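/- **Families.** Let $k\in\{3,4,6\}$ and let $h\ge 1$ be an integer. A family of near prime-order MNT curves with embedding degree $k$ and cofactor $h$ is a triple of integer polynomials $(t,r,q)$ such that $t(x)=ax+b$ with $a,b\in\mathbb Z$, $a\neq 0$; $\Phi_k(t(x)-1)=d\,r(x)$ with $d$ a positive integer, $d\le 4h$, and $r$ irreducible in $\mathbb Z[x]$; and $q(x)=h\,r(x)+t(x)-1$ is irreducible in $\mathbb Z[x]$. Put $\varepsilon=1,2,3$ for $k=3,4,6$ respectively, and $$u=d(4h-d),\quad w_0=a(4h-d),\quad w_1=b(4h-d)-2(\varepsilon h-d),\quad w_2=4h(4-\varepsilon)(\varepsilon h-d),$$ $$\Delta(x)=(w_0x+w_1)^2+w_2,\qquad \Delta_0(x)=\Delta(x)/u=4q(x)-t(x)^2\in\mathbb Z[x].$$ For real $z$ let $E(z)\in\mathbb N\cup\{\infty\}$ be the number of curves of the family with CM discriminant less than $z$, the curves (up to isogeny) being counted by their parameter: $E(z)$ is the number of positive integers $n$ such that $q(n)$ and $r(n)$ are primes, $q(n)\nmid t(n)$, $q(n)$ has multiplicative order $k$ modulo $r(n)$, and $4q(n)-t(n)^2=Dm^2$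 with an integer $m\ge1$ and a squarefree integer $0<D<z$. **Generalized Bateman–Horn conjecture.** Let $f_1,\dots,f_s,g\in\mathbb Z[x]$ be distinct, nonconstant, irreducible, with positive leading coefficients, such that $f_1\cdots f_s\,g$ has no fixed prime divisor. For $m\ge1$ and $\beta\in\mathbb Z$ with $m^2\mid g(\beta)$, let $N_p$ be the number of $j \bmod p^2$ such that $n=\beta+jm^2$ satisfies $(f_1(n)\cdots f_s(n))^2\,g(n)/m^2\equiv0 \pmod{p^2}$. Then, for every fixed $\delta\in(0,1)$, as $X\to\infty$, the number of positive integers $n\le X$, $n\equiv\beta \pmod{m^2}$, such that all $f_i(n)$ are prime and $g(n)/m^2$ is a squarefree integer is $$(1+o(1))\prod_p\Big(1-\frac{N_p}{p^2}\Big)\Big(1-\frac1p\Big)^{-s}\cdot\frac{X/m^2}{\prod_i(\deg f_i\cdot\log X)},$$ uniformly in all $m,\beta$ with $m^2\mid g(\beta)$, $m^2\le X^{1-\delta}$, and $N_p<p^2$ for all primes $p$. **Theorem.** Assume the generalized Bateman–Horn conjecture. Let $(t,r,q)$ be a family as above such that $\Delta$ is irreducible over $\mathbb Q$ and the product $r(n)q(n)\Delta_0(n)$,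 $n\in\mathbb Z$, has no fixed prime divisor. For a prime $p$ let $C_p$ be the number of $n \bmod p^2$ with $(q(n)r(n))^2\Delta_0(n)\equiv 0\pmod {p^2}$, let $\rho(p)$ be the number of $n\bmod p^2$ with $\Delta_0(n)\equiv0\pmod{p^2}$ and $p\nmid q(n)r(n)$, and put $$f(p)=\Big(1-\frac1p\Big)^2\Big(1-\frac{C_p}{p^2}\Big)^{-1}\rho(p).$$ Then the Euler products $$\mathfrak S_1=\prod_p\Big(1-\frac{C_p}{p^2}\Big)\Big(1-\frac1p\Big)^{-2},\qquad \mathfrak S_2=\prod_p\Big(1-\frac1p\Big)\Big(1+\frac{f(p)}p\Big)$$ converge (as limits of the products over $p\le N$, $N\to\infty$), and $$E(z)\ \ge\ (\mathfrak S_0+o(1))\,\frac{\sqrt z}{\log z}\qquad(z\to\infty),\qquad \mathfrak S_0=\frac{\sqrt u}{4|w_0|}\,\mathfrak S_1\mathfrak S_2 .$$ -/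

import Mathlib

open Filter Topology Polynomial
open scoped ENNReal

noncomputable section

/-- `∏_p F p = L`, the product over all primes taken in increasing order (the products below
converge only conditionally). -/
def HasEulerProduct (F : ℕ → ℝ) (L : ℝ) : Prop :=
  Tendsto (fun N : ℕ => ∏ p ∈ (Finset.range (N + 1)).filter Nat.Prime, F p) atTop (𝓝 L)

/-- No prime divides all the values of `f` at the integers. -/
def NoFixedPrimeDivisor (f : ℤ[X]) : Prop :=
  ∀ p : ℕ, p.Prime → ∃ n : ℤ, ¬ (p : ℤ) ∣ f.eval n

/-- The value of `f` at `n` is a (positive) prime number. -/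
def PrimeValue (f : ℤ[X]) (n : ℤ) : Prop :=
  (f.eval n).toNat.Prime

/-! ### The generalized Bateman-Horn conjecture -/

/-- The number of residues `j` modulo `p ^ 2` such that `n = β + j m ^ 2` satisfies
`(f₁(n) ⋯ fₛ(n)) ^ 2 * (g(n) / m ^ 2) ≡ 0 mod p ^ 2`; it is used only when `m ^ 2 ∣ g(β)`, so that
the division is exact. -/
def localCount {s : ℕ} (f : Fin s → ℤ[X]) (g : ℤ[X]) (m : ℕ) (β : ℤ) (p : ℕ) : ℕ :=
  ((Finset.range (p ^ 2)).filter fun j : ℕ =>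
    (p : ℤ) ^ 2 ∣ (∏ i, (f i).eval (β + j * (m : ℤ) ^ 2)) ^ 2 *
      (g.eval (β + j * (m : ℤ) ^ 2) / (m : ℤ) ^ 2)).card

/-- The number of positive integers `n ≤ X` in the residue class of `β` modulo `m ^ 2` such that
`f₁(n), …, fₛ(n)` are primes and `g(n) / m ^ 2` is a squarefree integer. -/
def primeSquarefreeCount {s : ℕ} (f : Fin s → ℤ[X]) (g : ℤ[X]) (m : ℕ) (β : ℤ) (X : ℝ) : ℕ :=
  Set.ncard {n : ℕ | 0 < n ∧ (n : ℝ) ≤ X ∧ (n : ℤ) ≡ β [ZMOD (m : ℤ) ^ 2] ∧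
    (∀ i, PrimeValue (f i) n) ∧ ∃ D : ℤ, Squarefree D ∧ g.eval (n : ℤ) = D * (m : ℤ) ^ 2}

/-- The generalized Bateman-Horn conjecture: for distinct irreducible `f₁, …, fₛ, g` with positive
leading coefficients whose product has no fixed prime divisor, the count above is asymptotic to
`𝔖 (X / m ^ 2) / ∏ (deg fᵢ · log X)` with
`𝔖 = ∏_p (1 - N_p / p ^ 2) (1 - 1 / p) ^ (-s)` and `N_p` the local count. The asymptotic is
uniform in the progressions `β mod m ^ 2` with `m ^ 2 ∣ g(β)`, with no local obstruction
(`N_p < p ^ 2` for all `p`), and with modulus `m ^ 2 ≤ X ^ (1 - δ)`, for each fixed `δ > 0`. -/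
def GeneralizedBatemanHorn : Prop :=
  ∀ (s : ℕ) (f : Fin s → ℤ[X]) (g : ℤ[X]),
    (∀ i, Irreducible (f i) ∧ 0 < (f i).natDegree ∧ 0 < (f i).leadingCoeff) →
    (Irreducible g ∧ 0 < g.natDegree ∧ 0 < g.leadingCoeff) →
    Function.Injective f → (∀ i, f i ≠ g) →
    NoFixedPrimeDivisor ((∏ i, f i) * g) →
    ∀ δ : ℝ, 0 < δ → δ < 1 → ∀ ε : ℝ, 0 < ε → ∃ X₀ : ℝ, ∀ X : ℝ, X₀ ≤ X →
      ∀ (m : ℕ) (β : ℤ), 0 < m → (m : ℝ) ^ 2 ≤ X ^ (1 - δ) → (m : ℤ) ^ 2 ∣ g.eval β →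
        (∀ p : ℕ, p.Prime → localCount f g m β p < p ^ 2) →
        ∀ S : ℝ,
          HasEulerProduct (fun p => (1 - (localCount f g m β p : ℝ) / (p : ℝ) ^ 2) *
            ((1 - 1 / (p : ℝ)) ^ s)⁻¹) S →
          |(primeSquarefreeCount f g m β X : ℝ) -
              S * (X / (m : ℝ) ^ 2) / ∏ i, (((f i).natDegree : ℝ) * Real.log X)| ≤
            ε * (S * (X / (m : ℝ) ^ 2) / ∏ i, (((f i).natDegree : ℝ) * Real.log X))

/-! ### Families of near prime-order MNT curves -/

/-- A family of near prime-order MNT curves with embedding degree `k ∈ {3, 4, 6}` and cofactor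
`h`: the trace is `t(x) = a x + b`, the prime factor of the order is the irreducible polynomial
`r(x)` with `Φ_k(t(x) - 1) = d r(x)`, and the field size is the polynomial
`q(x) = h r(x) + t(x) - 1`, which is irreducible. -/
structure MNTFamily where
  k : ℕ
  a : ℤ
  b : ℤ
  d : ℕ
  h : ℕ
  r : ℤ[X]
  hk : k = 3 ∨ k = 4 ∨ k = 6
  ha : a ≠ 0
  hh : 0 < h
  hd : d ≤ 4 * h
  r_irreducible : Irreducible r
  cyclotomic_eq : (cyclotomic k ℤ).comp (C a * X + C b - 1) = C (d : ℤ) * r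
  q_irreducible : Irreducible (C (h : ℤ) * r + (C a * X + C b) - 1)

namespace MNTFamily

variable (F : MNTFamily)

/-- The trace polynomial. -/
def t : ℤ[X] := C F.a * X + C F.b

/-- The field size polynomial. -/
def q : ℤ[X] := C (F.h : ℤ) * F.r + F.t - 1

/-- `ε`, so that `Φ_k(t - 1) = t ^ 2 - ε t + ε` with `ε = 1, 2, 3` for `k = 3, 4, 6`. -/
def epsilon : ℤ := if F.k = 3 then 1 else if F.k = 4 then 2 else 3

def u : ℤ := F.d * (4 * F.h - F.d)

def w0 : ℤ := F.a * (4 * F.h - F.d)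

def w1 : ℤ := F.b * (4 * F.h - F.d) - 2 * (F.epsilon * F.h - F.d)

def w2 : ℤ := 4 * F.h * (4 - F.epsilon) * (F.epsilon * F.h - F.d)

/-- The polynomial `Δ(x) = (w₀ x + w₁) ^ 2 + w₂` of the CM equation `Δ(x) = D u m ^ 2`. -/
def Delta : ℤ[X] := (C F.w0 * X + C F.w1) ^ 2 + C F.w2

/-- The polynomial `Δ₀ = Δ / u` of the CM equation in the form `4 q(x) - t(x) ^ 2 = D m ^ 2`. -/
def Delta0 : ℤ[X] := 4 * F.q - F.t ^ 2

theorem Delta_eq : F.Delta = C F.u * F.Delta0 := by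
  have key : F.t ^ 2 - C F.epsilon * F.t + C F.epsilon = C (F.d : ℤ) * F.r := by
    rw [← F.cyclotomic_eq]
    have c4 : cyclotomic 4 ℤ = X ^ 2 + 1 := by
      have h4 := cyclotomic_prime_pow_eq_geom_sum (R := ℤ) (n := 1) Nat.prime_two
      norm_num [Finset.sum_range_succ] at h4
      rw [h4]; ring
    rcases F.hk with h | h | h
    · simp only [h, epsilon, t, cyclotomic_three]
      simp
      ring
    · simp only [h, epsilon, t, c4]
      simp
      ring
    · simp only [h, epsilon, t, cyclotomic_six]
      simp
      ring
  simp only [Delta, Delta0, q, u, w0, w1, w2, t] at key ⊢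
  simp only [map_sub, map_mul, map_ofNat] at key ⊢
  linear_combination (4 * C (F.h : ℤ) * (4 * C (F.h : ℤ) - C (F.d : ℤ))) * key

/-- The curves of the family at the parameter `n` (the isogeny class over the field with `q(n)`
elements of trace `t(n)`) are ordinary with `q(n)` and `r(n)` prime and with embedding degree `k`
with respect to `r(n)`, and have CM discriminant `D`, the squarefree part of the positive integer
`4 q(n) - t(n) ^ 2`. -/
def IsCurve (n : ℤ) (D : ℕ) : Prop :=
  PrimeValue F.q n ∧ PrimeValue F.r n ∧ ¬ F.q.eval n ∣ F.t.eval n ∧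
    orderOf ((F.q.eval n : ℤ) : ZMod (F.r.eval n).toNat) = F.k ∧
    Squarefree D ∧ ∃ m : ℕ, 0 < m ∧ 4 * F.q.eval n - F.t.eval n ^ 2 = D * (m : ℤ) ^ 2

/-- `E(z)`: the number of curves of the family, counted by their positive integer parameter,
with CM discriminant less than `z`. -/
def E (z : ℝ) : ℕ∞ :=
  Set.encard {n : ℕ | 0 < n ∧ ∃ D : ℕ, (D : ℝ) < z ∧ F.IsCurve n D}

/-- `C_p`: the number of solutions of `(q(n) r(n)) ^ 2 Δ₀(n) ≡ 0 mod p ^ 2`. -/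
def Cp (p : ℕ) : ℕ :=
  ((Finset.range (p ^ 2)).filter fun n : ℕ =>
    (p : ℤ) ^ 2 ∣ (F.q.eval (n : ℤ) * F.r.eval (n : ℤ)) ^ 2 * F.Delta0.eval (n : ℤ)).card

/-- `ρ(p)`: the number of residues `n` modulo `p ^ 2` with `Δ₀(n) ≡ 0 mod p ^ 2` and
`q(n) r(n)` not divisible by `p`. -/
def rho (p : ℕ) : ℕ :=
  ((Finset.range (p ^ 2)).filter fun n : ℕ =>
    (p : ℤ) ^ 2 ∣ F.Delta0.eval (n : ℤ) ∧
      ¬ (p : ℤ) ∣ F.q.eval (n : ℤ) * F.r.eval (n : ℤ)).card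

/-- `f(p) = (1 - 1/p) ^ 2 (1 - C_p / p ^ 2)⁻¹ ρ(p)`. -/
def fp (p : ℕ) : ℝ :=
  (1 - 1 / (p : ℝ)) ^ 2 * (1 - (F.Cp p : ℝ) / (p : ℝ) ^ 2)⁻¹ * F.rho p

end MNTFamily

end

/-!
The integers `n` counted by `E(z)` are sorted by the square part `m ^ 2` of
`Δ₀(n) = 4 q(n) - t(n) ^ 2`. If `κ < √u / |w₀|` and `z` is large, then `n ≤ κ m √z` forces
`Δ₀(n) < z m ^ 2`, so the squarefree part is less than `z`; and for large `n` with `q(n)` and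
`r(n)` prime the remaining conditions on a curve are automatic, `q(n)` having order `k` modulo
`r(n)` as a root of the cyclotomic polynomial `Φ_k`. Since `m` and the residue of `n` modulo
`m ^ 2` are determined by `n`, this bounds `E(z)` from below by a sum, over `m ≤ z ^ θ` and over
the residues `β` modulo `m ^ 2` with `m ^ 2 ∣ Δ₀(β)`, of counts to which the generalized
Bateman-Horn conjecture applies (`MNTFamily.exists_sum_primeSquarefreeCount_le_E`). For
`θ < 1 / 2` the moduli stay in its range of uniformity, because `X = κ m √z` grows with `m`.

The singular series of the progression `β` modulo `m ^ 2` differs from `𝔖₁` at the primes dividing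
`m` only. By the Chinese remainder theorem (`sum_prod_local_density`) the sum over `β` of these
local corrections is `G(m)`, where `G` is multiplicative and its value at `p ^ k` is expressed by
the numbers of roots of `Δ₀` modulo `p ^ (2 k)` and `p ^ (2 k + 2)`
(`MNTFamily.sum_prod_localRatio`, `MNTFamily.gamma_eq`). The total is therefore
`(κ √z / 4) 𝔖₁ ∑_{m ≤ z ^ θ} G(m) / (m log² (κ m √z))`.

The numbers of roots are bounded, and at almost all primes the number of roots modulo `p` of an
irreducible quadratic polynomial is `1 + e(p)` with a nontrivial real character `e`. Hence `G` is
the convolution of `1`, of such a character, and of a function `K` with `∑ |K(d)| / d` finite, and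
`∑_{m ≤ x} G(m) / m ∼ c log x` with `c = ∏_p (1 - 1 / p) ∑_j G(p ^ j) / p ^ j`
(`ArithmeticFunction.exists_tendsto_sum_divId_ofLocal_div_log`). A telescoping estimate of each
factor gives `c ≥ 𝔖₂` (`MNTFamily.exists_tendsto_sum_gamma`). Partial summation in the form of a
Riemann sum (`exists_le_sum_div_log_sq`) shows that the sum over `m` is at least
`(c - o(1)) / log z` as `θ` tends to `1 / 2`, and `κ` may be taken as close to `√u / |w₀|` as
desired.

All Euler products converge conditionally only. Their convergence rests on that of `∑ e(p) / p`
and of `∏ (1 - e(p) / p)` for nontrivial real characters `e`, which follows from `L(1, e) ≠ 0` by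
Mertens' argument and Abel's theorem.
-/

/-! ### Partial summation -/

/-- Abel's inequality. -/
theorem norm_sum_Ico_mul_le {c : ℕ → ℂ} {b : ℕ → ℝ} {B : ℝ} {M : ℕ}
    (hc : ∀ n ≥ M, ‖∑ k ∈ Finset.Ico M n, c k‖ ≤ B) (hb : ∀ n ≥ M, b (n + 1) ≤ b n)
    (hb0 : ∀ n ≥ M, 0 ≤ b n) {N : ℕ} (hMN : M ≤ N) :
    ‖∑ k ∈ Finset.Ico M N, (b k : ℂ) * c k‖ ≤ B * b M := by
  have key : ∀ N ≥ M, ∑ k ∈ Finset.Ico M N, (b k : ℂ) * c k =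
      b N * ∑ k ∈ Finset.Ico M N, c k +
        ∑ k ∈ Finset.Ico M N, ((b k - b (k + 1) : ℝ) : ℂ) * ∑ j ∈ Finset.Ico M (k + 1), c j := by
    intro N hN
    induction N, hN using Nat.le_induction with
    | base => simp
    | succ n hn ih =>
      rw [Finset.sum_Ico_succ_top hn, ih, Finset.sum_Ico_succ_top hn
        (fun k => ((b k - b (k + 1) : ℝ) : ℂ) * ∑ j ∈ Finset.Ico M (k + 1), c j),
        Finset.sum_Ico_succ_top hn c]
      push_cast
      ring
  have tele : ∀ N ≥ M, ∑ k ∈ Finset.Ico M N, (b k - b (k + 1)) = b M - b N := by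
    intro N hN
    induction N, hN using Nat.le_induction with
    | base => simp
    | succ n hn ih => rw [Finset.sum_Ico_succ_top hn, ih]; ring
  rw [key N hMN]
  calc _ ≤ ‖(b N : ℂ) * ∑ k ∈ Finset.Ico M N, c k‖ + ∑ k ∈ Finset.Ico M N,
        ‖((b k - b (k + 1) : ℝ) : ℂ) * ∑ j ∈ Finset.Ico M (k + 1), c j‖ :=
        (norm_add_le _ _).trans (add_le_add le_rfl (norm_sum_le _ _))
    _ ≤ b N * B + ∑ k ∈ Finset.Ico M N, (b k - b (k + 1)) * B := by
        refine add_le_add ?_ (Finset.sum_le_sum fun k hk => ?_)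
        · rw [norm_mul, Complex.norm_real, Real.norm_of_nonneg (hb0 N hMN)]
          exact mul_le_mul_of_nonneg_left (hc N hMN) (hb0 N hMN)
        · have hk' := (Finset.mem_Ico.mp hk).1
          rw [norm_mul, Complex.norm_real, Real.norm_of_nonneg (sub_nonneg.mpr (hb k hk'))]
          exact mul_le_mul_of_nonneg_left (hc _ (by omega)) (sub_nonneg.mpr (hb k hk'))
    _ = B * b M := by rw [← Finset.sum_mul, tele N hMN]; ring

/-- Abel's theorem for Dirichlet series: a convergent series `∑ a n` is the limit of
`∑ a n / n ^ s` as `s` tends to `0` from the right. -/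
theorem tendsto_tsum_rpow_neg_mul {a : ℕ → ℂ} {A : ℂ}
    (h : Tendsto (fun N => ∑ k ∈ Finset.range N, a k) atTop (𝓝 A)) (ha0 : a 0 = 0)
    (hs : ∀ s : ℝ, 0 < s → Summable fun n : ℕ => (((n : ℝ) ^ (-s) : ℝ) : ℂ) * a n) :
    Tendsto (fun s : ℝ => ∑' n : ℕ, (((n : ℝ) ^ (-s) : ℝ) : ℂ) * a n) (𝓝[>] 0) (𝓝 A) := by
  rw [Metric.tendsto_nhds]
  intro ε hε
  obtain ⟨M₀, hM₀⟩ := Metric.cauchySeq_iff.mp h.cauchySeq (ε / 4) (by positivity)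
  set M := max M₀ 1
  have hM : ∀ n ≥ M, ‖∑ k ∈ Finset.Ico M n, a k‖ ≤ ε / 4 := by
    intro n hn
    rw [Finset.sum_Ico_eq_sub _ hn, ← dist_eq_norm]
    exact (hM₀ n ((le_max_left _ _).trans hn) M (le_max_left _ _)).le
  have hA : ‖A - ∑ k ∈ Finset.range M, a k‖ ≤ ε / 4 := by
    refine le_of_tendsto ((h.sub_const _).norm) ?_
    filter_upwards [eventually_ge_atTop M] with n hn
    rw [← Finset.sum_Ico_eq_sub _ hn]
    exact hM n hn
  have htail : ∀ s : ℝ, 0 < s → ‖∑' n : ℕ, (((n : ℝ) ^ (-s) : ℝ) : ℂ) * a n -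
      ∑ k ∈ Finset.range M, (((k : ℝ) ^ (-s) : ℝ) : ℂ) * a k‖ ≤ ε / 4 := by
    intro s hs0
    refine le_of_tendsto (((hs s hs0).hasSum.tendsto_sum_nat.sub_const _).norm) ?_
    filter_upwards [eventually_ge_atTop M] with n hn
    rw [← Finset.sum_Ico_eq_sub _ hn]
    have hM1 : 1 ≤ M := le_max_right _ _
    refine (norm_sum_Ico_mul_le (b := fun n : ℕ => (n : ℝ) ^ (-s)) hM ?_ ?_ hn).trans ?_
    · intro k hk
      have : (0 : ℝ) < k := by exact_mod_cast lt_of_lt_of_le hM1 hk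
      exact Real.rpow_le_rpow_of_nonpos this (by push_cast; linarith) (by linarith)
    · intro k _
      positivity
    · have : ((M : ℕ) : ℝ) ^ (-s) ≤ 1 :=
        Real.rpow_le_one_of_one_le_of_nonpos (by exact_mod_cast hM1) (by linarith)
      nlinarith
  have hfin : Tendsto (fun s : ℝ => ∑ k ∈ Finset.range M, (((k : ℝ) ^ (-s) : ℝ) : ℂ) * a k)
      (𝓝[>] 0) (𝓝 (∑ k ∈ Finset.range M, a k)) := by
    refine tendsto_finsetSum _ fun k _ => ?_
    rcases Nat.eq_zero_or_pos k with rfl | hk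
    · simp [ha0]
    · have hk' : (k : ℝ) ≠ 0 := by positivity
      have : Tendsto (fun s : ℝ => (k : ℝ) ^ (-s)) (𝓝[>] 0) (𝓝 ((k : ℝ) ^ (-(0 : ℝ)))) :=
        ((Real.continuousAt_const_rpow hk').tendsto.comp
          (continuous_neg.tendsto 0)).mono_left nhdsWithin_le_nhds
      simp only [neg_zero, Real.rpow_zero] at this
      simpa using ((Complex.continuous_ofReal.tendsto 1).comp this).mul_const (a k)
  filter_upwards [Metric.tendsto_nhds.mp hfin (ε / 4) (by positivity), self_mem_nhdsWithin]
    with s h1 h2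
  have h3 := htail s h2
  rw [dist_eq_norm] at h1 ⊢
  set T := ∑' n : ℕ, (((n : ℝ) ^ (-s) : ℝ) : ℂ) * a n
  set U := ∑ k ∈ Finset.range M, (((k : ℝ) ^ (-s) : ℝ) : ℂ) * a k
  set V := ∑ k ∈ Finset.range M, a k
  calc ‖T - A‖ = ‖(T - U) + (U - V) - (A - V)‖ := by congr 1; ring
    _ ≤ ‖T - U‖ + ‖U - V‖ + ‖A - V‖ := (norm_sub_le _ _).trans (by gcongr; exact norm_add_le _ _)
    _ < ε := by linarith

/-- Dirichlet's test, with a rate of convergence. -/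
theorem exists_tendsto_sum_mul_of_antitone {c : ℕ → ℂ} {b : ℕ → ℝ} {B : ℝ} {n₀ : ℕ}
    (hc : ∀ M n : ℕ, M ≤ n → ‖∑ k ∈ Finset.Ico M n, c k‖ ≤ B)
    (hb : ∀ n ≥ n₀, b (n + 1) ≤ b n) (hb0 : Tendsto b atTop (𝓝 0)) :
    ∃ L : ℂ, Tendsto (fun N => ∑ k ∈ Finset.range N, (b k : ℂ) * c k) atTop (𝓝 L) ∧
      ∀ N ≥ n₀, ‖∑ k ∈ Finset.range N, (b k : ℂ) * c k - L‖ ≤ B * b N := by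
  have hanti : ∀ m n, n₀ ≤ m → m ≤ n → b n ≤ b m := by
    intro m n hm hmn
    induction n, hmn using Nat.le_induction with
    | base => exact le_rfl
    | succ k hk ih => exact (hb k (hm.trans hk)).trans ih
  have hpos : ∀ n ≥ n₀, 0 ≤ b n := fun n hn =>
    le_of_tendsto hb0 (by filter_upwards [eventually_ge_atTop n] with k hk using hanti n k hn hk)
  have hbd : ∀ M ≥ n₀, ∀ N ≥ M, ‖∑ k ∈ Finset.Ico M N, (b k : ℂ) * c k‖ ≤ B * b M :=
    fun M hM N hN => norm_sum_Ico_mul_le (fun n hn => hc M n hn)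
      (fun n hn => hb n (hM.trans hn)) (fun n hn => hpos n (hM.trans hn)) hN
  have hcau : CauchySeq (fun N => ∑ k ∈ Finset.range N, (b k : ℂ) * c k) := by
    refine Metric.cauchySeq_iff'.mpr fun ε hε => ?_
    have h0 : Tendsto (fun n => B * b n) atTop (𝓝 0) := by simpa using hb0.const_mul B
    obtain ⟨N, hN, hN'⟩ := ((h0.eventually (gt_mem_nhds hε)).and (eventually_ge_atTop n₀)).exists
    refine ⟨N, fun n hn => ?_⟩
    rw [dist_eq_norm, ← Finset.sum_Ico_eq_sub _ hn]
    exact (hbd N hN' n hn).trans_lt hN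
  obtain ⟨L, hL⟩ := cauchySeq_tendsto_of_complete hcau
  refine ⟨L, hL, fun N hN => ?_⟩
  rw [norm_sub_rev]
  refine le_of_tendsto ((hL.sub_const _).norm) ?_
  filter_upwards [eventually_ge_atTop N] with n hn
  rw [← Finset.sum_Ico_eq_sub _ hn]
  exact hbd N hN n hn

/-! ### Dirichlet characters at `s = 1` -/

section Character

variable {N : ℕ} [NeZero N] {χ : DirichletCharacter ℂ N}

theorem norm_sum_Ico_character_le (hχ : χ ≠ 1) (M n : ℕ) (hMn : M ≤ n) :
    ‖∑ k ∈ Finset.Ico M n, χ k‖ ≤ N := by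
  have hper : ∀ M, ∑ k ∈ Finset.Ico M (M + N), χ k = 0 := by
    intro M
    induction M with
    | zero =>
      rw [← χ.sum_eq_zero_of_ne_one hχ]
      refine Finset.sum_nbij' (fun k : ℕ => (k : ZMod N)) ZMod.val (by simp) ?_ ?_ (by simp)
        (by simp)
      · intro a _
        simpa using ZMod.val_lt a
      · intro k hk
        exact ZMod.val_cast_of_lt (by simpa using hk)
    | succ M ih =>
      have hN : 0 < N := Nat.pos_of_ne_zero (NeZero.ne N)
      rw [Finset.sum_eq_sum_Ico_succ_bot (by omega)] at ih
      rw [show M + 1 + N = M + N + 1 by ring, Finset.sum_Ico_succ_top (by omega)]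
      rw [← ih]
      push_cast
      rw [ZMod.natCast_self, add_zero, add_comm]
  induction n using Nat.strong_induction_on with
  | _ n ih =>
    by_cases h : M + N ≤ n
    · have hN : 0 < N := Nat.pos_of_ne_zero (NeZero.ne N)
      have := ih (n - N) (by omega) (by omega)
      rw [← Finset.sum_Ico_consecutive _ (show M ≤ n - N by omega) (show n - N ≤ n by omega)]
      have h2 := hper (n - N)
      rw [Nat.sub_add_cancel (by omega)] at h2
      rwa [h2, add_zero]
    · calc _ ≤ ∑ k ∈ Finset.Ico M n, ‖χ k‖ := norm_sum_le _ _
        _ ≤ ∑ k ∈ Finset.Ico M n, (1 : ℝ) := Finset.sum_le_sum fun k _ => χ.norm_le_one _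
        _ ≤ N := by
          simp only [Finset.sum_const, Nat.card_Ico, nsmul_eq_mul, mul_one]
          exact_mod_cast (by omega : n - M ≤ N)

/-- The series `∑ χ(n) / n` converges to `L(1, χ)`, and its tails are `O(1 / n)`. -/
theorem tendsto_sum_character_div (hχ : χ ≠ 1) :
    Tendsto (fun n => ∑ k ∈ Finset.range n, (((k : ℝ)⁻¹ : ℝ) : ℂ) * χ k) atTop
        (𝓝 (χ.LFunction 1)) ∧
      ∀ n ≥ 1, ‖∑ k ∈ Finset.range n, (((k : ℝ)⁻¹ : ℝ) : ℂ) * χ k - χ.LFunction 1‖ ≤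
        N * (n : ℝ)⁻¹ := by
  obtain ⟨L, hL, hL'⟩ := exists_tendsto_sum_mul_of_antitone (n₀ := 1)
    (norm_sum_Ico_character_le hχ) (b := fun n : ℕ => (n : ℝ)⁻¹)
    (fun n hn => by
      have : (0 : ℝ) < n := by exact_mod_cast hn
      exact inv_anti₀ this (by push_cast; linarith))
    tendsto_inv_atTop_nhds_zero_nat
  have hterm : ∀ s : ℝ, 0 < s → ∀ n : ℕ,
      (((n : ℝ) ^ (-s) : ℝ) : ℂ) * ((((n : ℝ)⁻¹ : ℝ) : ℂ) * χ n) =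
        LSeries.term (χ ·) (1 + s : ℝ) n := by
    intro s hs n
    rcases Nat.eq_zero_or_pos n with rfl | hn
    · simp
    · have hn' : (0 : ℝ) < n := by exact_mod_cast hn
      rw [LSeries.term_of_ne_zero hn.ne', ← mul_assoc, ← Complex.ofReal_mul, ← Real.rpow_neg_one,
        ← Real.rpow_add hn', div_eq_mul_inv, mul_comm, ← Complex.cpow_neg]
      congr 1
      rw [Complex.ofReal_cpow hn'.le]
      congr 1
      push_cast; ring
  have hsum : ∀ s : ℝ, 0 < s → LSeriesSummable (χ ·) (1 + s : ℝ) := fun s hs =>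
    χ.LSeriesSummable_of_one_lt_re (by rw [Complex.ofReal_re]; linarith)
  have hA := tendsto_tsum_rpow_neg_mul hL (by simp) fun s hs => by
    simp only [hterm s hs]
    exact hsum s hs
  have hB : Tendsto (fun s : ℝ => χ.LFunction ((1 + s : ℝ) : ℂ)) (𝓝[>] 0) (𝓝 (χ.LFunction 1)) := by
    have hc : Continuous fun s : ℝ => χ.LFunction ((1 + s : ℝ) : ℂ) :=
      (DirichletCharacter.differentiable_LFunction hχ).continuous.comp (by fun_prop)
    simpa using (hc.tendsto 0).mono_left nhdsWithin_le_nhds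
  have : L = χ.LFunction 1 := by
    refine tendsto_nhds_unique hA (hB.congr' ?_)
    filter_upwards [self_mem_nhdsWithin] with s hs
    rw [DirichletCharacter.LFunction_eq_LSeries χ
      (by rw [Complex.ofReal_re]; linarith [Set.mem_Ioi.mp hs])]
    exact (tsum_congr (hterm s hs)).symm
  subst this
  exact ⟨hL, hL'⟩

/-- Mertens' estimate `∑_{n ≤ x} χ(n) Λ(n) / n = O(1)` for a nontrivial character. It rests on
`L(1, χ) ≠ 0`. -/
theorem exists_norm_sum_character_mul_vonMangoldt_div_le (hχ : χ ≠ 1) :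
    ∃ B : ℝ, ∀ n : ℕ, ‖∑ k ∈ Finset.Ioc 0 n,
      (((k : ℝ)⁻¹ : ℝ) : ℂ) * χ k * ArithmeticFunction.vonMangoldt k‖ ≤ B := by
  obtain ⟨-, hA⟩ := tendsto_sum_character_div hχ
  set L := χ.LFunction 1 with hLdef
  have hL0 : L ≠ 0 := DirichletCharacter.LFunction_apply_one_ne_zero hχ
  -- the series `∑ χ(n) log n / n` converges, so its partial sums are bounded
  obtain ⟨B₁, hB₁⟩ : ∃ B₁ : ℝ, ∀ n : ℕ, ‖∑ k ∈ Finset.range n,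
      ((Real.log k / k : ℝ) : ℂ) * χ k‖ ≤ B₁ := by
    obtain ⟨L', hL', -⟩ := exists_tendsto_sum_mul_of_antitone (n₀ := 3)
      (norm_sum_Ico_character_le hχ) (b := fun n : ℕ => Real.log n / n)
      (fun n hn => by
        have h3 : Real.exp 1 ≤ n :=
          Real.exp_one_lt_d9.le.trans (by have : (3 : ℝ) ≤ n := by exact_mod_cast hn
                                          linarith)
        exact Real.log_div_self_antitoneOn h3 (h3.trans (by push_cast; linarith))
          (by push_cast; linarith))
      ((Real.isLittleO_log_id_atTop.tendsto_div_nhds_zero).comp tendsto_natCast_atTop_atTop)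
    obtain ⟨B₁, hB₁⟩ := hL'.norm.bddAbove_range
    exact ⟨B₁, fun n => hB₁ ⟨n, rfl⟩⟩
  let F : ArithmeticFunction ℂ :=
    ⟨fun k => (((k : ℝ)⁻¹ : ℝ) : ℂ) * χ k * ArithmeticFunction.vonMangoldt k, by simp⟩
  let G : ArithmeticFunction ℂ := ⟨fun k => (((k : ℝ)⁻¹ : ℝ) : ℂ) * χ k, by simp⟩
  have hFG : ∀ n, (F * G) n = ((Real.log n / n : ℝ) : ℂ) * χ n := by
    intro n
    rw [ArithmeticFunction.mul_apply, ← ArithmeticFunction.vonMangoldt_sum,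
      ← Nat.sum_divisorsAntidiagonal (fun d _ => ArithmeticFunction.vonMangoldt d)]
    push_cast
    rw [Finset.sum_div, Finset.sum_mul]
    refine Finset.sum_congr rfl fun x hx => ?_
    have hn := (Nat.mem_divisorsAntidiagonal.mp hx).1
    simp only [F, G, ArithmeticFunction.coe_mk, ← hn]
    push_cast
    rw [map_mul, div_eq_mul_inv, mul_inv]
    ring
  refine ⟨(B₁ + N * (Real.log 4 + 4)) / ‖L‖, fun n => ?_⟩
  rw [le_div_iff₀ (norm_pos_iff.mpr hL0), ← norm_mul]
  have hsum := ArithmeticFunction.sum_Ioc_mul_eq_sum_sum F G n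
  simp only [hFG] at hsum
  have hIoc : ∀ (f : ℕ → ℂ) (n : ℕ), f 0 = 0 →
      ∑ k ∈ Finset.Ioc 0 n, f k = ∑ k ∈ Finset.range (n + 1), f k := by
    intro f n hf
    rw [Finset.range_eq_Ico, Finset.sum_eq_sum_Ico_succ_bot (by omega), hf, zero_add]
    rfl
  have hG : ∀ m, ‖∑ k ∈ Finset.Ioc 0 m, G k - L‖ ≤ N * ((m + 1 : ℕ) : ℝ)⁻¹ := by
    intro m
    rw [hIoc _ _ (by simp)]
    exact hA (m + 1) (by omega)
  -- sum `χ(n) log n / n = ∑_{d ∣ n} (χ(d) Λ(d) / d) (χ(n / d) / (n / d))` over `n`, and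
  -- complete the inner sums to `L(1, χ)`
  have hdiff : (∑ k ∈ Finset.Ioc 0 n, F k) * L = (∑ k ∈ Finset.Ioc 0 n,
      ((Real.log k / k : ℝ) : ℂ) * χ k) -
        ∑ k ∈ Finset.Ioc 0 n, F k * (∑ m ∈ Finset.Ioc 0 (n / k), G m - L) := by
    rw [hsum, ← Finset.sum_sub_distrib, Finset.sum_mul]
    exact Finset.sum_congr rfl fun k _ => by ring
  change ‖(∑ k ∈ Finset.Ioc 0 n, F k) * L‖ ≤ _
  rw [hdiff]
  refine (norm_sub_le _ _).trans (add_le_add ?_ ?_)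
  · rw [hIoc _ _ (by simp)]
    exact hB₁ _
  · rcases Nat.eq_zero_or_pos n with rfl | hn
    · simp; positivity
    have hn' : (0 : ℝ) < n := by exact_mod_cast hn
    calc _ ≤ ∑ k ∈ Finset.Ioc 0 n, ArithmeticFunction.vonMangoldt k * (N / n) := by
          refine (norm_sum_le _ _).trans (Finset.sum_le_sum fun k hk => ?_)
          have hk0 : (0 : ℝ) < k := by exact_mod_cast (Finset.mem_Ioc.mp hk).1
          rw [norm_mul]
          have h1 : ‖F k‖ ≤ (k : ℝ)⁻¹ * ArithmeticFunction.vonMangoldt k := by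
            simp only [F, ArithmeticFunction.coe_mk, norm_mul, Complex.norm_real,
              Real.norm_of_nonneg (inv_nonneg.mpr hk0.le),
              Real.norm_of_nonneg ArithmeticFunction.vonMangoldt_nonneg]
            gcongr
            · exact mul_le_of_le_one_right (by positivity) (χ.norm_le_one _)
          have h2 : ((n / k + 1 : ℕ) : ℝ)⁻¹ ≤ k / n := by
            rw [inv_le_comm₀ (by positivity) (by positivity), inv_div]
            rw [div_le_iff₀ hk0]
            have := Nat.lt_div_mul_add (a := n) (b := k) (by exact_mod_cast hk0)
            have : n ≤ (n / k + 1) * k := by nlinarith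
            exact_mod_cast this
          calc ‖F k‖ * _ ≤ ((k : ℝ)⁻¹ * ArithmeticFunction.vonMangoldt k) * (N * (k / n)) :=
                mul_le_mul h1 ((hG _).trans (by gcongr)) (norm_nonneg _)
                  (mul_nonneg (by positivity) ArithmeticFunction.vonMangoldt_nonneg)
            _ = _ := by field_simp
      _ = Chebyshev.psi n * (N / n) := by
          rw [← Finset.sum_mul, Chebyshev.psi, Nat.floor_natCast]
      _ ≤ (Real.log 4 + 4) * n * (N / n) := by
          gcongr
          exact Chebyshev.psi_le_const_mul_self hn'.le
      _ = _ := by field_simp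

/-- The proper prime powers contribute an absolutely convergent part to `∑ Λ(n) / n`. -/
theorem summable_vonMangoldt_not_prime_div :
    Summable fun n : ℕ => (if n.Prime then 0 else ArithmeticFunction.vonMangoldt n) / (n : ℝ) := by
  have h := ArithmeticFunction.vonMangoldt.summable_residueClass_non_primes_div (a := (0 : ZMod 1))
  refine h.congr fun n => ?_
  split_ifs with hp
  · rfl
  · congr 1
    simp only [ArithmeticFunction.vonMangoldt.residueClass]
    rw [Set.indicator_of_mem]
    exact Subsingleton.elim _ _

/-- The series `∑ χ(p) / p` over the primes converges for a nontrivial character. -/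
theorem exists_tendsto_sum_prime_character_div (hχ : χ ≠ 1) :
    ∃ l : ℂ, Tendsto (fun n => ∑ k ∈ Finset.range n,
      if k.Prime then (((k : ℝ)⁻¹ : ℝ) : ℂ) * χ k else 0) atTop (𝓝 l) := by
  obtain ⟨B, hB⟩ := exists_norm_sum_character_mul_vonMangoldt_div_le hχ
  set c : ℕ → ℂ := fun k => (((k : ℝ)⁻¹ : ℝ) : ℂ) * χ k * ArithmeticFunction.vonMangoldt k
    with hcdef
  have hc : ∀ M n : ℕ, M ≤ n → ‖∑ k ∈ Finset.Ico M n, c k‖ ≤ 2 * B := by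
    have hr : ∀ n, ‖∑ k ∈ Finset.range n, c k‖ ≤ B := by
      intro n
      rcases n with _ | n
      · simpa using (norm_nonneg _).trans (hB 0)
      · rw [Finset.range_eq_Ico, Finset.sum_eq_sum_Ico_succ_bot (by omega)]
        simp only [hcdef, Nat.cast_zero, inv_zero, Complex.ofReal_zero, zero_mul, zero_add]
        exact hB n
    intro M n hMn
    rw [Finset.sum_Ico_eq_sub _ hMn]
    exact (norm_sub_le _ _).trans (by linarith [hr M, hr n])
  obtain ⟨l, hl, -⟩ := exists_tendsto_sum_mul_of_antitone (n₀ := 2) hc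
    (b := fun n : ℕ => (Real.log n)⁻¹)
    (fun n hn => by
      have : (2 : ℝ) ≤ n := by exact_mod_cast hn
      exact inv_anti₀ (Real.log_pos (by linarith)) (Real.log_le_log (by linarith)
        (by push_cast; linarith)))
    ((tendsto_inv_atTop_zero.comp Real.tendsto_log_atTop).comp tendsto_natCast_atTop_atTop)
  have hs : Summable fun k : ℕ => if k.Prime then 0 else (((Real.log k)⁻¹ : ℝ) : ℂ) * c k := by
    refine Summable.of_norm_bounded
      (g := fun k : ℕ => (Real.log 2)⁻¹ *
        ((if k.Prime then 0 else ArithmeticFunction.vonMangoldt k) / (k : ℝ)))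
      (summable_vonMangoldt_not_prime_div.mul_left _) fun k => ?_
    split_ifs with hp
    · simp
    · rcases Nat.lt_or_ge k 2 with hk | hk
      · interval_cases k <;> simp [hcdef]
      · have hk' : (2 : ℝ) ≤ k := by exact_mod_cast hk
        have hlog : 0 < Real.log k := Real.log_pos (by linarith)
        simp only [hcdef, norm_mul, Complex.norm_real,
          Real.norm_of_nonneg ArithmeticFunction.vonMangoldt_nonneg, Real.norm_of_nonneg
          (inv_nonneg.mpr hlog.le),
          Real.norm_of_nonneg (inv_nonneg.mpr (by linarith : (0 : ℝ) ≤ k))]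
        have h1 : (Real.log k)⁻¹ ≤ (Real.log 2)⁻¹ :=
          inv_anti₀ (Real.log_pos (by norm_num)) (Real.log_le_log (by norm_num) hk')
        have h2 := χ.norm_le_one (k : ZMod N)
        have h3 : (0 : ℝ) ≤ ArithmeticFunction.vonMangoldt k :=
          ArithmeticFunction.vonMangoldt_nonneg
        calc _ ≤ (Real.log 2)⁻¹ * ((k : ℝ)⁻¹ * 1 * ArithmeticFunction.vonMangoldt k) := by
              gcongr
          _ = _ := by ring
  refine ⟨_, (hl.sub hs.hasSum.tendsto_sum_nat).congr fun n => ?_⟩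
  rw [← Finset.sum_sub_distrib]
  refine Finset.sum_congr rfl fun k _ => ?_
  split_ifs with hp
  · have hlog : (((Real.log k)⁻¹ : ℝ) : ℂ) * ((Real.log k : ℝ) : ℂ) = 1 := by
      rw [← Complex.ofReal_mul, inv_mul_cancel₀ (Real.log_pos (by exact_mod_cast hp.one_lt)).ne',
        Complex.ofReal_one]
    simp only [hcdef, ArithmeticFunction.vonMangoldt_apply_prime hp]
    linear_combination ((((k : ℝ)⁻¹ : ℝ) : ℂ) * χ k) * hlog
  · simp

/-- The logarithm of an Euler factor is its linear term up to a quadratic error, which is summable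
over the primes. -/
theorem norm_neg_log_one_sub_sub_le {z : ℂ} (hz : ‖z‖ ≤ 1 / 2) :
    ‖-Complex.log (1 - z) - z‖ ≤ ‖z‖ ^ 2 := by
  have h := Complex.norm_log_one_add_sub_self_le (z := -z) (by rw [norm_neg]; linarith)
  rw [norm_neg] at h
  have h2 : (1 - ‖z‖)⁻¹ ≤ 2 := by
    rw [inv_le_comm₀ (by linarith) (by norm_num)]
    linarith
  calc _ = ‖Complex.log (1 + -z) - -z‖ := by
        rw [← norm_neg]; congr 1; rw [← sub_eq_add_neg]; ring
    _ ≤ ‖z‖ ^ 2 * (1 - ‖z‖)⁻¹ / 2 := h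
    _ ≤ ‖z‖ ^ 2 * 2 / 2 := by gcongr
    _ = _ := by ring

/-- The Euler product of `L(1, χ)`, taken over the primes in increasing order. -/
theorem tendsto_prod_one_sub_character_div (hχ : χ ≠ 1) :
    Tendsto (fun n : ℕ => ∏ p ∈ (Finset.range n).filter Nat.Prime,
      (1 - (((p : ℝ)⁻¹ : ℝ) : ℂ) * χ p)) atTop (𝓝 (χ.LFunction 1)⁻¹) := by
  obtain ⟨l, hl⟩ := exists_tendsto_sum_prime_character_div hχ
  set z : ℕ → ℝ → ℂ := fun k s => (((k : ℝ) ^ (-(1 + s)) : ℝ) : ℂ) * χ k with hz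
  set e : ℕ → ℝ → ℂ := fun k s => if k.Prime then -Complex.log (1 - z k s) - z k s else 0 with he
  have hznorm : ∀ k : ℕ, k.Prime → ∀ s : ℝ, 0 ≤ s → ‖z k s‖ ≤ (k : ℝ)⁻¹ := by
    intro k hk s hs
    have hk1 : (1 : ℝ) ≤ k := by exact_mod_cast hk.one_le
    rw [hz, norm_mul, Complex.norm_real, Real.norm_of_nonneg (by positivity), ← Real.rpow_neg_one]
    calc _ ≤ (k : ℝ) ^ (-(1 + s)) * 1 := by gcongr; exact χ.norm_le_one _
      _ ≤ (k : ℝ) ^ (-1 : ℝ) := by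
        rw [mul_one]; exact Real.rpow_le_rpow_of_exponent_le hk1 (by linarith)
  have hzhalf : ∀ k : ℕ, k.Prime → ∀ s : ℝ, 0 ≤ s → ‖z k s‖ ≤ 1 / 2 := fun k hk s hs =>
    (hznorm k hk s hs).trans (by
      rw [one_div]
      exact inv_anti₀ (by norm_num) (by exact_mod_cast hk.two_le))
  have hebd : ∀ k : ℕ, ∀ s : ℝ, 0 ≤ s → ‖e k s‖ ≤ ((k : ℝ) ^ 2)⁻¹ := by
    intro k s hs
    simp only [he]
    split_ifs with hk
    · refine (norm_neg_log_one_sub_sub_le (hzhalf k hk s hs)).trans ?_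
      rw [← inv_pow]
      exact pow_le_pow_left₀ (norm_nonneg _) (hznorm k hk s hs) 2
    · rw [norm_zero]; positivity
  have hsum2 : Summable fun k : ℕ => ((k : ℝ) ^ 2)⁻¹ := Real.summable_nat_pow_inv.mpr one_lt_two
  have hE : Tendsto (fun s : ℝ => ∑' k, e k s) (𝓝[>] 0) (𝓝 (∑' k, e k 0)) := by
    refine tendsto_tsum_of_dominated_convergence hsum2 (fun k => ?_) ?_
    · simp only [he]
      split_ifs with hk
      · have hk0 : (k : ℝ) ≠ 0 := by exact_mod_cast hk.ne_zero
        have hzc : Tendsto (fun s => z k s) (𝓝[>] 0) (𝓝 (z k 0)) := by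
          have : Continuous fun s => z k s :=
            (Complex.continuous_ofReal.comp
              ((continuous_const.rpow (by fun_prop) (fun _ => Or.inl hk0)))).mul continuous_const
          exact (this.tendsto 0).mono_left nhdsWithin_le_nhds
        refine Tendsto.sub (Tendsto.neg (Tendsto.clog (tendsto_const_nhds.sub hzc) ?_)) hzc
        rw [sub_eq_add_neg]
        exact Complex.mem_slitPlane_of_norm_lt_one
          (by rw [norm_neg]; linarith [hzhalf k hk 0 le_rfl])
      · exact tendsto_const_nhds
    · filter_upwards [self_mem_nhdsWithin] with s hs k
      exact hebd k s (le_of_lt hs)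
  have hterm : ∀ s : ℝ, ∀ k : ℕ, (((k : ℝ) ^ (-s) : ℝ) : ℂ) *
      (if k.Prime then (((k : ℝ)⁻¹ : ℝ) : ℂ) * χ k else 0) = if k.Prime then z k s else 0 := by
    intro s k
    split_ifs with hk
    · rw [hz, ← mul_assoc, ← Complex.ofReal_mul, ← Real.rpow_neg_one,
        ← Real.rpow_add (by exact_mod_cast hk.pos)]
      congr 3; ring
    · simp
  have hsumz : ∀ s : ℝ, 0 < s → Summable fun k : ℕ => if k.Prime then z k s else 0 := by
    intro s hs
    refine Summable.of_norm_bounded (g := fun k : ℕ => (k : ℝ) ^ (-(1 + s)))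
      (Real.summable_nat_rpow.mpr (by linarith)) fun k => ?_
    split_ifs with hk
    · rw [hz, norm_mul, Complex.norm_real, Real.norm_of_nonneg (by positivity)]
      exact mul_le_of_le_one_right (by positivity) (χ.norm_le_one _)
    · rw [norm_zero]; positivity
  have hT := tendsto_tsum_rpow_neg_mul hl (by simp) fun s hs => by
    simpa only [hterm] using hsumz s hs
  simp only [hterm] at hT
  -- the limit of `log L(1 + s, χ) = ∑_p (-log (1 - χ(p) / p ^ (1 + s)))` as `s` tends to `0`
  have hexp : χ.LFunction 1 = Complex.exp (l + ∑' k, e k 0) := by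
    have hB : Tendsto (fun s : ℝ => χ.LFunction ((1 + s : ℝ) : ℂ)) (𝓝[>] 0)
        (𝓝 (χ.LFunction 1)) := by
      have hc : Continuous fun s : ℝ => χ.LFunction ((1 + s : ℝ) : ℂ) :=
        (DirichletCharacter.differentiable_LFunction hχ).continuous.comp (by fun_prop)
      simpa using (hc.tendsto 0).mono_left nhdsWithin_le_nhds
    refine tendsto_nhds_unique hB (((hT.add hE).cexp).congr' ?_)
    filter_upwards [self_mem_nhdsWithin] with s hs
    have hs : 0 < s := hs
    have hre : 1 < ((1 + s : ℝ) : ℂ).re := by rw [Complex.ofReal_re]; linarith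
    rw [DirichletCharacter.LFunction_eq_LSeries χ hre,
      ← DirichletCharacter.LSeries_eulerProduct_exp_log χ hre,
      ← (hsumz s hs).tsum_add (Summable.of_norm_bounded hsum2 fun k => hebd k s hs.le)]
    congr 1
    have := tsum_subtype {p : ℕ | p.Prime} (fun p : ℕ => -Complex.log (1 - z p s))
    calc _ = ∑' k : ℕ, Set.indicator {p : ℕ | p.Prime}
          (fun p : ℕ => -Complex.log (1 - z p s)) k := by
          refine tsum_congr fun k => ?_
          simp only [he, Set.indicator_apply, Set.mem_ofPred_eq]
          split_ifs <;> ring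
      _ = _ := by
          rw [← this]
          refine tsum_congr fun p => ?_
          simp only [hz]
          rw [Complex.ofReal_cpow (Nat.cast_nonneg _), mul_comm]
          push_cast
          rfl
  rw [hexp, ← Complex.exp_neg]
  have hesum : Summable fun k => e k 0 := Summable.of_norm_bounded hsum2 fun k => hebd k 0 le_rfl
  refine (((hl.add hesum.hasSum.tendsto_sum_nat).neg).cexp).congr fun n => ?_
  rw [← Finset.sum_add_distrib, ← Finset.sum_neg_distrib, Complex.exp_sum, Finset.prod_filter]
  refine Finset.prod_congr rfl fun k _ => ?_
  simp only [he]
  split_ifs with hk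
  · have hz0 : z k 0 = (((k : ℝ)⁻¹ : ℝ) : ℂ) * χ k := by
      simp only [hz, add_zero, Real.rpow_neg_one]
    rw [← hz0]
    rw [show -(z k 0 + (-Complex.log (1 - z k 0) - z k 0)) = Complex.log (1 - z k 0) by ring,
      Complex.exp_log]
    intro h
    have := hzhalf k hk 0 le_rfl
    rw [← sub_eq_zero.mp h, norm_one] at this
    norm_num at this
  · simp

end Character

/-! ### Real characters -/

/-- What is used of a nontrivial real Dirichlet character `e` with `L = L(1, e)`: complete
multiplicativity, the convergence of `∑ e(n) / n` with its rate, of `∑ e(p) / p`, and the Euler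
product of `L` over the primes in increasing order. -/
structure IsRealCharacter (e : ℕ → ℝ) (L : ℝ) : Prop where
  map_zero : e 0 = 0
  map_one : e 1 = 1
  map_mul : ∀ m n, e (m * n) = e m * e n
  abs_le_one : ∀ n, |e n| ≤ 1
  ne_zero : L ≠ 0
  tail : ∃ C : ℝ, ∀ n : ℕ, 1 ≤ n → |∑ k ∈ Finset.range n, (k : ℝ)⁻¹ * e k - L| ≤ C * (n : ℝ)⁻¹
  prod : Tendsto (fun n : ℕ => ∏ p ∈ (Finset.range n).filter Nat.Prime, (1 - (p : ℝ)⁻¹ * e p))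
    atTop (𝓝 L⁻¹)
  sum : ∃ l : ℝ, Tendsto (fun n : ℕ => ∑ p ∈ (Finset.range n).filter Nat.Prime, (p : ℝ)⁻¹ * e p)
    atTop (𝓝 l)

theorem tendsto_re_of_tendsto_ofReal {x : ℕ → ℝ} {z : ℂ}
    (h : Tendsto (fun n => (x n : ℂ)) atTop (𝓝 z)) :
    Tendsto x atTop (𝓝 z.re) ∧ (z.re : ℂ) = z := by
  have h1 : Tendsto x atTop (𝓝 z.re) := (Complex.continuous_re.tendsto z).comp h
  exact ⟨h1, tendsto_nhds_unique ((Complex.continuous_ofReal.tendsto _).comp h1) h⟩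

theorem exists_isRealCharacter {N : ℕ} [NeZero N] (ψ : MulChar (ZMod N) ℤ) (hψ : ψ ≠ 1) :
    ∃ L : ℝ, IsRealCharacter (fun n => if n = 0 then 0 else (ψ n : ℝ)) L := by
  set e : ℕ → ℝ := fun n => if n = 0 then 0 else (ψ n : ℝ) with he
  set χ : DirichletCharacter ℂ N := ψ.ringHomComp (Int.castRingHom ℂ) with hχdef
  have hχ : χ ≠ 1 := (MulChar.ringHomComp_ne_one_iff (RingHom.injective_int _)).mpr hψ
  have hval : ∀ k : ℕ, (((k : ℝ)⁻¹ : ℝ) : ℂ) * χ k = (((k : ℝ)⁻¹ * e k : ℝ) : ℂ) := by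
    intro k
    rcases eq_or_ne k 0 with rfl | hk
    · simp
    · simp [hχdef, he, hk]
  have hL0 := DirichletCharacter.LFunction_apply_one_ne_zero hχ
  obtain ⟨h1, h2⟩ := tendsto_sum_character_div hχ
  have h5 := tendsto_prod_one_sub_character_div hχ
  generalize χ.LFunction 1 = Lc at h1 h2 h5 hL0
  simp only [hval, ← Complex.ofReal_sum] at h1 h2
  obtain ⟨h3, h4⟩ := tendsto_re_of_tendsto_ofReal h1
  rw [← h4, ← Complex.ofReal_inv] at h5
  simp only [hval, ← Complex.ofReal_one, ← Complex.ofReal_sub, ← Complex.ofReal_prod] at h5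
  obtain ⟨h6, -⟩ := tendsto_re_of_tendsto_ofReal h5
  rw [Complex.ofReal_re] at h6
  obtain ⟨l, hl⟩ := exists_tendsto_sum_prime_character_div hχ
  have hl' : Tendsto (fun n : ℕ => ((∑ p ∈ (Finset.range n).filter Nat.Prime,
      (p : ℝ)⁻¹ * e p : ℝ) : ℂ)) atTop (𝓝 l) := by
    refine hl.congr fun n => ?_
    rw [Finset.sum_filter]
    rw [Complex.ofReal_sum]
    refine Finset.sum_congr rfl fun k _ => ?_
    split_ifs with hk
    · rw [hval]
    · rfl
  refine ⟨Lc.re, by simp [he], by simp [he], ?_, ?_, ?_, ⟨N, fun n hn => ?_⟩, h6,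
    ⟨l.re, (tendsto_re_of_tendsto_ofReal hl').1⟩⟩
  · intro m n
    rcases eq_or_ne m 0 with rfl | hm
    · simp [he]
    rcases eq_or_ne n 0 with rfl | hn
    · simp [he]
    simp [he, hm, hn]
  · intro n
    rcases eq_or_ne n 0 with rfl | hn
    · simp [he]
    have : ‖χ n‖ ≤ 1 := χ.norm_le_one _
    simp only [hχdef, MulChar.ringHomComp_apply, Int.coe_castRingHom, Complex.norm_intCast] at this
    simpa [he, hn] using this
  · intro h
    rw [h] at h4
    exact hL0 (by rw [← h4]; rfl)
  · have := h2 n hn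
    rwa [← h4, ← Complex.ofReal_sub, Complex.norm_real, Real.norm_eq_abs] at this

/-! ### The quadratic character of a discriminant -/

open scoped NumberTheorySymbols

/-- The symbol `J(D | ·)` is nontrivial: if an odd prime `l` divides the squarefree part of `D`,
take `n` congruent to a nonresidue modulo `l` and to `1` modulo `4` and the other primes, and use
reciprocity; otherwise a congruence condition modulo `8` suffices. -/
theorem exists_jacobiSym_eq_neg_one {D : ℤ} (hD : ¬ IsSquare D) :
    ∃ n : ℕ, Odd n ∧ n.Coprime D.natAbs ∧ J(D | n) = -1 := by
  have hD0 : D ≠ 0 := by rintro rfl; exact hD (IsSquare.zero)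
  obtain ⟨a, b, hab, hsq⟩ := Nat.sq_mul_squarefree D.natAbs
  have hb0 : b ≠ 0 := by rintro rfl; simp at hab; omega
  have ha0 : a ≠ 0 := by rintro rfl; simp at hab; omega
  obtain ⟨δ, hδ, hDδ⟩ : ∃ δ : ℤ, (δ = 1 ∨ δ = -1) ∧ D = δ * a * b ^ 2 := by
    rcases Int.natAbs_eq D with h | h
    · refine ⟨1, Or.inl rfl, ?_⟩
      rw [h, ← hab]; push_cast; ring
    · refine ⟨-1, Or.inr rfl, ?_⟩
      rw [h, ← hab]; push_cast; ring
  have hJ : ∀ n : ℕ, n.Coprime b → J(D | n) = J(δ * a | n) := by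
    intro n hn
    rw [hDδ, jacobiSym.mul_left, jacobiSym.sq_one', mul_one]
    simpa [Int.gcd_natCast_natCast] using hn.symm
  have hcop : ∀ n : ℕ, n.Coprime a → n.Coprime b → n.Coprime D.natAbs := by
    intro n h1 h2
    rw [← hab]
    exact (h2.pow_right 2).mul_right h1
  by_cases hodd : ∃ l : ℕ, l.Prime ∧ l ≠ 2 ∧ l ∣ a
  · obtain ⟨l, hl, hl2, a', rfl⟩ := hodd
    have hla : l.Coprime a' := Nat.coprime_of_squarefree_mul hsq
    have ha' : a' ≠ 0 := by rintro rfl; simp at ha0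
    have : Fact l.Prime := ⟨hl⟩
    obtain ⟨i, b', hb', rfl⟩ := Nat.exists_eq_pow_mul_and_not_dvd hb0 l hl.ne_one
    obtain ⟨x, hx⟩ := FiniteField.exists_nonsquare (F := ZMod l) (by rwa [ZMod.ringChar_zmod_n])
    have hl4 : l.Coprime 4 := by
      rw [hl.coprime_iff_not_dvd]
      intro h
      exact hl2 ((Nat.prime_dvd_prime_iff_eq hl Nat.prime_two).mp
        (hl.dvd_of_dvd_pow (n := 2) (by simpa using h)))
    have hc : l.Coprime (4 * a' * b') :=
      (hl4.mul_right hla).mul_right ((hl.coprime_iff_not_dvd).mpr hb')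
    obtain ⟨n, hn1, hn2⟩ := Nat.chineseRemainder hc x.val 1
    have hnx : ((n : ℕ) : ZMod l) = x := by
      rw [(ZMod.natCast_eq_natCast_iff _ _ _).mpr hn1, ZMod.natCast_zmod_val]
    have hn4 : n ≡ 1 [MOD 4] := hn2.of_dvd (Dvd.intro _ (mul_assoc _ _ _).symm)
    have hn4' : n % 4 = 1 := hn4
    have hnodd : Odd n := Nat.odd_iff.mpr (by omega)
    have hnl : n.Coprime l := by
      rw [Nat.coprime_comm, hl.coprime_iff_not_dvd, ← ZMod.natCast_eq_zero_iff, hnx]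
      rintro rfl
      exact hx IsSquare.zero
    have hna : n.Coprime (4 * a' * b') := by
      have := hn2.gcd_eq
      simpa [Nat.Coprime] using this
    have hnb : n.Coprime (l ^ i * b') :=
      (hnl.pow_right i).mul_right (hna.coprime_dvd_right (Dvd.intro_left _ rfl))
    have hnaa : n.Coprime a' :=
      hna.coprime_dvd_right (dvd_mul_of_dvd_left (Dvd.intro_left _ rfl) _)
    refine ⟨n, hnodd, hcop n (hnl.mul_right hnaa) hnb, ?_⟩
    rw [hJ n hnb, jacobiSym.mul_left]
    push_cast
    rw [jacobiSym.mul_left]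
    have e1 : J(δ | n) = 1 := by
      rcases hδ with rfl | rfl
      · exact jacobiSym.one_left n
      · rw [jacobiSym.at_neg_one hnodd, ZMod.χ₄_nat_one_mod_four hn4']
    have e2 : J(a' | n) = 1 := by
      rw [jacobiSym.mod_right _ hnodd]
      have h4 : n % (4 * (a' : ℤ).natAbs) = 1 % (4 * a') := by
        rw [Int.natAbs_natCast]
        exact hn2.of_dvd (Dvd.intro _ rfl)
      rw [h4, Nat.mod_eq_of_lt (by omega), jacobiSym.one_right]
    have e3 : J(l | n) = -1 := by
      rw [jacobiSym.quadratic_reciprocity_one_mod_four' (hl.odd_of_ne_two hl2) hn4',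
        ← jacobiSym.legendreSym.to_jacobiSym, legendreSym.eq_neg_one_iff]
      rw [Int.cast_natCast, hnx]
      exact hx
    rw [e1, e2, e3]; norm_num
  · push Not at hodd
    -- only the discriminants `-1`, `2`, `-2` remain, up to squares
    have ha12 : a = 1 ∨ a = 2 := by
      by_cases ha1 : a = 1
      · exact Or.inl ha1
      right
      have h2 : ∀ {q : ℕ}, q.Prime → q ∣ a → q = 2 := fun hq hqa => by
        by_contra h
        exact hodd _ hq h hqa
      obtain ⟨k, hk⟩ : ∃ k, a = 2 ^ k := ⟨_, Nat.eq_prime_pow_of_unique_prime_dvd ha0 h2⟩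
      rw [hk] at hsq ha1 ⊢
      have := (Nat.squarefree_pow_iff (by norm_num) (by rintro rfl; simp at ha1)).mp hsq
      rw [this.2]; norm_num
    obtain ⟨i, b', hb', rfl⟩ := Nat.exists_eq_pow_mul_and_not_dvd hb0 2 (by norm_num)
    have hc : Nat.Coprime 8 b' := by
      have : Nat.Coprime 2 b' := (Nat.prime_two.coprime_iff_not_dvd).mpr hb'
      exact this.pow_left 3
    have aux : ∀ r : ℕ, r % 2 = 1 → ∃ n : ℕ, n % 8 = r % 8 ∧ n % 2 = 1 ∧
        n.Coprime (2 ^ i * b') := by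
      intro r hr
      obtain ⟨n, hn1, hn2⟩ := Nat.chineseRemainder hc r 1
      have h8 : n % 8 = r % 8 := hn1
      refine ⟨n, h8, by omega, Nat.Coprime.mul_right (Nat.Coprime.pow_right _ ?_) ?_⟩
      · rw [Nat.coprime_two_right, Nat.odd_iff]; omega
      · simpa [Nat.Coprime] using hn2.gcd_eq
    have fin : ∀ n : ℕ, n % 2 = 1 → n.Coprime (2 ^ i * b') → J(δ * a | n) = -1 →
        ∃ n : ℕ, Odd n ∧ n.Coprime D.natAbs ∧ J(D | n) = -1 := by
      intro n h1 h2 h3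
      have ho : Odd n := Nat.odd_iff.mpr h1
      refine ⟨n, ho, hcop n ?_ h2, by rw [hJ n h2, h3]⟩
      rcases ha12 with rfl | rfl
      · exact Nat.coprime_one_right _
      · exact Nat.coprime_two_right.mpr ho
    rcases ha12 with rfl | rfl <;> rcases hδ with rfl | rfl
    · exact absurd ⟨((2 ^ i * b' : ℕ) : ℤ), by rw [hDδ]; push_cast; ring⟩ hD
    · obtain ⟨n, h8, h2, hn⟩ := aux 3 rfl
      refine fin n h2 hn ?_
      push_cast
      rw [jacobiSym.at_neg_one (Nat.odd_iff.mpr h2)]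
      exact ZMod.χ₄_nat_three_mod_four (by omega)
    · obtain ⟨n, h8, h2, hn⟩ := aux 3 rfl
      refine fin n h2 hn ?_
      push_cast
      rw [jacobiSym.at_two (Nat.odd_iff.mpr h2), ZMod.χ₈_nat_eq_if_mod_eight]
      simp [h2, h8]
    · obtain ⟨n, h8, h2, hn⟩ := aux 5 rfl
      refine fin n h2 hn ?_
      push_cast
      rw [jacobiSym.at_neg_two (Nat.odd_iff.mpr h2),
        ZMod.χ₈'_nat_eq_if_mod_eight]
      simp [h2, h8]

/-- The Jacobi symbol `n ↦ J(D | n)` as a character modulo `4 |D|`. -/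
noncomputable def jacobiChar (D : ℤ) [NeZero (4 * D.natAbs)] : MulChar (ZMod (4 * D.natAbs)) ℤ :=
  have hcop (u : (ZMod (4 * D.natAbs))ˣ) : (u : ZMod (4 * D.natAbs)).val.Coprime (4 * D.natAbs) :=
    ZMod.val_coe_unit_coprime u
  have hodd (u : (ZMod (4 * D.natAbs))ˣ) : Odd (u : ZMod (4 * D.natAbs)).val :=
    Nat.coprime_two_right.mp ((hcop u).coprime_dvd_right ⟨2 * D.natAbs, by ring⟩)
  MulChar.ofUnitHom (MonoidHom.toHomUnits
    { toFun := fun u => J(D | (u : ZMod (4 * D.natAbs)).val)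
      map_one' := by
        have h1 : (1 : ZMod (4 * D.natAbs)).val = 1 % (4 * D.natAbs) := ZMod.val_one_eq_one_mod _
        rw [Units.val_one, h1, ← jacobiSym.mod_right _ odd_one, jacobiSym.one_right]
      map_mul' := fun u v => by
        rw [Units.val_mul, ZMod.val_mul, ← jacobiSym.mod_right _ ((hodd u).mul (hodd v)),
          jacobiSym.mul_right' _ (hodd u).pos.ne' (hodd v).pos.ne'] })

theorem jacobiChar_natCast {D : ℤ} [NeZero (4 * D.natAbs)] {n : ℕ} (hn : Odd n)
    (hnD : n.Coprime D.natAbs) : jacobiChar D n = J(D | n) := by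
  have hc : n.Coprime (4 * D.natAbs) :=
    Nat.Coprime.mul_right ((Nat.coprime_two_right.mpr hn).pow_right 2) hnD
  have h := ZMod.coe_unitOfCoprime n hc
  rw [← h, jacobiChar, MulChar.ofUnitHom_coe]
  simp only [MonoidHom.coe_toHomUnits, MonoidHom.coe_mk, OneHom.coe_mk]
  rw [h, ZMod.val_natCast, ← jacobiSym.mod_right _ hn]

theorem jacobiChar_ne_one {D : ℤ} [NeZero (4 * D.natAbs)] (hD : ¬ IsSquare D) :
    jacobiChar D ≠ 1 := by
  obtain ⟨n, h1, h2, h3⟩ := exists_jacobiSym_eq_neg_one hD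
  intro h
  have hc : n.Coprime (4 * D.natAbs) :=
    Nat.Coprime.mul_right ((Nat.coprime_two_right.mpr h1).pow_right 2) h2
  have h4 := jacobiChar_natCast h1 h2
  rw [h, h3, ← ZMod.coe_unitOfCoprime n hc, MulChar.one_apply_coe] at h4
  norm_num at h4

/-! ### Roots of quadratic polynomials modulo primes -/

theorem card_filter_range_eq_card_zmod (N : ℕ) [NeZero N] (P : ZMod N → Prop) [DecidablePred P] :
    ((Finset.range N).filter fun n : ℕ => P n).card =
      (Finset.univ.filter P).card := by
  refine Finset.card_nbij' (fun k : ℕ => (k : ZMod N)) ZMod.val ?_ ?_ ?_ ?_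
  · intro k hk
    simpa using (Finset.mem_filter.mp hk).2
  · intro x hx
    have := (Finset.mem_filter.mp hx).2
    simpa [ZMod.val_lt x] using this
  · intro k hk
    exact ZMod.val_cast_of_lt (by simpa using (Finset.mem_filter.mp hk).1)
  · intro x _
    simp

/-- The number of roots modulo `p` of the quadratic polynomial `A n ^ 2 + B n + C`. -/
theorem card_roots_quadratic {A B C : ℤ} {p : ℕ} [Fact p.Prime] (hp2 : p ≠ 2)
    (hpA : ¬ (p : ℤ) ∣ A) :
    ((((Finset.range p).filter fun n : ℕ => (p : ℤ) ∣ A * (n : ℤ) ^ 2 + B * n + C).card : ℕ) : ℤ) =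
      1 + J(B ^ 2 - 4 * A * C | p) := by
  have h2 : (2 : ZMod p) ≠ 0 := by
    intro h
    have : (p : ℕ) ∣ 2 := (ZMod.natCast_eq_zero_iff 2 p).mp (by exact_mod_cast h)
    exact hp2 ((Nat.prime_dvd_prime_iff_eq Fact.out Nat.prime_two).mp this)
  have hA : (A : ZMod p) ≠ 0 := by
    rwa [Ne, ZMod.intCast_zmod_eq_zero_iff_dvd]
  have hcard := card_filter_range_eq_card_zmod p
    (fun x : ZMod p => (A : ZMod p) * x ^ 2 + B * x + C = 0)
  have hdvd : ∀ n : ℕ, (p : ℤ) ∣ A * (n : ℤ) ^ 2 + B * n + C ↔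
      (A : ZMod p) * (n : ZMod p) ^ 2 + B * n + C = 0 := by
    intro n
    rw [← ZMod.intCast_zmod_eq_zero_iff_dvd]
    push_cast
    rfl
  simp only [hdvd, hcard]
  rw [← jacobiSym.legendreSym.to_jacobiSym, add_comm, ← legendreSym.card_sqrts p hp2]
  congr 1
  -- completing the square
  refine Finset.card_nbij' (fun x : ZMod p => 2 * A * x + B) (fun y => (y - B) / (2 * A))
    ?_ ?_ ?_ ?_
  · intro x hx
    have hx := (Finset.mem_filter.mp hx).2
    simp only [Set.coe_toFinset, Set.mem_ofPred_eq]
    push_cast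
    linear_combination 4 * (A : ZMod p) * hx
  · intro y hy
    simp only [Set.coe_toFinset, Set.mem_ofPred_eq] at hy
    push_cast at hy
    simp only [Finset.coe_filter, Finset.mem_univ, true_and, Set.mem_ofPred_eq]
    have h4 : (4 * A : ZMod p) ≠ 0 := by
      rw [show (4 : ZMod p) = 2 * 2 by norm_num]
      exact mul_ne_zero (mul_ne_zero h2 h2) hA
    refine mul_left_cancel₀ h4 ?_
    field_simp
    linear_combination 4 * hy
  · intro x _
    field_simp
    ring
  · intro y _
    field_simp
    ring

/-- For an integer `D` that is not a square there is a nontrivial real character whose value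
at all but finitely many primes `p` is the quadratic residue symbol of `D` modulo `p`. -/
theorem exists_isRealCharacter_jacobiSym {D : ℤ} (hD : ¬ IsSquare D) :
    ∃ (e : ℕ → ℝ) (L : ℝ), IsRealCharacter e L ∧
      ∀ p : ℕ, p.Prime → p ≠ 2 → ¬ (p : ℤ) ∣ D → e p = J(D | p) := by
  have hD0 : D ≠ 0 := by rintro rfl; exact hD (IsSquare.zero)
  have : NeZero (4 * D.natAbs) := ⟨by omega⟩
  obtain ⟨L, hL⟩ := exists_isRealCharacter (jacobiChar D) (jacobiChar_ne_one hD)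
  refine ⟨_, L, hL, fun p hp hp2 hpD => ?_⟩
  simp only [hp.ne_zero, if_false]
  rw [jacobiChar_natCast (hp.odd_of_ne_two hp2)]
  rw [hp.coprime_iff_not_dvd]
  rwa [← Int.natCast_dvd]

/-! ### Mean values of multiplicative functions -/

namespace ArithmeticFunction

/-- The multiplicative function with the value `γ p k` at the prime power `p ^ k`, `k ≥ 1`. -/
noncomputable def ofLocal (γ : ℕ → ℕ → ℝ) : ArithmeticFunction ℝ :=
  ⟨fun n => if n = 0 then 0 else n.factorization.prod γ, by simp⟩

theorem ofLocal_apply {γ : ℕ → ℕ → ℝ} {n : ℕ} (hn : n ≠ 0) :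
    ofLocal γ n = ∏ p ∈ n.primeFactors, γ p (n.factorization p) := by
  simp [ofLocal, hn, Finsupp.prod]

theorem ofLocal_isMultiplicative (γ : ℕ → ℕ → ℝ) : (ofLocal γ).IsMultiplicative := by
  rw [IsMultiplicative.iff_ne_zero]
  refine ⟨by simp [ofLocal], fun {m n} hm hn hmn => ?_⟩
  simp only [ofLocal, coe_mk, hm, hn, mul_eq_zero, or_self, if_false]
  rw [Nat.factorization_mul_of_coprime hmn]
  exact Finsupp.prod_add_index_of_disjoint hmn.disjoint_primeFactors _

theorem ofLocal_prime_pow {γ : ℕ → ℕ → ℝ} (h0 : ∀ p, γ p 0 = 1) {p : ℕ} (hp : p.Prime) (k : ℕ) :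
    ofLocal γ (p ^ k) = γ p k := by
  simp only [ofLocal, coe_mk, pow_eq_zero_iff', hp.ne_zero, false_and, if_false]
  rw [hp.factorization_pow, Finsupp.prod_single_index (h0 p)]

theorem mul_apply_prime_pow (f g : ArithmeticFunction ℝ) {p : ℕ} (hp : p.Prime) (n : ℕ) :
    (f * g) (p ^ n) = ∑ x ∈ Finset.HasAntidiagonal.antidiagonal n, f (p ^ x.1) * g (p ^ x.2) := by
  rw [mul_apply, Nat.sum_divisorsAntidiagonal (fun a b => f a * g b), Nat.sum_divisors_prime_pow hp,
    Finset.Nat.sum_antidiagonal_eq_sum_range_succ (fun i j => f (p ^ i) * g (p ^ j))]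
  refine Finset.sum_congr rfl fun i hi => ?_
  rw [Nat.pow_div (by simpa [Nat.lt_succ_iff] using hi) hp.pos]

/-- The local power series of an arithmetic function at `p`. -/
noncomputable def localSeries (f : ArithmeticFunction ℝ) (p : ℕ) : PowerSeries ℝ :=
  PowerSeries.mk fun n => f (p ^ n)

theorem localSeries_mul (f g : ArithmeticFunction ℝ) {p : ℕ} (hp : p.Prime) :
    localSeries (f * g) p = localSeries f p * localSeries g p := by
  ext n
  rw [PowerSeries.coeff_mul]
  simp only [localSeries, PowerSeries.coeff_mk]
  exact mul_apply_prime_pow f g hp n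

theorem mk_pow_mul_one_sub (x : ℝ) :
    (PowerSeries.mk fun n => x ^ n) * (1 - PowerSeries.C x * PowerSeries.X) = 1 := by
  ext n
  rw [mul_sub, mul_one, map_sub, ← mul_assoc]
  rcases n with _ | n
  · simp
  · rw [PowerSeries.coeff_succ_mul_X, mul_comm, PowerSeries.coeff_C_mul]
    simp [pow_succ', PowerSeries.coeff_one]

/-- The coefficient sequence of `(∑ γ_j X ^ j) (1 - X) (1 - e X)`. -/
noncomputable def twist (e : ℝ) (γ : ℕ → ℝ) : ℕ → ℝ
  | 0 => γ 0
  | 1 => γ 1 - (1 + e) * γ 0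
  | n + 2 => γ (n + 2) - (1 + e) * γ (n + 1) + e * γ n

theorem mk_twist (e : ℝ) (γ : ℕ → ℝ) : PowerSeries.mk (twist e γ) =
    PowerSeries.mk γ * (1 - PowerSeries.X) * (1 - PowerSeries.C e * PowerSeries.X) := by
  have : PowerSeries.mk γ * (1 - PowerSeries.X) * (1 - PowerSeries.C e * PowerSeries.X) =
      PowerSeries.mk γ - PowerSeries.C (1 + e) * (PowerSeries.mk γ * PowerSeries.X) +
        PowerSeries.C e * (PowerSeries.mk γ * PowerSeries.X * PowerSeries.X) := by
    rw [map_add, map_one]; ring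
  rw [this]
  ext n
  rw [map_add, map_sub, PowerSeries.coeff_C_mul, PowerSeries.coeff_C_mul]
  rcases n with _ | _ | n
  · simp [twist]
  · rw [PowerSeries.coeff_succ_mul_X, PowerSeries.coeff_succ_mul_X]
    simp [twist]
  · rw [PowerSeries.coeff_succ_mul_X, PowerSeries.coeff_succ_mul_X, PowerSeries.coeff_succ_mul_X]
    simp [twist]

/-- `n ↦ f(n) / n`. -/
noncomputable def divId (f : ArithmeticFunction ℝ) : ArithmeticFunction ℝ :=
  ⟨fun n => (n : ℝ)⁻¹ * f n, by simp⟩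

theorem divId_apply (f : ArithmeticFunction ℝ) (n : ℕ) : divId f n = (n : ℝ)⁻¹ * f n := rfl

theorem divId_mul (f g : ArithmeticFunction ℝ) : divId (f * g) = divId f * divId g := by
  ext n
  rw [divId_apply, mul_apply, mul_apply, Finset.mul_sum]
  refine Finset.sum_congr rfl fun x hx => ?_
  rw [divId_apply, divId_apply, ← (Nat.mem_divisorsAntidiagonal.mp hx).1]
  push_cast
  rw [mul_inv]
  ring

/-- A real character as an arithmetic function. -/
noncomputable def ofCharacter {e : ℕ → ℝ} {L : ℝ} (he : IsRealCharacter e L) :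
    ArithmeticFunction ℝ := ⟨e, he.map_zero⟩

/-- A multiplicative function is the convolution of `1`, a character and the multiplicative
function whose local series are twisted accordingly. -/
theorem zeta_mul_ofCharacter_mul_ofLocal_twist {e : ℕ → ℝ} {L : ℝ} (he : IsRealCharacter e L)
    {γ : ℕ → ℕ → ℝ} (h0 : ∀ p, γ p 0 = 1) :
    (zeta : ArithmeticFunction ℝ) * ofCharacter he * ofLocal (fun p => twist (e p) (γ p)) =
      ofLocal γ := by
  have hE : (ofCharacter he).IsMultiplicative := ⟨he.map_one, fun _ => he.map_mul _ _⟩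
  have hz : (zeta : ArithmeticFunction ℝ).IsMultiplicative := isMultiplicative_zeta.natCast
  refine (IsMultiplicative.eq_iff_eq_on_prime_powers _ ((hz.mul hE).mul
    (ofLocal_isMultiplicative _)) _ (ofLocal_isMultiplicative _)).mpr fun p k hp => ?_
  have hEpow : ∀ n, e (p ^ n) = e p ^ n := by
    intro n
    induction n with
    | zero => simpa using he.map_one
    | succ n ih => rw [pow_succ, he.map_mul, ih, pow_succ]
  have h1 : localSeries (zeta : ArithmeticFunction ℝ) p = PowerSeries.mk fun n => (1 : ℝ) ^ n := by
    ext n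
    simp [localSeries, natCoe_apply, zeta_apply, hp.ne_zero]
  have h2 : localSeries (ofCharacter he) p = PowerSeries.mk fun n => (e p) ^ n := by
    ext n
    simp [localSeries, ofCharacter, hEpow]
  have h3 : ∀ γ : ℕ → ℕ → ℝ, (∀ p, γ p 0 = 1) →
      localSeries (ofLocal γ) p = PowerSeries.mk (γ p) := by
    intro γ h0
    ext n
    simp [localSeries, ofLocal_prime_pow h0 hp]
  have h4 : localSeries ((zeta : ArithmeticFunction ℝ) * ofCharacter he *
      ofLocal (fun p => twist (e p) (γ p))) p = localSeries (ofLocal γ) p := by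
    rw [localSeries_mul _ _ hp, localSeries_mul _ _ hp, h1, h2, h3 γ h0,
      h3 _ (fun p => by simp [twist, h0]), mk_twist]
    have a1 := mk_pow_mul_one_sub 1
    have a2 := mk_pow_mul_one_sub (e p)
    rw [map_one, one_mul] at a1
    linear_combination (PowerSeries.mk (γ p)) * (PowerSeries.mk fun n => (e p) ^ n) *
      (1 - PowerSeries.C (e p) * PowerSeries.X) * a1 + (PowerSeries.mk (γ p)) * a2
  have := congrArg (PowerSeries.coeff k) h4
  simpa [localSeries] using this

theorem abs_sum_divId_ofCharacter_sub_le {e : ℕ → ℝ} {L : ℝ} (he : IsRealCharacter e L) :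
    ∃ C : ℝ, ∀ n : ℕ, |∑ k ∈ Finset.Ioc 0 n, divId (ofCharacter he) k - L| ≤
      C * ((n + 1 : ℕ) : ℝ)⁻¹ := by
  obtain ⟨C, hC⟩ := he.tail
  refine ⟨C, fun n => ?_⟩
  have := hC (n + 1) (by omega)
  rw [Finset.range_eq_Ico, Finset.sum_eq_sum_Ico_succ_bot (by omega), he.map_zero, mul_zero,
    zero_add] at this
  exact this

/-- `∑_{m ≤ n} (1 * e)(m) / m = L log n + O(1)`. -/
theorem exists_abs_sum_divId_zeta_mul_ofCharacter_sub_le {e : ℕ → ℝ} {L : ℝ}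
    (he : IsRealCharacter e L) :
    ∃ C : ℝ, 0 ≤ C ∧ ∀ n : ℕ, 1 ≤ n →
      |∑ k ∈ Finset.Ioc 0 n, divId ((zeta : ArithmeticFunction ℝ) * ofCharacter he) k -
        L * Real.log n| ≤ C := by
  obtain ⟨C, hC⟩ := abs_sum_divId_ofCharacter_sub_le he
  have hC0 : 0 ≤ C := by
    have := (abs_nonneg _).trans (hC 0)
    simpa using this
  refine ⟨C + |L|, by positivity, fun n hn => ?_⟩
  have hn' : (0 : ℝ) < n := by exact_mod_cast hn
  have hz : ∀ k ∈ Finset.Ioc 0 n, divId (zeta : ArithmeticFunction ℝ) k = (k : ℝ)⁻¹ := by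
    intro k hk
    simp [divId_apply, natCoe_apply, zeta_apply, (Finset.mem_Ioc.mp hk).1.ne']
  have hH : ∑ k ∈ Finset.Ioc 0 n, (k : ℝ)⁻¹ = (harmonic n : ℝ) := by
    rw [harmonic_eq_sum_Icc]
    push_cast
    rfl
  have h1 : ∑ k ∈ Finset.Ioc 0 n, divId ((zeta : ArithmeticFunction ℝ) * ofCharacter he) k =
      L * (harmonic n : ℝ) + ∑ k ∈ Finset.Ioc 0 n, (k : ℝ)⁻¹ *
        (∑ j ∈ Finset.Ioc 0 (n / k), divId (ofCharacter he) j - L) := by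
    rw [divId_mul, sum_Ioc_mul_eq_sum_sum, ← hH, Finset.mul_sum, ← Finset.sum_add_distrib]
    refine Finset.sum_congr rfl fun k hk => ?_
    rw [hz k hk]
    ring
  have h2 : |∑ k ∈ Finset.Ioc 0 n, (k : ℝ)⁻¹ *
      (∑ j ∈ Finset.Ioc 0 (n / k), divId (ofCharacter he) j - L)| ≤ C := by
    calc _ ≤ ∑ k ∈ Finset.Ioc 0 n, C * (n : ℝ)⁻¹ := by
          refine (Finset.abs_sum_le_sum_abs _ _).trans (Finset.sum_le_sum fun k hk => ?_)
          have hk0 : (0 : ℝ) < k := by exact_mod_cast (Finset.mem_Ioc.mp hk).1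
          rw [abs_mul, abs_of_nonneg (inv_nonneg.mpr hk0.le)]
          have h3 : ((n / k + 1 : ℕ) : ℝ)⁻¹ ≤ k / n := by
            rw [inv_le_comm₀ (by positivity) (by positivity), inv_div, div_le_iff₀ hk0]
            have := Nat.lt_div_mul_add (a := n) (b := k) (by exact_mod_cast hk0)
            have : n ≤ (n / k + 1) * k := by nlinarith
            exact_mod_cast this
          calc (k : ℝ)⁻¹ * _ ≤ (k : ℝ)⁻¹ * (C * (k / n)) := by
                gcongr
                exact (hC _).trans (by gcongr)
            _ = _ := by field_simp
      _ = C := by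
          simp only [Finset.sum_const, Nat.card_Ioc, nsmul_eq_mul, Nat.sub_zero]
          field_simp
  have h4 : |(harmonic n : ℝ) - Real.log n| ≤ 1 := by
    have a1 := log_add_one_le_harmonic n
    have a2 := harmonic_le_one_add_log n
    have a3 : Real.log n ≤ Real.log ((n + 1 : ℕ) : ℝ) :=
      Real.log_le_log hn' (by push_cast; linarith)
    rw [abs_le]
    constructor <;> linarith
  rw [h1]
  calc _ = |(∑ k ∈ Finset.Ioc 0 n, (k : ℝ)⁻¹ *
        (∑ j ∈ Finset.Ioc 0 (n / k), divId (ofCharacter he) j - L)) +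
          L * ((harmonic n : ℝ) - Real.log n)| := by congr 1; ring
    _ ≤ C + |L| * 1 := by
        refine (abs_add_le _ _).trans (add_le_add h2 ?_)
        rw [abs_mul]
        gcongr
    _ = _ := by ring

/-- Bounded local values, with `O(1 / p)` at `p` itself, give an absolutely convergent sum. -/
theorem summable_divId_ofLocal {κ : ℕ → ℕ → ℝ} {B C : ℝ} (h0 : ∀ p, κ p 0 = 1) (hB : 0 ≤ B)
    (hC : 0 ≤ C) (hκ : ∀ p : ℕ, p.Prime → ∀ k, |κ p k| ≤ B)
    (hκ1 : ∀ p : ℕ, p.Prime → |κ p 1| ≤ C / p) :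
    Summable fun n => |divId (ofLocal κ) n| := by
  set F : ℕ → ℝ := fun n => |divId (ofLocal κ) n| with hF
  have hmult := ofLocal_isMultiplicative κ
  have hF1 : F 1 = 1 := by simp [hF, divId_apply, hmult.map_one]
  have hFmul : ∀ {m n : ℕ}, m.Coprime n → F (m * n) = F m * F n := by
    intro m n hmn
    simp only [hF, divId_apply, ← abs_mul, hmult.map_mul_of_coprime hmn]
    congr 1
    push_cast
    rw [mul_inv]; ring
  have hFp : ∀ {p : ℕ}, p.Prime → ∀ n, F (p ^ n) = |κ p n| * ((p : ℝ)⁻¹) ^ n := by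
    intro p hp n
    simp only [hF, divId_apply, ofLocal_prime_pow h0 hp, abs_mul]
    push_cast
    rw [abs_of_nonneg (by positivity), inv_pow, mul_comm]
  have hinv : ∀ {p : ℕ}, p.Prime → (p : ℝ)⁻¹ ≤ 1 / 2 := by
    intro p hp
    rw [one_div]
    exact inv_anti₀ (by norm_num) (by exact_mod_cast hp.two_le)
  have hgeo : ∀ {p : ℕ}, p.Prime → Summable fun n : ℕ => B * ((p : ℝ)⁻¹) ^ n := by
    intro p hp
    exact (summable_geometric_of_lt_one (by positivity) (by linarith [hinv hp])).mul_left B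
  have hFsum : ∀ {p : ℕ}, p.Prime → Summable fun n : ℕ => F (p ^ n) := by
    intro p hp
    refine Summable.of_nonneg_of_le (fun n => abs_nonneg _) (fun n => ?_) (hgeo hp)
    rw [hFp hp]
    gcongr
    exact hκ p hp n
  have hloc : ∀ {p : ℕ}, p.Prime → ∑' n, F (p ^ n) ≤ 1 + (C + 2 * B) * ((p : ℝ) ^ 2)⁻¹ := by
    intro p hp
    have hp0 : (0 : ℝ) < p := by exact_mod_cast hp.pos
    have hs := hFsum hp
    rw [hs.tsum_eq_zero_add, ((summable_nat_add_iff 1).mpr hs).tsum_eq_zero_add]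
    simp only [pow_zero, hF1, zero_add]
    have e1 : F (p ^ 1) ≤ C * ((p : ℝ) ^ 2)⁻¹ := by
      rw [hFp hp]
      calc _ ≤ C / p * ((p : ℝ)⁻¹) ^ 1 := by gcongr; exact hκ1 p hp
        _ = _ := by field_simp
    have e2 : ∑' n, F (p ^ (n + 1 + 1)) ≤ 2 * B * ((p : ℝ) ^ 2)⁻¹ := by
      have hs2 : Summable fun n : ℕ => B * ((p : ℝ) ^ 2)⁻¹ * ((p : ℝ)⁻¹) ^ n :=
        (summable_geometric_of_lt_one (by positivity) (by linarith [hinv hp])).mul_left _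
      calc _ ≤ ∑' n : ℕ, B * ((p : ℝ) ^ 2)⁻¹ * ((p : ℝ)⁻¹) ^ n := by
            refine Summable.tsum_le_tsum (fun n => ?_) ((summable_nat_add_iff 2).mpr hs) hs2
            rw [hFp hp]
            calc _ ≤ B * ((p : ℝ)⁻¹) ^ (n + 1 + 1) := by gcongr; exact hκ p hp _
              _ = _ := by rw [← inv_pow]; ring
        _ = B * ((p : ℝ) ^ 2)⁻¹ * (1 - (p : ℝ)⁻¹)⁻¹ := by
            rw [tsum_mul_left, tsum_geometric_of_lt_one (by positivity) (by linarith [hinv hp])]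
        _ ≤ B * ((p : ℝ) ^ 2)⁻¹ * 2 := by
            gcongr
            rw [inv_le_comm₀ (by linarith [hinv hp]) (by norm_num)]
            linarith [hinv hp]
        _ = _ := by ring
    linarith
  have hsq : Summable fun n : ℕ => (C + 2 * B) * ((n : ℝ) ^ 2)⁻¹ :=
    (Real.summable_nat_pow_inv.mpr one_lt_two).mul_left _
  refine summable_of_sum_le (fun n => abs_nonneg _)
    (c := Real.exp (∑' n : ℕ, (C + 2 * B) * ((n : ℝ) ^ 2)⁻¹)) fun u => ?_
  -- a finite sum is bounded by the sum over smooth numbers, which is a finite Euler product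
  obtain ⟨N, hN⟩ := u.exists_nat_subset_range
  obtain ⟨-, hsm⟩ := EulerProduct.summable_and_hasSum_smoothNumbers_prod_primesBelow_tsum hF1 hFmul
    (fun hp => by simpa [hF] using hFsum hp) N
  have hsm' := (hasSum_subtype_iff_indicator (f := F) (s := N.smoothNumbers)).mp hsm
  have hF0 : F 0 = 0 := by simp [hF]
  calc ∑ n ∈ u, F n ≤ ∑ n ∈ u, N.smoothNumbers.indicator F n := by
        refine Finset.sum_le_sum fun n hn => ?_
        rcases Nat.eq_zero_or_pos n with rfl | hn0
        · rw [hF0]; exact Set.indicator_nonneg (fun _ _ => abs_nonneg _) _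
        · rw [Set.indicator_of_mem]
          exact Nat.mem_smoothNumbers_of_lt hn0 (Finset.mem_range.mp (hN hn))
    _ ≤ _ := sum_le_hasSum u (fun n _ => Set.indicator_nonneg (fun _ _ => abs_nonneg _) _) hsm'
    _ ≤ ∏ p ∈ N.primesBelow, Real.exp ((C + 2 * B) * ((p : ℝ) ^ 2)⁻¹) := by
        refine Finset.prod_le_prod (fun p _ => tsum_nonneg fun n => abs_nonneg _) fun p hp => ?_
        refine (hloc (Nat.prime_of_mem_primesBelow hp)).trans ?_
        rw [add_comm]
        exact Real.add_one_le_exp _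
    _ = Real.exp (∑ p ∈ N.primesBelow, (C + 2 * B) * ((p : ℝ) ^ 2)⁻¹) := (Real.exp_sum _ _).symm
    _ ≤ _ := by
        rw [Real.exp_le_exp]
        exact hsq.sum_le_tsum _ fun n _ => by positivity

/-- The value at `x` of the identity of power series defining `twist`. -/
theorem tsum_twist {e x : ℝ} {γ : ℕ → ℝ} (h : Summable fun n => γ n * x ^ n) :
    ∑' n, twist e γ n * x ^ n = (1 - x) * (1 - x * e) * ∑' n, γ n * x ^ n := by
  have h1 := (summable_nat_add_iff 1).mpr h
  have h2 := (summable_nat_add_iff 2).mpr h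
  have e2 : ∀ n, twist e γ (n + 2) * x ^ (n + 2) = γ (n + 2) * x ^ (n + 2) -
      (1 + e) * x * (γ (n + 1) * x ^ (n + 1)) + e * x ^ 2 * (γ n * x ^ n) := by
    intro n
    rw [twist]; ring
  have s2 : Summable fun n => twist e γ (n + 2) * x ^ (n + 2) := by
    simp only [e2]
    exact (h2.sub (h1.mul_left _)).add (h.mul_left _)
  have s0 : Summable fun n => twist e γ n * x ^ n := (summable_nat_add_iff 2).mp s2
  have t0 := h.tsum_eq_zero_add
  have t1 := h1.tsum_eq_zero_add
  rw [s0.tsum_eq_zero_add, ((summable_nat_add_iff 1).mpr s0).tsum_eq_zero_add]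
  simp only [add_assoc, one_add_one_eq_two] at t1 ⊢
  simp only [e2]
  rw [(h2.sub (h1.mul_left _)).tsum_add (h.mul_left _), h2.tsum_sub (h1.mul_left _), tsum_mul_left,
    tsum_mul_left]
  simp only [twist, zero_add, pow_zero, pow_one, mul_one] at t0 t1 ⊢
  rw [t0, t1]
  ring

end ArithmeticFunction

namespace ArithmeticFunction

/-- The mean value of `f(n) / n` for `f = 1 * e * K` with `∑ |K(d)| / d` finite. -/
theorem tendsto_sum_divId_div_log {e : ℕ → ℝ} {L : ℝ} (he : IsRealCharacter e L)
    {K : ArithmeticFunction ℝ} (hK : Summable fun n => |divId K n|) :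
    Tendsto (fun n : ℕ => (∑ m ∈ Finset.Ioc 0 n,
      divId ((zeta : ArithmeticFunction ℝ) * ofCharacter he * K) m) / Real.log n) atTop
      (𝓝 (L * ∑' d, divId K d)) := by
  obtain ⟨C, hC0, hC⟩ := exists_abs_sum_divId_zeta_mul_ofCharacter_sub_le he
  set T : ℕ → ℝ := fun n => ∑ k ∈ Finset.Ioc 0 n,
    divId ((zeta : ArithmeticFunction ℝ) * ofCharacter he) k with hT
  have hlogt : Tendsto (fun n : ℕ => Real.log n) atTop atTop :=
    Real.tendsto_log_atTop.comp tendsto_natCast_atTop_atTop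
  have hsum : ∀ n : ℕ, (∑ m ∈ Finset.Ioc 0 n,
      divId ((zeta : ArithmeticFunction ℝ) * ofCharacter he * K) m) / Real.log n =
      ∑' d, if d ∈ Finset.Ioc 0 n then divId K d * (T (n / d) / Real.log n) else 0 := by
    intro n
    rw [tsum_eq_sum (s := Finset.Ioc 0 n) (fun d hd => if_neg hd), mul_comm, divId_mul,
      sum_Ioc_mul_eq_sum_sum, Finset.sum_div]
    refine Finset.sum_congr rfl fun d hd => ?_
    rw [if_pos hd, mul_div_assoc]
  simp only [hsum]
  rw [← tsum_mul_left]
  refine tendsto_tsum_of_dominated_convergence (bound := fun d => |divId K d| * (C + |L|))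
    (hK.mul_right _) (fun d => ?_) ?_
  · rcases Nat.eq_zero_or_pos d with rfl | hd
    · simp
    -- `T (n / d) = L log n + O(1)` for fixed `d`
    have h1 : ∀ᶠ n : ℕ in atTop, |T (n / d) / Real.log n - L| ≤
        (C + |L| * Real.log (2 * d)) / Real.log n := by
      filter_upwards [eventually_ge_atTop d, hlogt.eventually_gt_atTop 0] with n hn hlog
      have hnd : 1 ≤ n / d := (Nat.one_le_div_iff hd).mpr hn
      have hd0 : (0 : ℝ) < d := by exact_mod_cast hd
      have hnd0 : (0 : ℝ) < ((n / d : ℕ) : ℝ) := by exact_mod_cast hnd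
      have hn0 : (0 : ℝ) < n := by exact_mod_cast hd.trans_le hn
      have u1 : Real.log ((n / d : ℕ) : ℝ) ≤ Real.log n :=
        Real.log_le_log hnd0 (by exact_mod_cast Nat.div_le_self n d)
      have u2 : Real.log n ≤ Real.log ((n / d : ℕ) : ℝ) + Real.log (2 * d) := by
        rw [← Real.log_mul hnd0.ne' (by positivity)]
        refine Real.log_le_log hn0 ?_
        have := Nat.lt_div_mul_add (a := n) hd
        have : n ≤ (n / d) * (2 * d) := by nlinarith
        exact_mod_cast this
      have u3 : T (n / d) / Real.log n - L = ((T (n / d) - L * Real.log ((n / d : ℕ) : ℝ)) +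
          L * (Real.log ((n / d : ℕ) : ℝ) - Real.log n)) / Real.log n := by
        field_simp
        ring
      rw [u3, abs_div, abs_of_pos hlog]
      refine div_le_div_of_nonneg_right ((abs_add_le _ _).trans (add_le_add (hC _ hnd) ?_)) hlog.le
      rw [abs_mul]
      gcongr
      rw [abs_le]
      constructor <;> linarith
    have h2 : Tendsto (fun n : ℕ => T (n / d) / Real.log n) atTop (𝓝 L) := by
      rw [tendsto_iff_norm_sub_tendsto_zero]
      refine squeeze_zero' (Eventually.of_forall fun _ => norm_nonneg _) h1 ?_
      exact hlogt.const_div_atTop _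
    rw [mul_comm L]
    refine (h2.const_mul _).congr' ?_
    filter_upwards [eventually_ge_atTop d] with n hn
    rw [if_pos (Finset.mem_Ioc.mpr ⟨hd, hn⟩)]
  · filter_upwards [hlogt.eventually_ge_atTop 1] with n hlog d
    split_ifs with hd
    · rw [norm_mul, Real.norm_eq_abs, Real.norm_eq_abs]
      gcongr
      have hd := Finset.mem_Ioc.mp hd
      have hnd : 1 ≤ n / d := (Nat.one_le_div_iff hd.1).mpr hd.2
      have hnd0 : (1 : ℝ) ≤ ((n / d : ℕ) : ℝ) := by exact_mod_cast hnd
      rw [abs_div, abs_of_pos (by linarith : 0 < Real.log n), div_le_iff₀ (by linarith)]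
      calc |T (n / d)| = |(T (n / d) - L * Real.log ((n / d : ℕ) : ℝ)) +
            L * Real.log ((n / d : ℕ) : ℝ)| := by congr 1; ring
        _ ≤ C + |L| * Real.log n := by
            refine (abs_add_le _ _).trans (add_le_add (hC _ hnd) ?_)
            rw [abs_mul, abs_of_nonneg (Real.log_nonneg hnd0)]
            gcongr
            exact Nat.div_le_self n d
        _ ≤ C * Real.log n + |L| * Real.log n := by nlinarith
        _ = _ := by ring
    · rw [norm_zero]; positivity

/-- The mean value theorem: if a multiplicative function `g` has bounded values at prime powers and
`g(p) = 1 + e(p) + O(1 / p)` for a real character `e`, then `∑_{m ≤ n} g(m) / m ∼ c log n` with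
`c = ∏_p (1 - 1 / p) ∑_j g(p ^ j) / p ^ j`. -/
theorem exists_tendsto_sum_divId_ofLocal_div_log {e : ℕ → ℝ} {L : ℝ} (he : IsRealCharacter e L)
    {γ : ℕ → ℕ → ℝ} {B C : ℝ} (h0 : ∀ p, γ p 0 = 1)
    (hB : ∀ p : ℕ, p.Prime → ∀ k, |γ p k| ≤ B)
    (hC : ∀ p : ℕ, p.Prime → |γ p 1 - (1 + e p)| ≤ C / p) :
    ∃ c : ℝ, HasEulerProduct (fun p => (1 - 1 / (p : ℝ)) * ∑' j, γ p j * ((p : ℝ)⁻¹) ^ j) c ∧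
      Tendsto (fun n : ℕ => (∑ m ∈ Finset.Ioc 0 n, divId (ofLocal γ) m) / Real.log n) atTop
        (𝓝 c) := by
  have hB0 : 0 ≤ B := (abs_nonneg _).trans (hB 2 Nat.prime_two 0)
  have hC0 : 0 ≤ C := by
    have := (abs_nonneg _).trans (hC 2 Nat.prime_two)
    push_cast at this
    linarith
  set κ : ℕ → ℕ → ℝ := fun p => twist (e p) (γ p) with hκ
  have hκ0 : ∀ p, κ p 0 = 1 := fun p => by simp [hκ, twist, h0]
  have hκB : ∀ p : ℕ, p.Prime → ∀ k, |κ p k| ≤ 4 * B := by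
    intro p hp k
    have hep := abs_le.mp (he.abs_le_one p)
    have b1 : ∀ k, |(1 + e p) * γ p k| ≤ 2 * B := fun k => by
      rw [abs_mul]
      refine mul_le_mul ?_ (hB p hp k) (abs_nonneg _) (by norm_num)
      rw [abs_le]; constructor <;> linarith
    have b2 : ∀ k, |e p * γ p k| ≤ B := fun k => by
      rw [abs_mul]
      calc _ ≤ 1 * B := mul_le_mul (he.abs_le_one p) (hB p hp k) (abs_nonneg _) (by norm_num)
        _ = B := one_mul B
    simp only [hκ]
    rcases k with _ | _ | k
    · rw [twist]; linarith [hB p hp 0]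
    · rw [twist]
      linarith [abs_sub (γ p 1) ((1 + e p) * γ p 0), hB p hp 1, b1 0]
    · rw [twist]
      linarith [abs_add_le (γ p (k + 2) - (1 + e p) * γ p (k + 1)) (e p * γ p k),
        abs_sub (γ p (k + 2)) ((1 + e p) * γ p (k + 1)), hB p hp (k + 2), b1 (k + 1), b2 k]
  have hκC : ∀ p : ℕ, p.Prime → |κ p 1| ≤ C / p := by
    intro p hp
    simpa [hκ, twist, h0] using hC p hp
  have hsum := summable_divId_ofLocal hκ0 (by positivity) hC0 hκB hκC
  have hmean := tendsto_sum_divId_div_log he hsum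
  have hconv : (zeta : ArithmeticFunction ℝ) * ofCharacter he * ofLocal κ = ofLocal γ :=
    zeta_mul_ofCharacter_mul_ofLocal_twist he h0
  rw [hconv] at hmean
  refine ⟨_, ?_, hmean⟩
  have hmult := ofLocal_isMultiplicative κ
  have heuler := EulerProduct.eulerProduct (f := fun n => divId (ofLocal κ) n)
    (by simp [divId_apply, hmult.map_one])
    (fun {m n} hmn => by
      simp only [divId_apply, hmult.map_mul_of_coprime hmn]
      push_cast
      rw [mul_inv]; ring)
    (by simpa using hsum) (by simp)
  -- the Euler product of `∑ K(d) / d` times that of `L`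
  have hprod := heuler.div he.prod (inv_ne_zero he.ne_zero)
  rw [div_inv_eq_mul, mul_comm] at hprod
  refine (hprod.comp (tendsto_add_atTop_nat 1)).congr fun n => ?_
  simp only [Function.comp_apply, Pi.div_apply, Nat.primesBelow]
  rw [← Finset.prod_div_distrib]
  refine Finset.prod_congr rfl fun p hp => ?_
  have hp := (Finset.mem_filter.mp hp).2
  have hinv : (p : ℝ)⁻¹ ≤ 1 / 2 := by
    rw [one_div]
    exact inv_anti₀ (by norm_num) (by exact_mod_cast hp.two_le)
  have hpinv : 0 < (p : ℝ)⁻¹ := inv_pos.mpr (by exact_mod_cast hp.pos)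
  have hne : 1 - (p : ℝ)⁻¹ * e p ≠ 0 := by
    have := abs_le.mp (he.abs_le_one p)
    nlinarith
  have hs : Summable fun n => γ p n * ((p : ℝ)⁻¹) ^ n := by
    refine Summable.of_norm_bounded (g := fun n => B * ((p : ℝ)⁻¹) ^ n)
      ((summable_geometric_of_lt_one (by positivity) (by linarith)).mul_left B) fun n => ?_
    rw [norm_mul, Real.norm_eq_abs, norm_pow, Real.norm_of_nonneg hpinv.le]
    gcongr
    exact hB p hp n
  rw [div_eq_iff hne]
  calc _ = ∑' n, twist (e p) (γ p) n * ((p : ℝ)⁻¹) ^ n := by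
        refine tsum_congr fun n => ?_
        rw [divId_apply, ofLocal_prime_pow hκ0 hp]
        push_cast
        rw [inv_pow, mul_comm]
    _ = _ := by rw [tsum_twist hs, one_div]; ring

end ArithmeticFunction

/-! ### Conditionally convergent Euler products -/

/-- A product over the primes of positive factors `1 + a(p) + O(1 / p ^ 2)` converges if `∑ a(p)`
does, the primes being taken in increasing order. -/
theorem exists_hasEulerProduct {F a : ℕ → ℝ} {C A l : ℝ} (hpos : ∀ p : ℕ, p.Prime → 0 < F p)
    (ha : ∀ p : ℕ, p.Prime → |a p| ≤ A / p)
    (hl : Tendsto (fun n : ℕ => ∑ p ∈ (Finset.range n).filter Nat.Prime, a p) atTop (𝓝 l))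
    (hF : ∀ᶠ p : ℕ in atTop, p.Prime → |F p - (1 + a p)| ≤ C / (p : ℝ) ^ 2) :
    ∃ S : ℝ, HasEulerProduct F S := by
  have hsmall : ∀ᶠ p : ℕ in atTop, (|A| + |C|) / p ≤ 1 / 2 :=
    (tendsto_const_div_atTop_nhds_zero_nat (|A| + |C|)).eventually_le_const (by norm_num)
  obtain ⟨P, hP⟩ := eventually_atTop.mp (hF.and (hsmall.and (eventually_ge_atTop 1)))
  set E : ℝ := 2 * (|A| + |C|) ^ 2 + |C| with hE
  have hbd : ∀ p ≥ P, p.Prime → |Real.log (F p) - a p| ≤ E * ((p : ℝ) ^ 2)⁻¹ := by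
    intro p hp hpp
    obtain ⟨h1, h2, h3⟩ := hP p hp
    have hp1 : (1 : ℝ) ≤ p := by exact_mod_cast h3
    have h1 := h1 hpp
    have hCp : C / (p : ℝ) ^ 2 ≤ |C| / p := by
      calc C / (p : ℝ) ^ 2 ≤ |C| / (p : ℝ) ^ 2 := by gcongr; exact le_abs_self C
        _ ≤ |C| / p := by gcongr; nlinarith
    have hy : |F p - 1| ≤ (|A| + |C|) / p := by
      calc |F p - 1| = |(F p - (1 + a p)) + a p| := by congr 1; ring
        _ ≤ C / (p : ℝ) ^ 2 + A / p := (abs_add_le _ _).trans (add_le_add h1 (ha p hpp))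
        _ ≤ |C| / p + |A| / p := by
            refine add_le_add hCp ?_
            gcongr
            exact le_abs_self A
        _ = _ := by ring
    have hlog : |Real.log (F p) - (F p - 1)| ≤ 2 * (F p - 1) ^ 2 := by
      have hy2 : |F p - 1| ≤ 1 / 2 := hy.trans h2
      have hFp := hpos p hpp
      have u1 := Real.log_le_sub_one_of_pos hFp
      have u2 := Real.one_sub_inv_le_log_of_pos hFp
      have hF2 : 1 / 2 ≤ F p := by linarith [(abs_le.mp hy2).1]
      have u3 : (F p)⁻¹ ≤ 2 := by
        rw [inv_le_comm₀ hFp (by norm_num)]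
        linarith
      have u4 : 1 - (F p)⁻¹ - (F p - 1) = -((F p - 1) ^ 2 * (F p)⁻¹) := by
        field_simp
        ring
      rw [abs_le]
      constructor
      · nlinarith [sq_nonneg (F p - 1)]
      · nlinarith [sq_nonneg (F p - 1)]
    calc |Real.log (F p) - a p| = |(Real.log (F p) - (F p - 1)) + (F p - (1 + a p))| := by
          congr 1; ring
      _ ≤ 2 * ((|A| + |C|) / p) ^ 2 + |C| / (p : ℝ) ^ 2 := by
          refine (abs_add_le _ _).trans (add_le_add (hlog.trans ?_) (h1.trans ?_))
          · rw [← sq_abs]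
            gcongr
          · gcongr
            exact le_abs_self C
      _ = _ := by rw [hE]; field_simp
  have hsum : Summable fun p : ℕ => if p.Prime then Real.log (F p) - a p else 0 := by
    rw [← summable_nat_add_iff P]
    refine Summable.of_norm_bounded (g := fun n : ℕ => E * (((n + P : ℕ) : ℝ) ^ 2)⁻¹)
      ((summable_nat_add_iff P (f := fun n : ℕ => E * ((n : ℝ) ^ 2)⁻¹)).mpr
        ((Real.summable_nat_pow_inv.mpr one_lt_two).mul_left _)) fun n => ?_
    split_ifs with hp
    · exact hbd _ (by omega) hp
    · rw [norm_zero]; positivity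
  refine ⟨_, (((hl.add hsum.hasSum.tendsto_sum_nat).rexp).comp (tendsto_add_atTop_nat 1)).congr
    fun n => ?_⟩
  simp only [Function.comp_apply]
  rw [← Finset.sum_filter, ← Finset.sum_add_distrib, Real.exp_sum]
  refine Finset.prod_congr rfl fun p hp => ?_
  rw [add_sub_cancel, Real.exp_log (hpos p (Finset.mem_filter.mp hp).2)]

/-! ### Densities of periodic predicates -/

/-- The predicate `P` on the integers is periodic modulo `N`. -/
def PeriodicMod (N : ℕ) (P : ℤ → Prop) : Prop := ∀ n k : ℤ, P (n + k * N) ↔ P n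

open scoped Classical in
/-- The number of `n` in `[0, N)` satisfying `P`. -/
noncomputable def countMod (N : ℕ) (P : ℤ → Prop) : ℕ :=
  ((Finset.range N).filter fun n : ℕ => P n).card

/-- The proportion of residues modulo `N` satisfying `P`. -/
noncomputable def density (N : ℕ) (P : ℤ → Prop) : ℝ := countMod N P / N

theorem PeriodicMod.of_dvd {N M : ℕ} {P : ℤ → Prop} (h : PeriodicMod N P) (hNM : N ∣ M) :
    PeriodicMod M P := by
  obtain ⟨c, rfl⟩ := hNM
  intro n k
  have := h n (k * c)
  rwa [show n + k * c * (N : ℤ) = n + k * ((N * c : ℕ) : ℤ) by push_cast; ring] at this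

theorem PeriodicMod.congr {N : ℕ} {P : ℤ → Prop} (h : PeriodicMod N P) {a b : ℤ}
    (hab : (N : ℤ) ∣ a - b) : P a ↔ P b := by
  obtain ⟨c, hc⟩ := hab
  rw [show a = b + c * N by linarith]
  exact h b c

theorem PeriodicMod.and {N : ℕ} {P Q : ℤ → Prop} (hP : PeriodicMod N P) (hQ : PeriodicMod N Q) :
    PeriodicMod N (fun n => P n ∧ Q n) := fun n k => and_congr (hP n k) (hQ n k)

theorem PeriodicMod.not {N : ℕ} {P : ℤ → Prop} (hP : PeriodicMod N P) :
    PeriodicMod N (fun n => ¬ P n) := fun n k => not_congr (hP n k)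

theorem PeriodicMod.comp_affine {N M : ℕ} {P : ℤ → Prop} (hP : PeriodicMod N P) {c : ℤ} (β : ℤ)
    (h : (N : ℤ) ∣ M * c) : PeriodicMod M (fun j => P (β + j * c)) := fun n k => by
  refine hP.congr ?_
  rw [show β + (n + k * (M : ℤ)) * c - (β + n * c) = k * (M * c) by ring]
  exact h.mul_left k

theorem periodicMod_dvd_eval (f : ℤ[X]) (N : ℕ) : PeriodicMod N (fun n => (N : ℤ) ∣ f.eval n) := by
  intro n k
  have h : (N : ℤ) ∣ f.eval (n + k * N) - f.eval n :=
    (by rw [add_sub_cancel_left]; exact Dvd.intro_left _ rfl : (N : ℤ) ∣ (n + k * N) - n).trans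
      (f.sub_dvd_eval_sub _ _)
  exact (dvd_iff_dvd_of_dvd_sub h)

theorem countMod_congr {N : ℕ} {P Q : ℤ → Prop} (h : ∀ n : ℕ, n < N → (P n ↔ Q n)) :
    countMod N P = countMod N Q := by
  classical
  unfold countMod
  congr 1
  refine Finset.filter_congr fun n hn => h n (Finset.mem_range.mp hn)

theorem countMod_eq (N : ℕ) (P : ℤ → Prop) [DecidablePred fun n : ℕ => P n] :
    ((Finset.range N).filter fun n : ℕ => P n).card = countMod N P := by
  unfold countMod
  congr!

theorem countMod_le (N : ℕ) (P : ℤ → Prop) : countMod N P ≤ N := by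
  classical
  exact (Finset.card_filter_le _ _).trans (by simp)

theorem density_nonneg (N : ℕ) (P : ℤ → Prop) : 0 ≤ density N P := by
  unfold density; positivity

theorem density_congr {N : ℕ} {P Q : ℤ → Prop} (h : ∀ n : ℤ, P n ↔ Q n) :
    density N P = density N Q := by
  rw [density, density, countMod_congr fun n _ => h n]

theorem density_true {N : ℕ} (hN : 0 < N) : density N (fun _ => True) = 1 := by
  classical
  rw [density, ← countMod_eq, Finset.filter_true, Finset.card_range, div_self]
  exact_mod_cast hN.ne'

theorem countMod_eq_zero {N : ℕ} {P : ℤ → Prop} (h : ∀ n : ℕ, ¬ P n) : countMod N P = 0 := by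
  classical
  rw [countMod, Finset.filter_false_of_mem (fun n _ => h n), Finset.card_empty]

theorem density_add {N : ℕ} {P Q : ℤ → Prop} (h : ∀ n, ¬ (P n ∧ Q n)) :
    density N (fun n => P n ∨ Q n) = density N P + density N Q := by
  classical
  rw [density, density, density, ← countMod_eq, ← countMod_eq, ← countMod_eq, Finset.filter_or,
    Finset.card_union_of_disjoint]
  · push_cast; rw [add_div]
  · exact Finset.disjoint_filter.mpr fun n _ h1 h2 => h n ⟨h1, h2⟩

theorem density_not {N : ℕ} (hN : 0 < N) (P : ℤ → Prop) :
    density N (fun n => ¬ P n) = 1 - density N P := by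
  have := density_add (N := N) (P := P) (Q := fun n => ¬ P n) (fun n h => h.2 h.1)
  rw [density_congr (Q := fun _ => True) fun n => by tauto, density_true hN] at this
  linarith

/-- The number of solutions in `[0, a b)`, by residues modulo `a`. -/
theorem countMod_mul (a b : ℕ) (P : ℤ → Prop) :
    countMod (a * b) P = ∑ β ∈ Finset.range a, countMod b (fun j => P (β + j * a)) := by
  classical
  simp only [countMod]
  rw [← Finset.card_sigma]
  refine (Finset.card_nbij' (fun n : ℕ => (⟨n % a, n / a⟩ : Σ _ : ℕ, ℕ)) (fun x => x.1 + x.2 * a)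
    ?_ ?_ ?_ ?_)
  · intro n hn
    simp only [Finset.coe_filter, Finset.mem_range, Set.mem_ofPred_eq] at hn
    have ha : 0 < a := by
      rcases Nat.eq_zero_or_pos a with rfl | h
      · simp at hn
      · exact h
    simp only [Finset.coe_sigma, Finset.coe_range, Set.mem_sigma_iff, Set.mem_Iio,
      Finset.coe_filter, Finset.mem_range, Set.mem_ofPred_eq]
    refine ⟨Nat.mod_lt _ ha, Nat.div_lt_of_lt_mul hn.1, ?_⟩
    have h : ((n % a : ℕ) : ℤ) + ((n / a : ℕ) : ℤ) * a = n := by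
      exact_mod_cast Nat.mod_add_div' n a
    rw [h]
    exact hn.2
  · rintro ⟨x, y⟩ hx
    simp only [Finset.coe_sigma, Finset.coe_range, Set.mem_sigma_iff, Set.mem_Iio,
      Finset.coe_filter, Finset.mem_range, Set.mem_ofPred_eq] at hx ⊢
    obtain ⟨h1, h2, h3⟩ := hx
    refine ⟨by nlinarith, ?_⟩
    push_cast
    exact h3
  · intro n _
    exact Nat.mod_add_div' n a
  · rintro ⟨x, y⟩ hx
    simp only [Finset.coe_sigma, Finset.coe_range, Set.mem_sigma_iff, Set.mem_Iio,
      Finset.coe_filter, Finset.mem_range, Set.mem_ofPred_eq] at hx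
    have h1 : (x + y * a) % a = x := by
      rw [Nat.add_mul_mod_self_right, Nat.mod_eq_of_lt hx.1]
    have h2 : (x + y * a) / a = y := by
      rw [Nat.add_mul_div_right _ _ (by omega), Nat.div_eq_of_lt hx.1, zero_add]
    simp only [h1, h2]

theorem countMod_of_dvd {N : ℕ} {P : ℤ → Prop} (h : PeriodicMod N P) (k : ℕ) :
    countMod (k * N) P = k * countMod N P := by
  rw [mul_comm k N, countMod_mul]
  classical
  have : ∀ β ∈ Finset.range N, countMod k (fun j => P ((β : ℕ) + j * N)) =
      if P (β : ℕ) then k else 0 := by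
    intro β _
    rw [countMod_congr (Q := fun _ => P (β : ℕ)) (fun n _ => h _ _), ← countMod_eq]
    split_ifs with hP <;> simp [hP]
  rw [Finset.sum_congr rfl this, ← Finset.sum_filter, Finset.sum_const, smul_eq_mul, mul_comm,
    countMod_eq]

theorem density_of_dvd {N M : ℕ} {P : ℤ → Prop} (h : PeriodicMod N P) (hM : 0 < M) (hNM : N ∣ M) :
    density M P = density N P := by
  obtain ⟨k, rfl⟩ := hNM
  have hN : (N : ℝ) ≠ 0 := by
    have := Nat.pos_of_mul_pos_right hM
    exact_mod_cast (pos_of_mul_pos_left hM (Nat.zero_le _)).ne'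
  have hk : (k : ℝ) ≠ 0 := by
    exact_mod_cast (pos_of_mul_pos_right hM (Nat.zero_le _)).ne'
  rw [density, density, mul_comm N k, countMod_of_dvd h]
  push_cast
  field_simp

theorem countMod_mul_of_coprime {a b : ℕ} {P Q : ℤ → Prop} (hP : PeriodicMod a P)
    (hQ : PeriodicMod b Q) (hab : a.Coprime b) (ha : 0 < a) (hb : 0 < b) :
    countMod (a * b) (fun n => P n ∧ Q n) = countMod a P * countMod b Q := by
  classical
  have key : ∀ {N : ℕ} {P : ℤ → Prop}, PeriodicMod N P → ∀ {m n : ℕ}, m ≡ n [MOD N] →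
      (P m ↔ P n) := fun h m n hmn => h.congr ((Nat.modEq_iff_dvd.mp hmn.symm))
  simp only [countMod]
  rw [← Finset.card_product]
  refine Finset.card_nbij' (fun n : ℕ => (n % a, n % b))
    (fun x => (Nat.chineseRemainder hab x.1 x.2 : ℕ)) ?_ ?_ ?_ ?_
  · intro n hn
    simp only [Finset.coe_filter, Finset.mem_range, Set.mem_ofPred_eq] at hn
    simp only [Finset.coe_product, Finset.coe_filter, Finset.mem_range, Set.mem_prod,
      Set.mem_ofPred_eq]
    exact ⟨⟨Nat.mod_lt _ ha, (key hP (Nat.mod_modEq n a)).mpr hn.2.1⟩,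
      ⟨Nat.mod_lt _ hb, (key hQ (Nat.mod_modEq n b)).mpr hn.2.2⟩⟩
  · rintro ⟨x, y⟩ hx
    simp only [Finset.coe_product, Finset.coe_filter, Finset.mem_range, Set.mem_prod,
      Set.mem_ofPred_eq] at hx ⊢
    exact ⟨Nat.chineseRemainder_lt_mul hab _ _ ha.ne' hb.ne',
      (key hP (Nat.chineseRemainder hab x y).2.1).mpr hx.1.2,
      (key hQ (Nat.chineseRemainder hab x y).2.2).mpr hx.2.2⟩
  · intro n hn
    simp only [Finset.coe_filter, Finset.mem_range, Set.mem_ofPred_eq] at hn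
    have h1 := Nat.chineseRemainder_modEq_unique hab (a := n % a) (b := n % b) (z := n)
      (Nat.mod_modEq n a).symm (Nat.mod_modEq n b).symm
    exact (h1.symm.eq_of_lt_of_lt (Nat.chineseRemainder_lt_mul hab _ _ ha.ne' hb.ne') hn.1)
  · rintro ⟨x, y⟩ hx
    simp only [Finset.coe_product, Finset.coe_filter, Finset.mem_range, Set.mem_prod,
      Set.mem_ofPred_eq] at hx
    have h1 : (Nat.chineseRemainder hab x y : ℕ) % a = x % a := (Nat.chineseRemainder hab x y).2.1
    have h2 : (Nat.chineseRemainder hab x y : ℕ) % b = y % b := (Nat.chineseRemainder hab x y).2.2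
    simp only [h1, h2, Nat.mod_eq_of_lt hx.1.1, Nat.mod_eq_of_lt hx.2.1]

theorem density_mul_of_coprime {a b : ℕ} {P Q : ℤ → Prop} (hP : PeriodicMod a P)
    (hQ : PeriodicMod b Q) (hab : a.Coprime b) (ha : 0 < a) (hb : 0 < b) :
    density (a * b) (fun n => P n ∧ Q n) = density a P * density b Q := by
  rw [density, countMod_mul_of_coprime hP hQ hab ha hb, density, density]
  push_cast
  rw [mul_div_mul_comm]

/-- Chinese remainder theorem for densities: conditions modulo powers of distinct primes are
independent. -/
theorem density_forall_prime {s : Finset ℕ} (hs : ∀ p ∈ s, p.Prime) {E : ℕ → ℕ}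
    {Q : ℕ → ℤ → Prop} (hQ : ∀ p ∈ s, PeriodicMod (p ^ E p) (Q p)) :
    PeriodicMod (∏ p ∈ s, p ^ E p) (fun n => ∀ p ∈ s, Q p n) ∧
      density (∏ p ∈ s, p ^ E p) (fun n => ∀ p ∈ s, Q p n) = ∏ p ∈ s, density (p ^ E p) (Q p) := by
  induction s using Finset.induction_on with
  | empty =>
    refine ⟨fun n k => by simp, ?_⟩
    rw [density_congr (Q := fun _ => True) fun n => by simp]
    simpa using density_true one_pos
  | insert q s hq ih =>
    obtain ⟨h1, h2⟩ := ih (fun p hp => hs p (Finset.mem_insert_of_mem hp))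
      (fun p hp => hQ p (Finset.mem_insert_of_mem hp))
    have hqp := hs q (Finset.mem_insert_self q s)
    have hqQ := hQ q (Finset.mem_insert_self q s)
    rw [Finset.prod_insert hq, Finset.prod_insert hq]
    have hiff : ∀ n : ℤ, (∀ p ∈ insert q s, Q p n) ↔ (Q q n ∧ ∀ p ∈ s, Q p n) := fun n => by
      simp
    constructor
    · intro n k
      refine (hiff _).trans (Iff.trans ?_ (hiff _).symm)
      exact ((hqQ.of_dvd (Dvd.intro _ rfl)).and (h1.of_dvd (Dvd.intro_left _ rfl))) n k
    · rw [density_congr hiff, density_mul_of_coprime hqQ h1, h2]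
      · refine Nat.Coprime.pow_left _
          (Nat.Coprime.prod_right fun p hp => Nat.Coprime.pow_right _ ?_)
        refine (Nat.coprime_primes hqp (hs p (Finset.mem_insert_of_mem hp))).mpr ?_
        rintro rfl
        exact hq hp
      · exact pow_pos hqp.pos _
      · exact Finset.prod_pos fun p hp => pow_pos (hs p (Finset.mem_insert_of_mem hp)).pos _

/-- An invertible affine substitution does not change the number of solutions. -/
theorem countMod_comp_affine {N : ℕ} (hN : 0 < N) {P : ℤ → Prop} (hP : PeriodicMod N P) (β c : ℤ)
    (hc : IsCoprime c N) : countMod N (fun j => P (β + j * c)) = countMod N P := by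
  classical
  have : NeZero N := ⟨hN.ne'⟩
  have hiff : ∀ z : ℤ, P z ↔ P (((z : ZMod N).val : ℕ) : ℤ) := by
    intro z
    refine hP.congr ?_
    rw [← ZMod.intCast_eq_intCast_iff_dvd_sub]
    simp
  have h1 : ∀ Q : ℤ → Prop, countMod N Q =
      (Finset.univ.filter fun x : ZMod N => Q ((x.val : ℕ) : ℤ)).card := by
    intro Q
    rw [← card_filter_range_eq_card_zmod N, ← countMod_eq]
    congr 1
    refine Finset.filter_congr fun n hn => ?_
    rw [ZMod.val_cast_of_lt (Finset.mem_range.mp hn)]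
  have hu : IsUnit (c : ZMod N) := (ZMod.coe_int_isUnit_iff_isCoprime c N).mpr hc.symm
  obtain ⟨u, hu⟩ := hu
  rw [h1, h1]
  refine Finset.card_nbij' (fun x => (β : ZMod N) + x * u) (fun y => (y - β) * (u⁻¹ : (ZMod N)ˣ))
    ?_ ?_ ?_ ?_
  · intro x hx
    simp only [Finset.coe_filter, Finset.mem_univ, true_and, Set.mem_ofPred_eq] at hx ⊢
    rw [hiff] at hx
    convert! hx using 3
    push_cast
    rw [hu]; simp
  · intro y hy
    simp only [Finset.coe_filter, Finset.mem_univ, true_and, Set.mem_ofPred_eq] at hy ⊢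
    rw [hiff]
    convert! hy using 3
    push_cast
    rw [← hu]; simp
  · intro x _
    simp
  · intro y _
    simp

/-! ### Quadratic congruences modulo prime powers -/

theorem pow_sub_dvd_of_dvd_mul {p : ℤ} (hp : Prime p) {v n : ℕ} {a b : ℤ} (h : p ^ n ∣ a * b)
    (hb : ¬ p ^ (v + 1) ∣ b) : p ^ (n - v) ∣ a := by
  induction v generalizing n b with
  | zero => exact hp.pow_dvd_of_dvd_mul_right n (by simpa using hb) h
  | succ v ih =>
    by_cases hpb : p ∣ b
    · obtain ⟨b', rfl⟩ := hpb
      rcases n with _ | n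
      · simp
      · rw [Nat.add_sub_add_right]
        refine ih (b := b') ?_ ?_
        · rw [mul_left_comm, pow_succ'] at h
          exact (mul_dvd_mul_iff_left hp.ne_zero).mp h
        · rwa [pow_succ' p (v + 1), mul_dvd_mul_iff_left hp.ne_zero] at hb
    · exact (pow_dvd_pow p (Nat.sub_le _ _)).trans (hp.pow_dvd_of_dvd_mul_right n hpb h)

/-- The roots of a quadratic polynomial modulo `p ^ n`: two roots that are close to each other
are very close, since the derivative is at a root as small as the discriminant at most. -/
theorem countMod_quadratic_le {A B C : ℤ} {p : ℕ} (hp : p.Prime) {v n : ℕ}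
    (hv : ¬ (p : ℤ) ^ (v + 1) ∣ B ^ 2 - 4 * A * C) (hn : v < n) :
    countMod (p ^ n) (fun x => (p : ℤ) ^ n ∣ A * x ^ 2 + B * x + C) ≤
      p ^ v * countMod (p ^ (v + 1)) (fun x => (p : ℤ) ∣ A * x ^ 2 + B * x + C) := by
  classical
  have hpZ : Prime (p : ℤ) := Nat.prime_iff_prime_int.mp hp
  have hsep : ∀ x y : ℤ, (p : ℤ) ^ n ∣ A * x ^ 2 + B * x + C → (p : ℤ) ^ n ∣ A * y ^ 2 + B * y + C →
      (p : ℤ) ^ (v + 1) ∣ x - y → (p : ℤ) ^ (n - v) ∣ x - y := by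
    intro x y hx hy hxy
    have h1 : (p : ℤ) ^ n ∣ (x - y) * ((2 * A * x + B) - A * (x - y)) := by
      have := dvd_sub hx hy
      rwa [show A * x ^ 2 + B * x + C - (A * y ^ 2 + B * y + C) =
        (x - y) * ((2 * A * x + B) - A * (x - y)) by ring] at this
    refine pow_sub_dvd_of_dvd_mul hpZ h1 fun h2 => hv ?_
    have h3 : (p : ℤ) ^ (v + 1) ∣ 2 * A * x + B := by
      have := dvd_add h2 (hxy.mul_left A)
      rwa [sub_add_cancel] at this
    have h4 : (p : ℤ) ^ (v + 1) ∣ A * x ^ 2 + B * x + C := (pow_dvd_pow _ hn).trans hx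
    rw [show B ^ 2 - 4 * A * C = (2 * A * x + B) * (2 * A * x + B) -
      4 * A * (A * x ^ 2 + B * x + C) by ring]
    exact dvd_sub (h3.mul_left _) (h4.mul_left _)
  have hp0 : 0 < p := hp.pos
  simp only [countMod]
  refine Finset.card_le_mul_card_image_of_maps_to (f := fun x => x % p ^ (v + 1)) ?_ _ ?_
  · intro x hx
    simp only [Finset.mem_filter, Finset.mem_range] at hx ⊢
    refine ⟨Nat.mod_lt _ (pow_pos hp0 _), ?_⟩
    have h1 : (p : ℤ) ∣ A * (x : ℤ) ^ 2 + B * x + C := (dvd_pow_self _ (by omega)).trans hx.2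
    have h2 : (p : ℤ) ∣ (x : ℤ) - ((x % p ^ (v + 1) : ℕ) : ℤ) := by
      have := Nat.modEq_iff_dvd.mp (Nat.mod_modEq x (p ^ (v + 1)))
      push_cast at this ⊢
      exact (dvd_pow_self _ (by omega)).trans this
    have h3 := dvd_sub h1 (h2.mul_right (A * (x + ((x % p ^ (v + 1) : ℕ) : ℤ)) + B))
    convert! h3 using 1
    ring
  · intro b _
    rcases Finset.eq_empty_or_nonempty (Finset.filter (fun x => x % p ^ (v + 1) = b) (Finset.filter
      (fun x : ℕ => (p : ℤ) ^ n ∣ A * (x : ℤ) ^ 2 + B * x + C) (Finset.range (p ^ n))))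
        with h | ⟨y, hy⟩
    · rw [h]; simp
    calc _ ≤ (Finset.range (p ^ v)).card := by
          refine Finset.card_le_card_of_injOn (fun x => x / p ^ (n - v)) ?_ ?_
          · intro x hx
            simp only [Finset.coe_filter, Finset.mem_filter, Finset.mem_range,
              Set.mem_ofPred_eq] at hx
            simp only [Finset.coe_range, Set.mem_Iio]
            refine Nat.div_lt_of_lt_mul ?_
            rw [← pow_add, Nat.sub_add_cancel hn.le]
            exact hx.1.1
          · intro x hx x' hx' hxx
            simp only [Finset.coe_filter, Finset.mem_filter, Finset.mem_range,
              Set.mem_ofPred_eq] at hx hx'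
            have h1 : (p : ℤ) ^ (n - v) ∣ (x : ℤ) - x' := by
              refine hsep _ _ hx.1.2 hx'.1.2 ?_
              have : x' ≡ x [MOD p ^ (v + 1)] := hx'.2.trans hx.2.symm
              have := Nat.modEq_iff_dvd.mp this
              exact_mod_cast this
            have h2 : x' ≡ x [MOD p ^ (n - v)] := Nat.modEq_iff_dvd.mpr (by exact_mod_cast h1)
            have h3 : x % p ^ (n - v) = x' % p ^ (n - v) := h2.symm
            have h4 : x / p ^ (n - v) = x' / p ^ (n - v) := hxx
            rw [← Nat.mod_add_div x (p ^ (n - v)), ← Nat.mod_add_div x' (p ^ (n - v)), h3, h4]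
      _ = p ^ v := Finset.card_range _

theorem countMod_roots_quadratic_le_two {A B C : ℤ} {p : ℕ} (hp : p.Prime) (hp2 : p ≠ 2)
    (hpA : ¬ (p : ℤ) ∣ A) : countMod p (fun x => (p : ℤ) ∣ A * x ^ 2 + B * x + C) ≤ 2 := by
  have : Fact p.Prime := ⟨hp⟩
  have h := card_roots_quadratic (B := B) (C := C) hp2 hpA
  rw [countMod_eq p (fun x => (p : ℤ) ∣ A * x ^ 2 + B * x + C)] at h
  rcases jacobiSym.trichotomy (B ^ 2 - 4 * A * C) p with h' | h' | h' <;> rw [h'] at h <;> omega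

/-- The number of roots of a quadratic polynomial with nonzero discriminant modulo the prime powers
is bounded. -/
theorem exists_countMod_quadratic_le {A B C : ℤ} (hA : A ≠ 0) (hD : B ^ 2 - 4 * A * C ≠ 0) :
    ∃ K : ℕ, ∀ p : ℕ, p.Prime → ∀ n : ℕ,
      countMod (p ^ n) (fun x => (p : ℤ) ^ n ∣ A * x ^ 2 + B * x + C) ≤ K := by
  set D := B ^ 2 - 4 * A * C with hDdef
  set P := (2 * A * D).natAbs with hP
  have hP0 : 2 * A * D ≠ 0 := mul_ne_zero (mul_ne_zero two_ne_zero hA) hD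
  -- `P` bounds the exceptional primes and the exponents with which they divide the discriminant
  refine ⟨2 + P ^ P * P ^ (P + 1), fun p hp n => ?_⟩
  by_cases hdiv : (p : ℤ) ∣ 2 * A * D
  · have hpP : p ≤ P := Nat.le_of_dvd (Int.natAbs_pos.mpr hP0) (Int.natCast_dvd.mp hdiv)
    have hP1 : 1 ≤ P := hp.one_le.trans hpP
    have hv : ¬ (p : ℤ) ^ (P + 1) ∣ D := by
      intro h
      have h1 : p ^ (P + 1) ∣ D.natAbs := Int.natCast_dvd.mp (by exact_mod_cast h)
      have h2 := Nat.le_of_dvd (Int.natAbs_pos.mpr hD) h1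
      have h3 : D.natAbs ≤ P := by
        rw [hP, Int.natAbs_mul]
        exact Nat.le_mul_of_pos_left _ (Int.natAbs_pos.mpr (mul_ne_zero two_ne_zero hA))
      have h4 : P + 1 < p ^ (P + 1) := Nat.lt_pow_self hp.one_lt
      omega
    have hle : p ^ P ≤ P ^ P := Nat.pow_le_pow_left hpP P
    rcases Nat.lt_or_ge P n with h | h
    · refine (countMod_quadratic_le hp hv h).trans ?_
      have h1 := countMod_le (p ^ (P + 1)) (fun x => (p : ℤ) ∣ A * x ^ 2 + B * x + C)
      have h2 : p ^ (P + 1) ≤ P ^ (P + 1) := Nat.pow_le_pow_left hpP (P + 1)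
      have := Nat.mul_le_mul hle (h1.trans h2)
      omega
    · have h1 := countMod_le (p ^ n) (fun x => (p : ℤ) ^ n ∣ A * x ^ 2 + B * x + C)
      have h2 : p ^ n ≤ P ^ P := (Nat.pow_le_pow_right hp.pos h).trans hle
      have h3 : P ^ P ≤ P ^ P * P ^ (P + 1) := Nat.le_mul_of_pos_right _ (by positivity)
      omega
  · have hp2 : p ≠ 2 := by
      rintro rfl
      exact hdiv ⟨A * D, by push_cast; ring⟩
    have hpA : ¬ (p : ℤ) ∣ A := fun h => hdiv ((h.mul_left 2).mul_right D)
    have hpD : ¬ (p : ℤ) ^ (0 + 1) ∣ D := by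
      rw [zero_add, pow_one]
      exact fun h => hdiv (h.mul_left _)
    rcases Nat.eq_zero_or_pos n with rfl | hn
    · exact (countMod_le _ _).trans (by simp; omega)
    · have h1 := countMod_quadratic_le hp hpD hn
      rw [pow_zero, one_mul, zero_add, pow_one] at h1
      have := countMod_roots_quadratic_le_two (B := B) (C := C) hp hp2 hpA
      omega

/-- Hensel's lemma for quadratic polynomials, from `p` to `p ^ 2`. -/
theorem countMod_sq_quadratic {A B C : ℤ} {p : ℕ} (hp : p.Prime)
    (hD : ¬ (p : ℤ) ∣ B ^ 2 - 4 * A * C) :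
    countMod (p ^ 2) (fun x => (p : ℤ) ^ 2 ∣ A * x ^ 2 + B * x + C) =
      countMod p (fun x => (p : ℤ) ∣ A * x ^ 2 + B * x + C) := by
  classical
  have hpZ : Prime (p : ℤ) := Nat.prime_iff_prime_int.mp hp
  rw [sq p, countMod_mul]
  conv_rhs => rw [countMod, Finset.card_filter]
  refine Finset.sum_congr rfl fun β _ => ?_
  split_ifs with h
  · obtain ⟨c, hc⟩ := h
    have hd : ¬ (p : ℤ) ∣ 2 * A * β + B := by
      intro hd
      refine hD ?_
      rw [show B ^ 2 - 4 * A * C = (2 * A * β + B) * (2 * A * β + B) -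
        4 * A * (A * (β : ℤ) ^ 2 + B * β + C) by ring, hc]
      exact dvd_sub (hd.mul_left _) ((Dvd.intro _ rfl).mul_left _)
    have hcop : IsCoprime (2 * A * (β : ℤ) + B) (p : ℤ) :=
      ((Prime.coprime_iff_not_dvd hpZ).mpr hd).symm
    have hper : PeriodicMod p (fun n => (p : ℤ) ∣ n) := by
      simpa using periodicMod_dvd_eval X p
    have h1 := countMod_comp_affine hp.pos hper c _ hcop
    rw [countMod_congr (Q := fun j => (p : ℤ) ∣ c + j * (2 * A * (β : ℤ) + B)), h1]
    · rw [countMod]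
      rw [Finset.card_eq_one]
      refine ⟨0, ?_⟩
      ext x
      simp only [Finset.mem_filter, Finset.mem_range, Finset.mem_singleton]
      constructor
      · rintro ⟨hx, hx'⟩
        exact Nat.eq_zero_of_dvd_of_lt (by exact_mod_cast hx') hx
      · rintro rfl
        exact ⟨hp.pos, by simp⟩
    · intro j _
      have : A * ((β : ℤ) + j * p) ^ 2 + B * (β + j * p) + C =
          p * (c + j * (2 * A * β + B)) + p ^ 2 * (A * j ^ 2) := by
        linear_combination hc
      rw [this, dvd_add_left (Dvd.intro _ rfl), sq, mul_dvd_mul_iff_left hpZ.ne_zero]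
  · refine countMod_eq_zero fun j hj => ?_
    refine h ?_
    have h1 : (p : ℤ) ∣ A * ((β : ℤ) + j * p) ^ 2 + B * (β + j * p) + C :=
      (dvd_pow_self _ two_ne_zero).trans hj
    have : A * ((β : ℤ) + j * p) ^ 2 + B * (β + j * p) + C = (A * (β : ℤ) ^ 2 + B * β + C) +
      p * (j * (2 * A * β + B) + p * (A * j ^ 2)) := by ring
    rw [this] at h1
    exact (dvd_add_left (Dvd.intro _ rfl)).mp h1

/-! ### Local densities of square factors -/

theorem dvd_mul_left_iff_of_isCoprime {a b c : ℤ} (h : IsCoprime a b) : a ∣ b * c ↔ a ∣ c :=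
  ⟨h.dvd_of_dvd_mul_left, fun h => h.mul_left _⟩

section LocalDensity

variable (W G : ℤ[X])

/-- The conditions at `p` for `m ^ 2` with `p ^ k ∥ m` to be the largest square dividing `G(n)`,
with `W(n)` prime to `p`. -/
def ExactSquareAt (p k : ℕ) (n : ℤ) : Prop :=
  ¬ (p : ℤ) ∣ W.eval n ∧ (p : ℤ) ^ (2 * k) ∣ G.eval n ∧ ¬ (p : ℤ) ^ (2 * k + 2) ∣ G.eval n

/-- `p ^ 2` divides `W(n) ^ 2 (G(n) / m ^ 2)`. It is used only when `m ^ 2 ∣ G(n)`, so that the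
division is exact. -/
def BadAt (m p : ℕ) (n : ℤ) : Prop :=
  (p : ℤ) ^ 2 ∣ W.eval n ^ 2 * (G.eval n / (m : ℤ) ^ 2)

/-- The number of `x` modulo `p ^ n` with `G(x) ≡ 0` modulo `p ^ n` and `W(x)` prime to `p`. -/
noncomputable def rootCount (p n : ℕ) : ℕ :=
  countMod (p ^ n) (fun x => ¬ (p : ℤ) ∣ W.eval x ∧ (p : ℤ) ^ n ∣ G.eval x)

variable {W G}

theorem periodicMod_not_dvd {p n : ℕ} (hn : 1 ≤ n) :
    PeriodicMod (p ^ n) (fun x => ¬ (p : ℤ) ∣ W.eval x) :=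
  (periodicMod_dvd_eval W p).not.of_dvd (dvd_pow_self p (by omega))

theorem periodicMod_pow_dvd (p n : ℕ) : PeriodicMod (p ^ n) (fun x => (p : ℤ) ^ n ∣ G.eval x) := by
  simpa using periodicMod_dvd_eval G (p ^ n)

theorem periodicMod_exactSquareAt (p k : ℕ) :
    PeriodicMod (p ^ (2 * k + 2)) (ExactSquareAt W G p k) :=
  (periodicMod_not_dvd (by omega)).and
    (((periodicMod_pow_dvd p (2 * k)).of_dvd (pow_dvd_pow p (by omega))).and
      (periodicMod_pow_dvd p (2 * k + 2)).not)

theorem density_rootCount {p : ℕ} (hp : p.Prime) {n N : ℕ} (hn : 1 ≤ n) (hN : n ≤ N) :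
    density (p ^ N) (fun x => ¬ (p : ℤ) ∣ W.eval x ∧ (p : ℤ) ^ n ∣ G.eval x) =
      rootCount W G p n / (p : ℝ) ^ n := by
  rw [density_of_dvd ((periodicMod_not_dvd hn).and (periodicMod_pow_dvd p n)) (pow_pos hp.pos _)
    (pow_dvd_pow p hN), density, rootCount]
  push_cast
  rfl

theorem density_exactSquareAt {p : ℕ} (hp : p.Prime) {k : ℕ} (hk : 1 ≤ k) :
    density (p ^ (2 * k + 2)) (ExactSquareAt W G p k) =
      rootCount W G p (2 * k) / (p : ℝ) ^ (2 * k) -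
        rootCount W G p (2 * k + 2) / (p : ℝ) ^ (2 * k + 2) := by
  rw [← density_rootCount hp (show 1 ≤ 2 * k by omega) (show 2 * k ≤ 2 * k + 2 by omega),
    ← density_rootCount hp (show 1 ≤ 2 * k + 2 by omega) le_rfl, eq_sub_iff_add_eq,
    ← density_add (fun n h => h.1.2.2 h.2.2)]
  refine density_congr fun n => ?_
  have : (p : ℤ) ^ (2 * k + 2) ∣ G.eval n → (p : ℤ) ^ (2 * k) ∣ G.eval n :=
    fun h => (pow_dvd_pow _ (by omega)).trans h
  unfold ExactSquareAt
  tauto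

theorem sq_dvd_eval_add {m : ℕ} {β : ℤ} (hβ : (m : ℤ) ^ 2 ∣ G.eval β) (j : ℤ) :
    (m : ℤ) ^ 2 ∣ G.eval (β + j * (m : ℤ) ^ 2) := by
  have h := periodicMod_dvd_eval G (m ^ 2) β j
  push_cast at h
  exact h.mpr hβ

/-- Outside the prime divisors of `m` the passage to the progression `β` modulo `m ^ 2` does not
change the local count. -/
theorem countMod_badAt_of_not_dvd {m : ℕ} (hm : 0 < m) {β : ℤ} (hβ : (m : ℤ) ^ 2 ∣ G.eval β) {p : ℕ}
    (hp : p.Prime) (hpm : ¬ p ∣ m) :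
    countMod (p ^ 2) (fun j => BadAt W G m p (β + j * (m : ℤ) ^ 2)) =
      countMod (p ^ 2) (fun n => (p : ℤ) ^ 2 ∣ W.eval n ^ 2 * G.eval n) := by
  have hpZ : Prime (p : ℤ) := Nat.prime_iff_prime_int.mp hp
  have hcop : IsCoprime ((m : ℤ) ^ 2) (((p ^ 2 : ℕ)) : ℤ) := by
    push_cast
    refine IsCoprime.pow ?_
    rw [Nat.isCoprime_iff_coprime, Nat.coprime_comm, hp.coprime_iff_not_dvd]
    exact hpm
  have hper : PeriodicMod (p ^ 2) (fun n => (p : ℤ) ^ 2 ∣ W.eval n ^ 2 * G.eval n) := by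
    intro n k
    have h := periodicMod_dvd_eval (W ^ 2 * G) (p ^ 2) n k
    simp only [eval_mul, eval_pow] at h
    exact_mod_cast h
  rw [← countMod_comp_affine (pow_pos hp.pos 2) hper β _ hcop]
  refine countMod_congr fun j _ => ?_
  obtain ⟨c, hc⟩ := sq_dvd_eval_add hβ j
  have hm0 : (m : ℤ) ^ 2 ≠ 0 := by positivity
  rw [BadAt, hc, Int.mul_ediv_cancel_left _ hm0, mul_left_comm]
  push_cast at hcop
  exact (dvd_mul_left_iff_of_isCoprime hcop.symm).symm

/-- At a prime divisor of `m` the local density is that of the exact square divisibility. -/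
theorem not_badAt_iff {m : ℕ} (hm : 0 < m) {n : ℤ} (hn : (m : ℤ) ^ 2 ∣ G.eval n) {p : ℕ}
    (hp : p.Prime) : ¬ BadAt W G m p n ↔ ExactSquareAt W G p (m.factorization p) n := by
  have hpZ : Prime (p : ℤ) := Nat.prime_iff_prime_int.mp hp
  set k := m.factorization p with hk
  obtain ⟨c, hc⟩ := hn
  have hm0 : (m : ℤ) ^ 2 ≠ 0 := by positivity
  have hmk : (m : ℤ) = (p : ℤ) ^ k * ((m / p ^ k : ℕ) : ℤ) := by
    exact_mod_cast (Nat.ordProj_mul_ordCompl_eq_self m p).symm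
  have hcomp : ¬ (p : ℤ) ∣ ((m / p ^ k : ℕ) : ℤ) := by
    exact_mod_cast Nat.not_dvd_ordCompl hp hm.ne'
  set m' : ℤ := ((m / p ^ k : ℕ) : ℤ)
  have hcop : IsCoprime ((p : ℤ) ^ 2) (m' ^ 2) := ((Prime.coprime_iff_not_dvd hpZ).mpr hcomp).pow
  have hG : G.eval n = (p : ℤ) ^ (2 * k) * (m' ^ 2 * c) := by rw [hc, hmk]; ring
  have h1 : (p : ℤ) ^ (2 * k + 2) ∣ G.eval n ↔ (p : ℤ) ^ 2 ∣ c := by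
    rw [hG, pow_add, mul_dvd_mul_iff_left (pow_ne_zero _ hpZ.ne_zero)]
    exact dvd_mul_left_iff_of_isCoprime hcop
  rw [BadAt, ExactSquareAt, h1, hc, Int.mul_ediv_cancel_left _ hm0, ← hc]
  by_cases hW : (p : ℤ) ∣ W.eval n
  · have : (p : ℤ) ^ 2 ∣ W.eval n ^ 2 * c := (pow_dvd_pow_of_dvd hW 2).mul_right c
    tauto
  · have hcW : IsCoprime ((p : ℤ) ^ 2) (W.eval n ^ 2) :=
      ((Prime.coprime_iff_not_dvd hpZ).mpr hW).pow
    rw [dvd_mul_left_iff_of_isCoprime hcW]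
    have : (p : ℤ) ^ (2 * k) ∣ G.eval n := hG ▸ Dvd.intro _ rfl
    tauto

theorem prod_primeFactors_pow_dvd (m : ℕ) :
    (∏ p ∈ m.primeFactors, p ^ 2) ∣ m ^ 2 := by
  rw [Finset.prod_pow]
  exact pow_dvd_pow_of_dvd (Nat.prod_primeFactors_dvd m) 2

/-- The sum of the local densities over the progressions modulo `m ^ 2` on which `m ^ 2 ∣ G`. -/
theorem sum_prod_local_density {m : ℕ} (hm : 0 < m) :
    ∑ β ∈ (Finset.range (m ^ 2)).filter (fun β : ℕ => (m : ℤ) ^ 2 ∣ G.eval (β : ℤ)),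
      ∏ p ∈ m.primeFactors, (1 - (countMod (p ^ 2)
        (fun j => BadAt W G m p ((β : ℤ) + j * (m : ℤ) ^ 2)) : ℝ) / (p : ℝ) ^ 2) =
      (m : ℝ) ^ 2 * ∏ p ∈ m.primeFactors,
        density (p ^ (2 * m.factorization p + 2)) (ExactSquareAt W G p (m.factorization p)) := by
  classical
  have hprime : ∀ p ∈ m.primeFactors, p.Prime := fun p hp => Nat.prime_of_mem_primeFactors hp
  have hfac : ∀ p ∈ m.primeFactors, 1 ≤ m.factorization p := fun p hp =>
    (hprime p hp).factorization_pos_of_dvd hm.ne' (Nat.dvd_of_mem_primeFactors hp)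
  have hm2 : 0 < m ^ 2 := pow_pos hm 2
  have hmR : (m : ℝ) ≠ 0 := by positivity
  obtain ⟨hper, hdens⟩ := density_forall_prime hprime (E := fun p => 2 * m.factorization p + 2)
    (Q := fun p => ExactSquareAt W G p (m.factorization p))
    (fun p _ => periodicMod_exactSquareAt p _)
  have hdvd4 : (∏ p ∈ m.primeFactors, p ^ (2 * m.factorization p + 2)) ∣ m ^ 2 * m ^ 2 := by
    have : ∏ p ∈ m.primeFactors, p ^ (2 * m.factorization p + 2) =
        (∏ p ∈ m.primeFactors, p ^ m.factorization p) ^ 2 * ∏ p ∈ m.primeFactors, p ^ 2 := by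
      rw [← Finset.prod_pow, ← Finset.prod_mul_distrib]
      exact Finset.prod_congr rfl fun p _ => by rw [pow_add, ← pow_mul, mul_comm 2]
    rw [this]
    refine mul_dvd_mul ?_ (prod_primeFactors_pow_dvd m)
    have := Nat.prod_factorization_pow_eq_self hm.ne'
    rw [Finsupp.prod, Nat.support_factorization] at this
    rw [this]
  -- count the residues modulo `m ^ 4` by their residue `β` modulo `m ^ 2`
  rw [← hdens, ← density_of_dvd hper (Nat.mul_pos hm2 hm2) hdvd4, density, countMod_mul]
  push_cast
  rw [Finset.sum_filter, Finset.sum_div, Finset.mul_sum]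
  refine Finset.sum_congr rfl fun β _ => ?_
  split_ifs with hβ
  · have hexact : ∀ j : ℤ, ∀ p ∈ m.primeFactors, (ExactSquareAt W G p (m.factorization p)
        ((β : ℤ) + j * (m : ℤ) ^ 2) ↔ ¬ BadAt W G m p ((β : ℤ) + j * (m : ℤ) ^ 2)) :=
      fun j p hp => (not_badAt_iff hm (sq_dvd_eval_add hβ j) (hprime p hp)).symm
    obtain ⟨hper', hdens'⟩ := density_forall_prime hprime (E := fun _ => 2)
      (Q := fun p j => ExactSquareAt W G p (m.factorization p) ((β : ℤ) + j * (m : ℤ) ^ 2))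
      (fun p hp => (periodicMod_exactSquareAt p (m.factorization p)).comp_affine _ (by
        push_cast
        rw [pow_add, mul_comm]
        refine mul_dvd_mul dvd_rfl ?_
        rw [mul_comm, pow_mul]
        refine pow_dvd_pow_of_dvd ?_ 2
        exact_mod_cast Nat.ordProj_dvd m p))
    have hone : ∀ p ∈ m.primeFactors, 1 - (countMod (p ^ 2)
        (fun j => BadAt W G m p ((β : ℤ) + j * (m : ℤ) ^ 2)) : ℝ) / (p : ℝ) ^ 2 =
        density (p ^ 2) (fun j => ExactSquareAt W G p (m.factorization p)
          ((β : ℤ) + j * (m : ℤ) ^ 2)) := by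
      intro p hp
      rw [density_congr fun j => hexact j p hp, density_not (pow_pos (hprime p hp).pos 2), density]
      push_cast
      rfl
    rw [Finset.prod_congr rfl hone, ← hdens', ← density_of_dvd hper' hm2
      (prod_primeFactors_pow_dvd m), density]
    push_cast
    field_simp
  · -- the conditions at all `p ∣ m` together imply `m ^ 2 ∣ G(β)`
    have hno : ∀ j : ℤ, ¬ ∀ p ∈ m.primeFactors, ExactSquareAt W G p (m.factorization p)
        ((β : ℤ) + j * (m : ℤ) ^ 2) := by
      intro j hj
      refine hβ ?_
      have h := periodicMod_dvd_eval G (m ^ 2) β j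
      push_cast at h
      refine h.mp ?_
      have hprod : ((∏ p ∈ m.primeFactors, p ^ (2 * m.factorization p) : ℕ) : ℤ) ∣
          G.eval ((β : ℤ) + j * (m : ℤ) ^ 2) := by
        push_cast
        refine Finset.prod_dvd_of_coprime ?_ fun p hp => (hj p hp).2.1
        intro p hp p' hp' hne
        refine IsCoprime.pow ?_
        rw [Nat.isCoprime_iff_coprime]
        exact (Nat.coprime_primes (hprime p hp) (hprime p' hp')).mpr hne
      have hm2' : ∏ p ∈ m.primeFactors, p ^ (2 * m.factorization p) = m ^ 2 := by
        have := Nat.prod_factorization_pow_eq_self hm.ne'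
        rw [Finsupp.prod, Nat.support_factorization] at this
        conv_rhs => rw [← this]
        rw [← Finset.prod_pow]
        exact Finset.prod_congr rfl fun p _ => by rw [← pow_mul, mul_comm 2]
      rw [hm2'] at hprod
      exact_mod_cast hprod
    rw [countMod_eq_zero fun j => by simpa using hno j]
    simp

end LocalDensity

/-! ### Irreducible quadratic polynomials -/

theorem natDegree_leadingCoeff_of_C_mul_eq {f : ℤ[X]} {d A B C' : ℤ} (hd : 0 < d) (hA : 0 < A)
    (h : C d * f = C A * X ^ 2 + C B * X + C C') : f.natDegree = 2 ∧ 0 < f.leadingCoeff := by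
  have h1 : f.natDegree = 2 := by
    rw [← natDegree_C_mul hd.ne', h, natDegree_quadratic hA.ne']
  have h2 : d * f.leadingCoeff = A := by
    have := congrArg leadingCoeff h
    rwa [leadingCoeff_mul, leadingCoeff_C, leadingCoeff_quadratic hA.ne'] at this
  exact ⟨h1, pos_of_mul_pos_right (h2 ▸ hA) hd.le⟩

theorem eval_eq_of_natDegree_eq_two {f : ℤ[X]} (hf : f.natDegree = 2) (n : ℤ) :
    f.eval n = f.coeff 2 * n ^ 2 + f.coeff 1 * n + f.coeff 0 := by
  conv_lhs => rw [eq_quadratic_of_degree_le_two (natDegree_le_iff_degree_le.mp hf.le)]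
  simp

theorem Irreducible.not_isSquare_discrim {f : ℤ[X]} (hf : Irreducible f) (hdeg : f.natDegree = 2) :
    ¬ IsSquare (f.coeff 1 ^ 2 - 4 * f.coeff 2 * f.coeff 0) := by
  rintro ⟨s, hs⟩
  have hA : f.coeff 2 ≠ 0 := by
    rw [← hdeg, coeff_natDegree, leadingCoeff_ne_zero]
    exact hf.ne_zero
  -- completing the square splits `4 A f` into linear factors
  have hfac : C (4 * f.coeff 2) * f = (C (2 * f.coeff 2) * X + C (f.coeff 1 - s)) *
      (C (2 * f.coeff 2) * X + C (f.coeff 1 + s)) := by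
    have hq := eq_quadratic_of_degree_le_two (natDegree_le_iff_degree_le.mp hdeg.le)
    have := congrArg (C : ℤ → ℤ[X]) hs
    simp only [map_mul, map_add, map_sub, map_pow, map_ofNat] at this ⊢
    linear_combination (4 * C (f.coeff 2)) * hq - this
  have hlin : ∀ c : ℤ, ¬ f ∣ C (2 * f.coeff 2) * X + C c := by
    intro c h
    have h2 : (2 * f.coeff 2 : ℤ) ≠ 0 := mul_ne_zero two_ne_zero hA
    have hne : C (2 * f.coeff 2) * X + C c ≠ 0 := by
      intro h0
      have := natDegree_linear (a := 2 * f.coeff 2) (b := c) h2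
      rw [h0] at this
      simp at this
    have := natDegree_le_of_dvd h hne
    rw [hdeg, natDegree_linear h2] at this
    omega
  have hdvd : f ∣ (C (2 * f.coeff 2) * X + C (f.coeff 1 - s)) *
      (C (2 * f.coeff 2) * X + C (f.coeff 1 + s)) := hfac ▸ Dvd.intro_left _ rfl
  rcases hf.prime.dvd_or_dvd hdvd with h | h
  · exact hlin _ h
  · exact hlin _ h

/-- The number of roots modulo `p` of an irreducible quadratic polynomial is `1 + e(p)` with a
nontrivial real character `e`, for all but finitely many primes `p`; modulo `p ^ 2` it is the
same. -/
theorem exists_isRealCharacter_roots {f : ℤ[X]} (hf : Irreducible f) (hdeg : f.natDegree = 2) :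
    ∃ (e : ℕ → ℝ) (L : ℝ), IsRealCharacter e L ∧ ∀ᶠ p : ℕ in atTop, p.Prime →
      (countMod p (fun x => (p : ℤ) ∣ f.eval x) : ℝ) = 1 + e p ∧
      countMod (p ^ 2) (fun x => (p : ℤ) ^ 2 ∣ f.eval x) =
        countMod p (fun x => (p : ℤ) ∣ f.eval x) := by
  have hD := hf.not_isSquare_discrim hdeg
  obtain ⟨e, L, he, hval⟩ := exists_isRealCharacter_jacobiSym hD
  refine ⟨e, L, he, ?_⟩
  have hA : f.coeff 2 ≠ 0 := by
    rw [← hdeg, coeff_natDegree, leadingCoeff_ne_zero]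
    exact hf.ne_zero
  have hD0 : f.coeff 1 ^ 2 - 4 * f.coeff 2 * f.coeff 0 ≠ 0 := fun h => hD (h ▸ IsSquare.zero)
  filter_upwards [eventually_gt_atTop (2 * f.coeff 2 *
    (f.coeff 1 ^ 2 - 4 * f.coeff 2 * f.coeff 0)).natAbs] with p hpgt hp
  have hnd : ¬ (p : ℤ) ∣ 2 * f.coeff 2 * (f.coeff 1 ^ 2 - 4 * f.coeff 2 * f.coeff 0) := by
    intro h
    have := Nat.le_of_dvd (Int.natAbs_pos.mpr (mul_ne_zero (mul_ne_zero two_ne_zero hA) hD0))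
      (Int.natCast_dvd.mp h)
    omega
  have hp2 : p ≠ 2 := by
    rintro rfl
    exact hnd ((Dvd.intro _ rfl : ((2 : ℕ) : ℤ) ∣ 2 * f.coeff 2).mul_right _)
  have hpA : ¬ (p : ℤ) ∣ f.coeff 2 := fun h => hnd ((h.mul_left 2).mul_right _)
  have hpD : ¬ (p : ℤ) ∣ f.coeff 1 ^ 2 - 4 * f.coeff 2 * f.coeff 0 := fun h => hnd (h.mul_left _)
  simp only [eval_eq_of_natDegree_eq_two hdeg]
  have : Fact p.Prime := ⟨hp⟩
  refine ⟨?_, countMod_sq_quadratic hp hpD⟩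
  have h := card_roots_quadratic (B := f.coeff 1) (C := f.coeff 0) hp2 hpA
  rw [countMod_eq p (fun x => (p : ℤ) ∣ f.coeff 2 * x ^ 2 + f.coeff 1 * x + f.coeff 0)] at h
  rw [hval p hp hp2 hpD]
  exact_mod_cast h

/-! ### The polynomials of a family -/

namespace MNTFamily

variable (F : MNTFamily)

theorem t_sq_sub : F.t ^ 2 - C F.epsilon * F.t + C F.epsilon = C (F.d : ℤ) * F.r := by
  rw [← F.cyclotomic_eq]
  have c4 : cyclotomic 4 ℤ = X ^ 2 + 1 := by
    have h4 := cyclotomic_prime_pow_eq_geom_sum (R := ℤ) (n := 1) Nat.prime_two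
    norm_num [Finset.sum_range_succ] at h4
    rw [h4]; ring
  rcases F.hk with h | h | h
  · simp only [h, epsilon, t, cyclotomic_three]
    simp
    ring
  · simp only [h, epsilon, t, c4]
    simp
    ring
  · simp only [h, epsilon, t, cyclotomic_six]
    simp
    ring

theorem epsilon_pos : 0 < F.epsilon := by
  unfold epsilon; split_ifs <;> norm_num

theorem epsilon_lt_four : F.epsilon < 4 := by
  unfold epsilon; split_ifs <;> norm_num

theorem C_d_mul_r : C (F.d : ℤ) * F.r = C (F.a ^ 2) * X ^ 2 +
    C (2 * F.a * F.b - F.epsilon * F.a) * X + C (F.b ^ 2 - F.epsilon * F.b + F.epsilon) := by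
  rw [← F.t_sq_sub, t]
  simp only [map_mul, map_add, map_sub, map_pow, map_ofNat]
  ring

theorem d_pos : 0 < F.d := by
  rcases Nat.eq_zero_or_pos F.d with h | h
  · have h1 := F.C_d_mul_r
    rw [h, Nat.cast_zero, C_0, zero_mul] at h1
    have h2 := natDegree_quadratic (R := ℤ) (a := F.a ^ 2)
      (b := 2 * F.a * F.b - F.epsilon * F.a) (c := F.b ^ 2 - F.epsilon * F.b + F.epsilon)
      (pow_ne_zero 2 F.ha)
    rw [← h1] at h2
    simp at h2
  · exact h

theorem C_d_mul_q : C (F.d : ℤ) * F.q = C (F.h * F.a ^ 2) * X ^ 2 +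
    C (F.h * (2 * F.a * F.b - F.epsilon * F.a) + F.d * F.a) * X +
    C (F.h * (F.b ^ 2 - F.epsilon * F.b + F.epsilon) + F.d * F.b - F.d) := by
  have h := F.C_d_mul_r
  rw [q, t]
  simp only [map_mul, map_add, map_sub, map_pow, map_ofNat] at h ⊢
  linear_combination C (F.h : ℤ) * h

theorem C_d_mul_Delta0 : C (F.d : ℤ) * F.Delta0 = C ((4 * F.h - F.d) * F.a ^ 2) * X ^ 2 +
    C ((4 * F.h - F.d) * (2 * F.a * F.b) - 4 * (F.epsilon * F.h - F.d) * F.a) * X +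
    C ((4 * F.h - F.d) * F.b ^ 2 - 4 * (F.epsilon * F.h - F.d) * F.b +
      4 * (F.epsilon * F.h - F.d)) := by
  have h := F.C_d_mul_q
  rw [Delta0, t]
  simp only [map_mul, map_add, map_sub, map_pow, map_ofNat] at h ⊢
  linear_combination 4 * h

variable {F}

theorem d_lt_of_irreducible (hirr : Irreducible (F.Delta.map (Int.castRingHom ℚ))) :
    (F.d : ℤ) < 4 * F.h := by
  have hd : (F.d : ℤ) ≤ 4 * F.h := by exact_mod_cast F.hd
  refine lt_of_le_of_ne hd fun h => ?_
  have : F.Delta = C (F.w1 ^ 2 + F.w2) := by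
    rw [Delta, w0, h, sub_self, mul_zero, C_0, zero_mul, zero_add]
    simp
  rw [this, map_C] at hirr
  exact not_irreducible_C _ hirr

theorem epsilon_mul_h_sub_d_ne_zero (hirr : Irreducible (F.Delta.map (Int.castRingHom ℚ))) :
    F.epsilon * F.h - F.d ≠ 0 := by
  intro h
  have : F.Delta = (C F.w0 * X + C F.w1) ^ 2 := by
    rw [Delta, w2, h, mul_zero, C_0, add_zero]
  rw [this, Polynomial.map_pow] at hirr
  exact not_irreducible_pow (by norm_num) hirr

variable (F) in
theorem r_natDegree : F.r.natDegree = 2 ∧ 0 < F.r.leadingCoeff :=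
  natDegree_leadingCoeff_of_C_mul_eq (by exact_mod_cast F.d_pos) (by have := F.ha; positivity)
    F.C_d_mul_r

variable (F) in
theorem q_natDegree : F.q.natDegree = 2 ∧ 0 < F.q.leadingCoeff :=
  natDegree_leadingCoeff_of_C_mul_eq (by exact_mod_cast F.d_pos)
    (by have := F.ha; have := F.hh; positivity) F.C_d_mul_q

theorem Delta0_natDegree (hirr : Irreducible (F.Delta.map (Int.castRingHom ℚ))) :
    F.Delta0.natDegree = 2 ∧ 0 < F.Delta0.leadingCoeff :=
  natDegree_leadingCoeff_of_C_mul_eq (by exact_mod_cast F.d_pos)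
    (mul_pos (sub_pos.mpr (d_lt_of_irreducible hirr)) (by have := F.ha; positivity))
    F.C_d_mul_Delta0

theorem u_pos (hirr : Irreducible (F.Delta.map (Int.castRingHom ℚ))) : 0 < F.u :=
  mul_pos (by exact_mod_cast F.d_pos) (sub_pos.mpr (d_lt_of_irreducible hirr))

theorem w0_ne_zero (hirr : Irreducible (F.Delta.map (Int.castRingHom ℚ))) : F.w0 ≠ 0 :=
  mul_ne_zero F.ha (sub_pos.mpr (d_lt_of_irreducible hirr)).ne'

theorem Delta0_irreducible (hirr : Irreducible (F.Delta.map (Int.castRingHom ℚ)))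
    (hfix : NoFixedPrimeDivisor (F.r * F.q * F.Delta0)) : Irreducible F.Delta0 := by
  have hprim : F.Delta0.IsPrimitive := by
    intro c hc
    by_contra hcu
    have hc0 : c ≠ 0 := by
      rintro rfl
      rw [C_0, zero_dvd_iff] at hc
      have := (Delta0_natDegree hirr).1
      rw [hc] at this
      simp at this
    obtain ⟨p, hp, hpc⟩ := Nat.exists_prime_and_dvd (n := c.natAbs)
      (by rwa [Ne, ← Int.isUnit_iff_natAbs_eq])
    obtain ⟨n, hn⟩ := hfix p hp
    refine hn ?_
    obtain ⟨g, hg⟩ := hc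
    simp only [hg, eval_mul, eval_C]
    exact ((Int.natCast_dvd.mpr hpc).mul_right _).mul_left _
  rw [IsPrimitive.Int.irreducible_iff_irreducible_map_cast hprim]
  have hu0 := (u_pos hirr).ne'
  rw [F.Delta_eq, Polynomial.map_mul, map_C] at hirr
  have hu : IsUnit (C ((Int.castRingHom ℚ) F.u)) := by
    rw [isUnit_C, isUnit_iff_ne_zero]
    simpa using hu0
  exact (irreducible_isUnit_mul hu).mp hirr

variable (F) in
theorem t_eval (n : ℤ) : F.t.eval n = F.a * n + F.b := by simp [t]

variable (F) in
theorem d_mul_r_eval (n : ℤ) : F.d * F.r.eval n =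
    F.t.eval n ^ 2 - F.epsilon * F.t.eval n + F.epsilon := by
  have := congrArg (eval n) F.t_sq_sub
  simpa using this.symm

variable (F) in
theorem q_eval (n : ℤ) : F.q.eval n = F.h * F.r.eval n + F.t.eval n - 1 := by simp [q]

variable (F) in
theorem Delta0_eval (n : ℤ) : F.Delta0.eval n = 4 * F.q.eval n - F.t.eval n ^ 2 := by
  simp [Delta0]

/-- `q` and `r` have no common root modulo any prime. -/
theorem not_dvd_q_of_dvd_r {p : ℕ} (hp : p.Prime) {n : ℤ} (hr : (p : ℤ) ∣ F.r.eval n) :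
    ¬ (p : ℤ) ∣ F.q.eval n := by
  intro hq
  have h1 : (p : ℤ) ∣ F.t.eval n - 1 := by
    have := dvd_sub hq (hr.mul_left (F.h : ℤ))
    rwa [F.q_eval, show F.h * F.r.eval n + F.t.eval n - 1 - F.h * F.r.eval n =
      F.t.eval n - 1 by ring] at this
  have h2 := dvd_sub (hr.mul_left (F.d : ℤ)) (h1.mul_right (F.t.eval n + 1 - F.epsilon))
  rw [F.d_mul_r_eval, show F.t.eval n ^ 2 - F.epsilon * F.t.eval n + F.epsilon -
    (F.t.eval n - 1) * (F.t.eval n + 1 - F.epsilon) = 1 by ring] at h2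
  exact (Nat.prime_iff_prime_int.mp hp).not_dvd_one h2

/-- A common root of `q r` and `Δ₀` modulo a prime exists for finitely many primes only. -/
theorem eventually_not_dvd_of_dvd_Delta0 (hirr : Irreducible (F.Delta.map (Int.castRingHom ℚ))) :
    ∀ᶠ p : ℕ in atTop, p.Prime → ∀ n : ℤ, (p : ℤ) ∣ F.Delta0.eval n →
      ¬ (p : ℤ) ∣ (F.q * F.r).eval n := by
  have hne := epsilon_mul_h_sub_d_ne_zero hirr
  have h4 := F.epsilon_lt_four
  have h0 := F.epsilon_pos
  filter_upwards [eventually_gt_atTop (F.epsilon * F.h - F.d).natAbs, eventually_gt_atTop 4]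
    with p hp1 hp2 hp n hD hW
  have hpZ := Nat.prime_iff_prime_int.mp hp
  rw [eval_mul] at hW
  rw [Delta0_eval] at hD
  rcases hpZ.dvd_or_dvd hW with hq | hr
  · have ht : (p : ℤ) ∣ F.t.eval n := by
      have := dvd_sub (hq.mul_left 4) hD
      rw [sub_sub_cancel] at this
      exact hpZ.dvd_of_dvd_pow this
    have h1 : (p : ℤ) ∣ F.epsilon * F.h - F.d := by
      have e : F.epsilon * F.h - F.d = F.d * F.q.eval n -
          F.t.eval n * (F.h * (F.t.eval n - F.epsilon) + F.d) := by
        rw [F.q_eval]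
        linear_combination -(F.h : ℤ) * F.d_mul_r_eval n
      rw [e]
      exact dvd_sub (hq.mul_left _) (ht.mul_right _)
    have := Nat.le_of_dvd (Int.natAbs_pos.mpr hne) (Int.natCast_dvd.mp h1)
    omega
  · have h1 : (p : ℤ) ∣ (4 - F.epsilon) * (F.t.eval n - 1) := by
      have e : (4 - F.epsilon) * (F.t.eval n - 1) = (4 * F.q.eval n - F.t.eval n ^ 2) +
          F.r.eval n * (F.d - 4 * F.h) := by
        rw [F.q_eval]
        linear_combination -F.d_mul_r_eval n
      rw [e]
      exact dvd_add hD (hr.mul_right _)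
    rcases hpZ.dvd_or_dvd h1 with h2 | h2
    · have := Int.le_of_dvd (by omega) h2
      omega
    · refine not_dvd_q_of_dvd_r hp hr ?_
      rw [F.q_eval, add_sub_assoc]
      exact dvd_add (hr.mul_left _) h2

end MNTFamily

/-! ### Bounds along the primes -/

/-- An eventual bound for a real sequence along the primes is a bound up to a constant. -/
theorem exists_forall_prime_le {x y : ℕ → ℝ} {C : ℝ} (hy : ∀ p : ℕ, p.Prime → 0 < y p)
    (h : ∀ᶠ p : ℕ in atTop, p.Prime → x p ≤ C * y p) :
    ∃ C' : ℝ, ∀ p : ℕ, p.Prime → x p ≤ C' * y p := by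
  obtain ⟨P, hP⟩ := eventually_atTop.mp h
  refine ⟨|C| + ∑ p ∈ Finset.range P, |x p / y p|, fun p hp => ?_⟩
  have hsum : 0 ≤ ∑ p ∈ Finset.range P, |x p / y p| := Finset.sum_nonneg fun _ _ => abs_nonneg _
  rcases Nat.lt_or_ge p P with hpP | hpP
  · have h1 := Finset.single_le_sum (f := fun p => |x p / y p|) (fun _ _ => abs_nonneg _)
      (Finset.mem_range.mpr hpP)
    calc x p = x p / y p * y p := (div_mul_cancel₀ _ (hy p hp).ne').symm
      _ ≤ _ := mul_le_mul_of_nonneg_right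
        (by linarith [le_abs_self (x p / y p), abs_nonneg C]) (hy p hp).le
  · exact (hP p hpP hp).trans (mul_le_mul_of_nonneg_right
      (by linarith [le_abs_self C]) (hy p hp).le)

namespace MNTFamily

variable {F : MNTFamily}

/-! ### Local counts of a family -/

variable (F) in
theorem Cp_eq (p : ℕ) : F.Cp p =
    countMod (p ^ 2) (fun n => (p : ℤ) ^ 2 ∣ (F.q * F.r).eval n ^ 2 * F.Delta0.eval n) := by
  rw [Cp, ← countMod_eq]
  simp only [eval_mul]

variable (F) in
theorem rho_eq (p : ℕ) : F.rho p = rootCount (F.q * F.r) F.Delta0 p 2 := by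
  rw [rho, rootCount, ← countMod_eq]
  simp only [eval_mul]
  congr! 2
  exact and_comm

variable (F) in
/-- The proportion of excluded residues at `p`: the roots of `q`, of `r`, and those of `Δ₀` modulo
`p ^ 2` that are counted by neither, are disjoint. -/
theorem Cp_div_sq {p : ℕ} (hp : p.Prime) : (F.Cp p : ℝ) / (p : ℝ) ^ 2 =
    countMod p (fun x => (p : ℤ) ∣ F.q.eval x) / (p : ℝ) +
      countMod p (fun x => (p : ℤ) ∣ F.r.eval x) / (p : ℝ) + F.rho p / (p : ℝ) ^ 2 := by
  have hpZ := Nat.prime_iff_prime_int.mp hp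
  have hp2 : 0 < p ^ 2 := pow_pos hp.pos 2
  have h1 : (F.Cp p : ℝ) / (p : ℝ) ^ 2 = density (p ^ 2)
      (fun n => (p : ℤ) ^ 2 ∣ (F.q * F.r).eval n ^ 2 * F.Delta0.eval n) := by
    rw [Cp_eq, density]; push_cast; rfl
  have h2 : (F.rho p : ℝ) / (p : ℝ) ^ 2 = density (p ^ 2)
      (fun x => ¬ (p : ℤ) ∣ (F.q * F.r).eval x ∧ (p : ℤ) ^ 2 ∣ F.Delta0.eval x) := by
    rw [rho_eq, density_rootCount hp (by norm_num) le_rfl]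
  have h3 : ∀ f : ℤ[X], (countMod p (fun x => (p : ℤ) ∣ f.eval x) : ℝ) / (p : ℝ) =
      density (p ^ 2) (fun x => (p : ℤ) ∣ f.eval x) := fun f =>
    (density_of_dvd (periodicMod_dvd_eval f p) hp2 (dvd_pow_self p two_ne_zero)).symm
  rw [h1, h2, h3, h3, ← density_add fun n h => not_dvd_q_of_dvd_r hp h.2 h.1, ← density_add]
  · refine density_congr fun n => ?_
    rw [eval_mul, hpZ.dvd_mul]
    by_cases h : (p : ℤ) ∣ F.q.eval n ∨ (p : ℤ) ∣ F.r.eval n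
    · have : (p : ℤ) ^ 2 ∣ (F.q.eval n * F.r.eval n) ^ 2 * F.Delta0.eval n :=
        (pow_dvd_pow_of_dvd (hpZ.dvd_mul.mpr h) 2).mul_right _
      tauto
    · have hc : IsCoprime ((p : ℤ) ^ 2) ((F.q.eval n * F.r.eval n) ^ 2) :=
        ((Prime.coprime_iff_not_dvd hpZ).mpr (by rwa [hpZ.dvd_mul])).pow
      rw [dvd_mul_left_iff_of_isCoprime hc]
      tauto
  · intro n h
    rw [eval_mul, hpZ.dvd_mul] at h
    exact h.2.1 h.1

theorem Cp_lt (hfix : NoFixedPrimeDivisor (F.r * F.q * F.Delta0)) {p : ℕ} (hp : p.Prime) :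
    F.Cp p < p ^ 2 := by
  have hpZ := Nat.prime_iff_prime_int.mp hp
  obtain ⟨n, hn⟩ := hfix p hp
  simp only [eval_mul, hpZ.dvd_mul, not_or] at hn
  have hp2 : (0 : ℤ) < ((p ^ 2 : ℕ) : ℤ) := by exact_mod_cast pow_pos hp.pos 2
  obtain ⟨k, hk⟩ := Int.eq_ofNat_of_zero_le (Int.emod_nonneg n hp2.ne')
  have hkm : (p : ℤ) ∣ n - k := by
    have : ((p ^ 2 : ℕ) : ℤ) ∣ n - k := by rw [← hk]; exact Int.dvd_self_sub_emod
    push_cast at this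
    exact (dvd_pow_self _ two_ne_zero).trans this
  have hev : ∀ f : ℤ[X], ¬ (p : ℤ) ∣ f.eval n → ¬ (p : ℤ) ∣ f.eval (k : ℤ) := fun f hf h =>
    hf (((periodicMod_dvd_eval f p).congr hkm).mpr h)
  rw [Cp]
  calc _ < (Finset.range (p ^ 2)).card := by
        refine Finset.card_lt_card (Finset.filter_ssubset.mpr ⟨k, ?_, fun h => ?_⟩)
        · rw [Finset.mem_range]
          have := Int.emod_lt_of_pos n hp2
          rw [hk] at this
          exact_mod_cast this
        · have h1 := (dvd_pow_self (p : ℤ) two_ne_zero).trans h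
          rw [hpZ.dvd_mul] at h1
          rcases h1 with h1 | h1
          · rcases hpZ.dvd_or_dvd (hpZ.dvd_of_dvd_pow h1) with h1 | h1
            · exact hev _ hn.1.2 h1
            · exact hev _ hn.1.1 h1
          · exact hev _ hn.2 h1
    _ = p ^ 2 := Finset.card_range _

theorem one_sub_Cp_pos (hfix : NoFixedPrimeDivisor (F.r * F.q * F.Delta0)) {p : ℕ} (hp : p.Prime) :
    0 < 1 - (F.Cp p : ℝ) / (p : ℝ) ^ 2 := by
  have hp0 : (0 : ℝ) < p := by exact_mod_cast hp.pos
  rw [sub_pos, div_lt_one (by positivity)]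
  exact_mod_cast Cp_lt hfix hp

theorem exists_rootCount_le (hirr : Irreducible (F.Delta.map (Int.castRingHom ℚ)))
    (hfix : NoFixedPrimeDivisor (F.r * F.q * F.Delta0)) :
    ∃ K : ℝ, 0 ≤ K ∧ ∀ p : ℕ, p.Prime → ∀ n : ℕ,
      (rootCount (F.q * F.r) F.Delta0 p n : ℝ) ≤ K := by
  classical
  have hdeg := (Delta0_natDegree hirr).1
  have hir := Delta0_irreducible hirr hfix
  obtain ⟨K, hK⟩ := exists_countMod_quadratic_le (A := F.Delta0.coeff 2) (B := F.Delta0.coeff 1)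
    (C := F.Delta0.coeff 0)
    (by rw [← hdeg, coeff_natDegree, leadingCoeff_ne_zero]; exact hir.ne_zero)
    (fun h => hir.not_isSquare_discrim hdeg (h ▸ IsSquare.zero))
  refine ⟨K, Nat.cast_nonneg _, fun p hp n => ?_⟩
  have h := hK p hp n
  simp only [← eval_eq_of_natDegree_eq_two hdeg] at h
  refine le_trans ?_ (Nat.cast_le.mpr h)
  rw [Nat.cast_le, rootCount, ← countMod_eq, ← countMod_eq]
  exact Finset.card_le_card (Finset.monotone_filter_right _ fun x _ hx => hx.2)

/-- The local counts at almost all primes, in terms of real characters. -/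
theorem exists_isRealCharacter_local (hirr : Irreducible (F.Delta.map (Int.castRingHom ℚ)))
    (hfix : NoFixedPrimeDivisor (F.r * F.q * F.Delta0)) :
    ∃ (e₁ e₂ e₃ : ℕ → ℝ) (L₁ L₂ L₃ : ℝ), IsRealCharacter e₁ L₁ ∧ IsRealCharacter e₂ L₂ ∧
      IsRealCharacter e₃ L₃ ∧ ∀ᶠ p : ℕ in atTop, p.Prime →
        (F.rho p : ℝ) = 1 + e₃ p ∧
        (F.Cp p : ℝ) / (p : ℝ) ^ 2 =
          (2 + e₁ p + e₂ p) * (p : ℝ)⁻¹ + (1 + e₃ p) * ((p : ℝ)⁻¹) ^ 2 := by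
  obtain ⟨e₁, L₁, he₁, h₁⟩ := exists_isRealCharacter_roots F.q_irreducible (q_natDegree F).1
  obtain ⟨e₂, L₂, he₂, h₂⟩ := exists_isRealCharacter_roots F.r_irreducible (r_natDegree F).1
  obtain ⟨e₃, L₃, he₃, h₃⟩ := exists_isRealCharacter_roots (Delta0_irreducible hirr hfix)
    (Delta0_natDegree hirr).1
  refine ⟨e₁, e₂, e₃, L₁, L₂, L₃, he₁, he₂, he₃, ?_⟩
  filter_upwards [h₁, h₂, h₃, eventually_not_dvd_of_dvd_Delta0 hirr] with p h₁ h₂ h₃ h₄ hp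
  have hrho : (F.rho p : ℝ) = 1 + e₃ p := by
    rw [← (h₃ hp).1, ← (h₃ hp).2, rho_eq, rootCount]
    congr 1
    refine countMod_congr fun n _ => ⟨fun h => h.2, fun h => ⟨?_, h⟩⟩
    exact h₄ hp _ ((dvd_pow_self _ two_ne_zero).trans h)
  refine ⟨hrho, ?_⟩
  have e1 : (countMod p (fun x => (p : ℤ) ∣ F.q.eval x) : ℝ) = 1 + e₁ p := (h₁ hp).1
  rw [Cp_div_sq F hp, hrho, e1, (h₂ hp).1]
  field_simp
  ring

variable (F) in
/-- The value at `p ^ k` of the multiplicative function of `m` that the local factors of the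
progressions modulo `m ^ 2` sum up to. -/
noncomputable def gamma (p k : ℕ) : ℝ :=
  if k = 0 then 1 else (p : ℝ) ^ (2 * k) *
    density (p ^ (2 * k + 2)) (ExactSquareAt (F.q * F.r) F.Delta0 p k) *
      (1 - (F.Cp p : ℝ) / (p : ℝ) ^ 2)⁻¹

variable (F) in
theorem gamma_eq {p : ℕ} (hp : p.Prime) {k : ℕ} (hk : 1 ≤ k) : F.gamma p k =
    (rootCount (F.q * F.r) F.Delta0 p (2 * k) -
      rootCount (F.q * F.r) F.Delta0 p (2 * k + 2) * ((p : ℝ)⁻¹) ^ 2) *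
      (1 - (F.Cp p : ℝ) / (p : ℝ) ^ 2)⁻¹ := by
  have hp0 : (p : ℝ) ≠ 0 := by exact_mod_cast hp.ne_zero
  rw [gamma, if_neg (by omega), density_exactSquareAt hp hk]
  congr 1
  field_simp
  ring

theorem gamma_nonneg (hfix : NoFixedPrimeDivisor (F.r * F.q * F.Delta0)) {p : ℕ} (hp : p.Prime)
    (k : ℕ) : 0 ≤ F.gamma p k := by
  rw [gamma]
  split_ifs
  · exact zero_le_one
  · exact mul_nonneg (mul_nonneg (by positivity) (density_nonneg _ _))
      (inv_nonneg.mpr (one_sub_Cp_pos hfix hp).le)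

theorem exists_inv_one_sub_Cp_le (hirr : Irreducible (F.Delta.map (Int.castRingHom ℚ)))
    (hfix : NoFixedPrimeDivisor (F.r * F.q * F.Delta0)) :
    (∃ C : ℝ, ∀ p : ℕ, p.Prime → (F.Cp p : ℝ) / (p : ℝ) ^ 2 ≤ C * (p : ℝ)⁻¹) ∧
    ∃ M : ℝ, ∀ p : ℕ, p.Prime → (1 - (F.Cp p : ℝ) / (p : ℝ) ^ 2)⁻¹ ≤ M := by
  obtain ⟨e₁, e₂, e₃, L₁, L₂, L₃, he₁, he₂, he₃, hloc⟩ := exists_isRealCharacter_local hirr hfix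
  have hc : ∀ᶠ p : ℕ in atTop, p.Prime → (F.Cp p : ℝ) / (p : ℝ) ^ 2 ≤ 6 * (p : ℝ)⁻¹ := by
    filter_upwards [hloc] with p hloc hp
    have hx : 0 < (p : ℝ)⁻¹ := inv_pos.mpr (by exact_mod_cast hp.pos)
    have hx1 : (p : ℝ)⁻¹ ≤ 1 := inv_le_one_of_one_le₀ (by exact_mod_cast hp.one_le)
    rw [(hloc hp).2]
    have h1 := abs_le.mp (he₁.abs_le_one p)
    have h2 := abs_le.mp (he₂.abs_le_one p)
    have h3 := abs_le.mp (he₃.abs_le_one p)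
    calc _ ≤ 4 * (p : ℝ)⁻¹ + 2 * (p : ℝ)⁻¹ := by
          refine add_le_add (mul_le_mul_of_nonneg_right (by linarith) hx.le) ?_
          nlinarith
      _ = _ := by ring
  refine ⟨exists_forall_prime_le (fun p hp => inv_pos.mpr (by exact_mod_cast hp.pos)) hc, ?_⟩
  have hsmall : ∀ᶠ p : ℕ in atTop, (6 : ℝ) / p ≤ 1 / 2 :=
    (tendsto_const_div_atTop_nhds_zero_nat (6 : ℝ)).eventually_le_const (by norm_num)
  obtain ⟨M, hM⟩ := exists_forall_prime_le (x := fun p => (1 - (F.Cp p : ℝ) / (p : ℝ) ^ 2)⁻¹)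
    (y := fun _ => 1) (C := 2) (fun _ _ => one_pos) (by
      filter_upwards [hc, hsmall] with p h1 h2 hp
      have h1 := h1 hp
      rw [div_eq_mul_inv] at h2
      rw [mul_one, inv_le_comm₀ (one_sub_Cp_pos hfix hp) (by norm_num)]
      linarith)
  exact ⟨M, fun p hp => by simpa using hM p hp⟩

/-- The singular series of the two prime conditions converges. -/
theorem exists_hasEulerProduct_Cp (hirr : Irreducible (F.Delta.map (Int.castRingHom ℚ)))
    (hfix : NoFixedPrimeDivisor (F.r * F.q * F.Delta0)) :
    ∃ S : ℝ, HasEulerProduct (fun p => (1 - (F.Cp p : ℝ) / (p : ℝ) ^ 2) *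
      ((1 - 1 / (p : ℝ)) ^ 2)⁻¹) S := by
  obtain ⟨e₁, e₂, e₃, L₁, L₂, L₃, he₁, he₂, he₃, hloc⟩ := exists_isRealCharacter_local hirr hfix
  obtain ⟨l₁, hl₁⟩ := he₁.sum
  obtain ⟨l₂, hl₂⟩ := he₂.sum
  refine exists_hasEulerProduct (a := fun p => -((p : ℝ)⁻¹ * e₁ p + (p : ℝ)⁻¹ * e₂ p)) (A := 2)
    (C := 40) (l := -(l₁ + l₂)) ?_ ?_ ?_ ?_
  · intro p hp
    have h1 : (1 : ℝ) < p := by exact_mod_cast hp.one_lt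
    have h2 : 1 / (p : ℝ) < 1 := by rw [div_lt_one (by linarith)]; exact h1
    exact mul_pos (one_sub_Cp_pos hfix hp) (inv_pos.mpr (pow_pos (by linarith) 2))
  · intro p hp
    have hx : 0 < (p : ℝ)⁻¹ := inv_pos.mpr (by exact_mod_cast hp.pos)
    have h1 := abs_le.mp (he₁.abs_le_one p)
    have h2 := abs_le.mp (he₂.abs_le_one p)
    rw [abs_neg, ← mul_add, abs_mul, abs_of_pos hx, div_eq_mul_inv, mul_comm]
    refine mul_le_mul_of_nonneg_right ?_ hx.le
    rw [abs_le]
    constructor <;> linarith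
  · refine ((hl₁.add hl₂).neg).congr fun n => ?_
    rw [← Finset.sum_add_distrib, Finset.sum_neg_distrib]
  · filter_upwards [hloc, eventually_ge_atTop 2] with p hloc hp2 hp
    rw [(hloc hp).2, one_div, div_eq_mul_inv 40, ← inv_pow (p : ℝ)]
    set x := (p : ℝ)⁻¹
    have hx : 0 < x := inv_pos.mpr (by exact_mod_cast hp.pos)
    have hx2 : x ≤ 1 / 2 := by
      rw [one_div]
      exact inv_anti₀ (by norm_num) (by exact_mod_cast hp2)
    obtain ⟨h1, h1'⟩ := abs_le.mp (he₁.abs_le_one p)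
    obtain ⟨h2, h2'⟩ := abs_le.mp (he₂.abs_le_one p)
    obtain ⟨h3, h3'⟩ := abs_le.mp (he₃.abs_le_one p)
    set s := e₁ p + e₂ p with hs
    have hs1 : -2 ≤ s := by linarith
    have hs2 : s ≤ 2 := by linarith
    have h4 : 1 / 4 ≤ (1 - x) ^ 2 := by nlinarith
    have hne : 1 - x ≠ 0 := by linarith
    -- the terms of first order in `x = 1 / p` cancel up to `e₁ + e₂`
    have key : (1 - ((2 + e₁ p + e₂ p) * x + (1 + e₃ p) * x ^ 2)) * ((1 - x) ^ 2)⁻¹ -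
        (1 + -(x * e₁ p + x * e₂ p)) = x ^ 2 * (-(1 + e₃ p) - 1 - 2 * s + s * x) *
          ((1 - x) ^ 2)⁻¹ := by
      rw [hs]
      field_simp
      ring
    rw [key, abs_mul, abs_mul, abs_of_pos (pow_pos hx 2),
      abs_of_pos (inv_pos.mpr (by positivity : 0 < (1 - x) ^ 2))]
    have h5 : ((1 - x) ^ 2)⁻¹ ≤ 4 := by
      rw [inv_le_comm₀ (by positivity) (by norm_num)]
      linarith
    have h6 : |-(1 + e₃ p) - 1 - 2 * s + s * x| ≤ 10 := by
      rw [abs_le]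
      constructor <;> nlinarith
    calc _ ≤ x ^ 2 * 10 * 4 := by gcongr
      _ = _ := by ring

/-- The second Euler product converges. -/
theorem exists_hasEulerProduct_fp (hirr : Irreducible (F.Delta.map (Int.castRingHom ℚ)))
    (hfix : NoFixedPrimeDivisor (F.r * F.q * F.Delta0)) :
    ∃ S : ℝ, HasEulerProduct (fun p => (1 - 1 / (p : ℝ)) * (1 + F.fp p / (p : ℝ))) S := by
  obtain ⟨e₁, e₂, e₃, L₁, L₂, L₃, he₁, he₂, he₃, hloc⟩ := exists_isRealCharacter_local hirr hfix
  obtain ⟨l₃, hl₃⟩ := he₃.sum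
  refine exists_hasEulerProduct (a := fun p => (p : ℝ)⁻¹ * e₃ p) (A := 1) (C := 100) ?_ ?_ hl₃ ?_
  · intro p hp
    have h1 : (1 : ℝ) < p := by exact_mod_cast hp.one_lt
    have h2 : 1 / (p : ℝ) < 1 := by rw [div_lt_one (by linarith)]; exact h1
    have h3 : 0 ≤ F.fp p := mul_nonneg (mul_nonneg (sq_nonneg _)
      (inv_nonneg.mpr (one_sub_Cp_pos hfix hp).le)) (Nat.cast_nonneg _)
    have : 0 < 1 - 1 / (p : ℝ) := by linarith
    positivity
  · intro p hp
    have hx : 0 < (p : ℝ)⁻¹ := inv_pos.mpr (by exact_mod_cast hp.pos)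
    rw [abs_mul, abs_of_pos hx, one_div]
    exact mul_le_of_le_one_right hx.le (he₃.abs_le_one p)
  · filter_upwards [hloc, eventually_ge_atTop 12] with p hloc hp2 hp
    rw [fp, (hloc hp).2, (hloc hp).1, one_div, div_eq_mul_inv 100, ← inv_pow, div_eq_mul_inv]
    set x := (p : ℝ)⁻¹
    have hx : 0 < x := inv_pos.mpr (by exact_mod_cast hp.pos)
    have hx2 : x ≤ 1 / 12 := by
      rw [one_div]
      exact inv_anti₀ (by norm_num) (by exact_mod_cast hp2)
    obtain ⟨h1, h1'⟩ := abs_le.mp (he₁.abs_le_one p)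
    obtain ⟨h2, h2'⟩ := abs_le.mp (he₂.abs_le_one p)
    obtain ⟨h3, h3'⟩ := abs_le.mp (he₃.abs_le_one p)
    set c := (2 + e₁ p + e₂ p) * x + (1 + e₃ p) * x ^ 2 with hc
    have hc0 : 0 ≤ c := by
      have a1 : 0 ≤ 2 + e₁ p + e₂ p := by linarith
      have a2 : 0 ≤ 1 + e₃ p := by linarith
      positivity
    have hc6 : c ≤ 6 * x := by
      have a1 : (2 + e₁ p + e₂ p) * x ≤ 4 * x := mul_le_mul_of_nonneg_right (by linarith) hx.le
      nlinarith
    have hc2 : 1 / 2 ≤ 1 - c := by linarith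
    have hinv : (1 - c)⁻¹ ≤ 2 := by
      rw [inv_le_comm₀ (by linarith) (by norm_num)]
      linarith
    have hne : 1 - c ≠ 0 := by linarith
    -- `f(p) = ρ(p) + O(1 / p)`
    have key : (1 - x) * (1 + (1 - x) ^ 2 * (1 - c)⁻¹ * (1 + e₃ p) * x) - (1 + x * e₃ p) =
        (1 + e₃ p) * (x * ((1 - x) ^ 3 - 1 + c)) * (1 - c)⁻¹ := by
      field_simp
      ring
    have h6 : |(1 - x) ^ 3 - 1 + c| ≤ 9 * x := by
      rw [abs_le]
      constructor <;> nlinarith [mul_pos hx hx, mul_pos (mul_pos hx hx) hx]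
    rw [key, abs_mul, abs_mul, abs_mul, abs_of_pos hx,
      abs_of_nonneg (by linarith : 0 ≤ 1 + e₃ p),
      abs_of_pos (inv_pos.mpr (by linarith : 0 < 1 - c))]
    have h7 : 1 + e₃ p ≤ 2 := by linarith
    have h8 : 0 ≤ (1 - c)⁻¹ := inv_nonneg.mpr (by linarith)
    calc _ ≤ 2 * (x * (9 * x)) * 2 := by gcongr
      _ ≤ _ := by nlinarith [mul_pos hx hx]

end MNTFamily

/-! ### Comparison of Euler products -/

theorem HasEulerProduct.le_of_le {F G : ℕ → ℝ} {L M : ℝ} (hF : HasEulerProduct F L)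
    (hG : HasEulerProduct G M) (h0 : ∀ p : ℕ, p.Prime → 0 ≤ F p)
    (h : ∀ p : ℕ, p.Prime → F p ≤ G p) : L ≤ M :=
  le_of_tendsto_of_tendsto' hF hG fun _ => Finset.prod_le_prod
    (fun p hp => h0 p (Finset.mem_filter.mp hp).2) fun p hp => h p (Finset.mem_filter.mp hp).2

theorem HasEulerProduct.nonneg {F : ℕ → ℝ} {L : ℝ} (hF : HasEulerProduct F L)
    (h0 : ∀ p : ℕ, p.Prime → 0 ≤ F p) : 0 ≤ L :=
  ge_of_tendsto' hF fun _ => Finset.prod_nonneg fun p hp => h0 p (Finset.mem_filter.mp hp).2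

namespace MNTFamily

variable {F : MNTFamily}

/-! ### The mean value of the local factors -/

theorem fp_nonneg (hfix : NoFixedPrimeDivisor (F.r * F.q * F.Delta0)) {p : ℕ} (hp : p.Prime) :
    0 ≤ F.fp p :=
  mul_nonneg (mul_nonneg (sq_nonneg _) (inv_nonneg.mpr (one_sub_Cp_pos hfix hp).le))
    (Nat.cast_nonneg _)

theorem exists_gamma_le (hirr : Irreducible (F.Delta.map (Int.castRingHom ℚ)))
    (hfix : NoFixedPrimeDivisor (F.r * F.q * F.Delta0)) :
    ∃ B : ℝ, ∀ p : ℕ, p.Prime → ∀ k, |F.gamma p k| ≤ B := by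
  obtain ⟨K, hK0, hK⟩ := exists_rootCount_le hirr hfix
  obtain ⟨-, M, hM⟩ := exists_inv_one_sub_Cp_le hirr hfix
  refine ⟨max 1 (K * M), fun p hp k => ?_⟩
  rw [abs_of_nonneg (gamma_nonneg hfix hp k)]
  rcases Nat.eq_zero_or_pos k with rfl | hk
  · simp [gamma]
  · refine le_trans ?_ (le_max_right _ _)
    rw [gamma_eq F hp hk]
    have h1 := hK p hp (2 * k)
    have h2 : 0 ≤ (rootCount (F.q * F.r) F.Delta0 p (2 * k + 2) : ℝ) * ((p : ℝ)⁻¹) ^ 2 := by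
      positivity
    have h3 := inv_nonneg.mpr (one_sub_Cp_pos hfix hp).le
    exact mul_le_mul (by linarith) (hM p hp) h3 hK0

/-- At a prime `p` the function `gamma` differs from a shifted real character by `O(1 / p)`. -/
theorem exists_gamma_one_sub_le (hirr : Irreducible (F.Delta.map (Int.castRingHom ℚ)))
    (hfix : NoFixedPrimeDivisor (F.r * F.q * F.Delta0)) :
    ∃ (e : ℕ → ℝ) (L C : ℝ), IsRealCharacter e L ∧
      ∀ p : ℕ, p.Prime → |F.gamma p 1 - (1 + e p)| ≤ C / p := by
  obtain ⟨K, hK0, hK⟩ := exists_rootCount_le hirr hfix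
  obtain ⟨⟨C, hC⟩, M, hM⟩ := exists_inv_one_sub_Cp_le hirr hfix
  obtain ⟨_, _, e, _, _, L, _, _, he, hloc⟩ := exists_isRealCharacter_local hirr hfix
  obtain ⟨C', hC'⟩ := exists_forall_prime_le (x := fun p => |F.gamma p 1 - (1 + e p)|)
    (y := fun p => (p : ℝ)⁻¹) (C := (K + |C| * 2) * M)
    (fun p hp => inv_pos.mpr (by exact_mod_cast hp.pos)) (by
      filter_upwards [hloc] with p hloc hp
      have hx : 0 < (p : ℝ)⁻¹ := inv_pos.mpr (by exact_mod_cast hp.pos)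
      have hx1 : (p : ℝ)⁻¹ ≤ 1 := inv_le_one_of_one_le₀ (by exact_mod_cast hp.one_le)
      have hpos := one_sub_Cp_pos hfix hp
      have hM' := hM p hp
      have hC2 := hC p hp
      have h4 := hK p hp 4
      have h4' : 0 ≤ (rootCount (F.q * F.r) F.Delta0 p 4 : ℝ) := Nat.cast_nonneg _
      have hrho := (hloc hp).1
      have hc0 : 0 ≤ (F.Cp p : ℝ) / (p : ℝ) ^ 2 := by positivity
      have he' := abs_le.mp (he.abs_le_one p)
      have h2 : (rootCount (F.q * F.r) F.Delta0 p 2 : ℝ) = 1 + e p := by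
        rw [← hrho, rho_eq]
      rw [gamma_eq F hp le_rfl]
      simp only [mul_one]
      norm_num only
      rw [h2]
      set x := (p : ℝ)⁻¹
      set c := (F.Cp p : ℝ) / (p : ℝ) ^ 2
      set R := (rootCount (F.q * F.r) F.Delta0 p 4 : ℝ)
      have hne : 1 - c ≠ 0 := hpos.ne'
      have hi := inv_nonneg.mpr hpos.le
      have key : (1 + e p - R * x ^ 2) * (1 - c)⁻¹ - (1 + e p) =
          (c * (1 + e p) - R * x ^ 2) * (1 - c)⁻¹ := by
        field_simp
        ring
      have hcC : c ≤ |C| * x := hC2.trans (mul_le_mul_of_nonneg_right (le_abs_self C) hx.le)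
      have hb : |c * (1 + e p) - R * x ^ 2| ≤ (K + |C| * 2) * x := by
        have a1 : c * (1 + e p) ≤ |C| * x * 2 := by
          refine mul_le_mul hcC (by linarith) (by linarith) (by positivity)
        have a2 : 0 ≤ c * (1 + e p) := mul_nonneg hc0 (by linarith)
        have a3 : R * x ^ 2 ≤ K * x := by
          refine mul_le_mul h4 ?_ (by positivity) hK0
          nlinarith
        have a4 : 0 ≤ R * x ^ 2 := by positivity
        have a5 : 0 ≤ K * x := by positivity
        have a6 : 0 ≤ |C| * x := by positivity
        rw [abs_le]
        constructor <;> nlinarith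
      rw [key, abs_mul, abs_of_nonneg hi]
      calc _ ≤ (K + |C| * 2) * x * M := mul_le_mul hb hM' hi (by positivity)
        _ = _ := by ring)
  exact ⟨e, L, C', he, fun p hp => by rw [div_eq_mul_inv]; exact hC' p hp⟩

/-- The telescoping estimate behind the comparison of the two Euler products. -/
theorem sum_gamma_ge (hfix : NoFixedPrimeDivisor (F.r * F.q * F.Delta0)) {p : ℕ} (hp : p.Prime)
    (J : ℕ) :
    1 + (rootCount (F.q * F.r) F.Delta0 p 2 * (p : ℝ)⁻¹ -
      rootCount (F.q * F.r) F.Delta0 p (2 * J + 2) * ((p : ℝ)⁻¹) ^ (J + 1)) *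
        (1 - (F.Cp p : ℝ) / (p : ℝ) ^ 2)⁻¹ ≤
      ∑ j ∈ Finset.range (J + 1), F.gamma p j * ((p : ℝ)⁻¹) ^ j := by
  have hx : 0 < (p : ℝ)⁻¹ := inv_pos.mpr (by exact_mod_cast hp.pos)
  have hx1 : (p : ℝ)⁻¹ ≤ 1 := inv_le_one_of_one_le₀ (by exact_mod_cast hp.one_le)
  have hi := inv_nonneg.mpr (one_sub_Cp_pos hfix hp).le
  induction J with
  | zero => simp [gamma]
  | succ J ih =>
    rw [Finset.sum_range_succ, gamma_eq F hp (Nat.le_add_left 1 J)]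
    refine le_trans ?_ (add_le_add_left ih _)
    set x := (p : ℝ)⁻¹
    set v := (1 - (F.Cp p : ℝ) / (p : ℝ) ^ 2)⁻¹
    have e1 : 2 * (J + 1) = 2 * J + 2 := by ring
    rw [e1]
    set R := (rootCount (F.q * F.r) F.Delta0 p (2 * J + 2 + 2) : ℝ) with hR
    have hR0 : 0 ≤ R := Nat.cast_nonneg _
    have h : R * x ^ (J + 1) * x ^ 2 * v ≤ R * x ^ (J + 1) * x * v := by
      have : x ^ 2 ≤ x := by nlinarith
      gcongr
    have e2 : x ^ (J + 1 + 1) = x ^ (J + 1) * x := pow_succ _ _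
    rw [e2]
    nlinarith

theorem fp_factor_le (hirr : Irreducible (F.Delta.map (Int.castRingHom ℚ)))
    (hfix : NoFixedPrimeDivisor (F.r * F.q * F.Delta0)) {p : ℕ} (hp : p.Prime) :
    (1 - 1 / (p : ℝ)) * (1 + F.fp p / (p : ℝ)) ≤
      (1 - 1 / (p : ℝ)) * ∑' j, F.gamma p j * ((p : ℝ)⁻¹) ^ j := by
  have hp1 : (1 : ℝ) < p := by exact_mod_cast hp.one_lt
  have hx : 0 < (p : ℝ)⁻¹ := inv_pos.mpr (by linarith)
  have hx1 : (p : ℝ)⁻¹ < 1 := inv_lt_one_of_one_lt₀ hp1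
  have hi := inv_nonneg.mpr (one_sub_Cp_pos hfix hp).le
  obtain ⟨B, hB⟩ := exists_gamma_le hirr hfix
  obtain ⟨K, hK0, hK⟩ := exists_rootCount_le hirr hfix
  have hgeo := summable_geometric_of_lt_one hx.le hx1
  have hs : Summable fun j => F.gamma p j * ((p : ℝ)⁻¹) ^ j := by
    refine Summable.of_norm_bounded (hgeo.mul_left B) fun j => ?_
    rw [Real.norm_eq_abs, abs_mul, abs_of_pos (pow_pos hx j)]
    exact mul_le_mul_of_nonneg_right (hB p hp j) (pow_pos hx j).le
  have hlim : Tendsto (fun J : ℕ => (rootCount (F.q * F.r) F.Delta0 p (2 * J + 2) : ℝ) *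
      ((p : ℝ)⁻¹) ^ (J + 1)) atTop (𝓝 0) := by
    refine squeeze_zero (fun J => by positivity)
      (fun J => mul_le_mul_of_nonneg_right (hK p hp _) (by positivity)) ?_
    simpa using ((tendsto_add_atTop_iff_nat 1).mpr
      (tendsto_pow_atTop_nhds_zero_of_lt_one hx.le hx1)).const_mul K
  have hle := le_of_tendsto_of_tendsto'
    (((hlim.const_sub (rootCount (F.q * F.r) F.Delta0 p 2 * (p : ℝ)⁻¹)).mul_const
      (1 - (F.Cp p : ℝ) / (p : ℝ) ^ 2)⁻¹).const_add 1)
    ((tendsto_add_atTop_iff_nat 1).mpr hs.hasSum.tendsto_sum_nat) (sum_gamma_ge hfix hp)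
  have h1 : 0 ≤ 1 - 1 / (p : ℝ) := by rw [one_div]; linarith
  refine mul_le_mul_of_nonneg_left (le_trans ?_ hle) h1
  rw [fp, rho_eq, sub_zero, div_eq_mul_inv _ (p : ℝ)]
  have h2 : (1 - 1 / (p : ℝ)) ^ 2 ≤ 1 := pow_le_one₀ h1 (by rw [one_div]; linarith)
  have h3 : 0 ≤ (1 - (F.Cp p : ℝ) / (p : ℝ) ^ 2)⁻¹ *
    (rootCount (F.q * F.r) F.Delta0 p 2 : ℝ) * (p : ℝ)⁻¹ := by positivity
  nlinarith [mul_le_mul_of_nonneg_right h2 h3]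

/-- The mean value of the local factors is at least the second Euler product. -/
theorem exists_tendsto_sum_gamma (hirr : Irreducible (F.Delta.map (Int.castRingHom ℚ)))
    (hfix : NoFixedPrimeDivisor (F.r * F.q * F.Delta0)) {S : ℝ}
    (hS : HasEulerProduct (fun p => (1 - 1 / (p : ℝ)) * (1 + F.fp p / (p : ℝ))) S) :
    0 ≤ S ∧ ∃ c, S ≤ c ∧ Tendsto (fun n : ℕ =>
      (∑ m ∈ Finset.Ioc 0 n, (m : ℝ)⁻¹ * ArithmeticFunction.ofLocal F.gamma m) / Real.log n)
        atTop (𝓝 c) := by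
  obtain ⟨e, L, C, he, hC⟩ := exists_gamma_one_sub_le hirr hfix
  obtain ⟨B, hB⟩ := exists_gamma_le hirr hfix
  obtain ⟨c, hc, hlim⟩ := ArithmeticFunction.exists_tendsto_sum_divId_ofLocal_div_log he
    (γ := F.gamma) (fun p => by simp [gamma]) hB hC
  have h0 : ∀ p : ℕ, p.Prime → 0 ≤ (1 - 1 / (p : ℝ)) * (1 + F.fp p / (p : ℝ)) := by
    intro p hp
    have hp1 : (1 : ℝ) ≤ p := by exact_mod_cast hp.one_le
    have h1 : 1 / (p : ℝ) ≤ 1 := by rw [div_le_one (by linarith)]; exact hp1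
    have := fp_nonneg hfix hp
    exact mul_nonneg (by linarith) (by positivity)
  refine ⟨hS.nonneg h0, c, hS.le_of_le hc h0 fun p hp => fp_factor_le hirr hfix hp, ?_⟩
  simpa only [ArithmeticFunction.divId_apply] using hlim

end MNTFamily

namespace MNTFamily

variable {F : MNTFamily}

/-! ### The conjecture for the polynomials of a family -/

theorem coeff_eq_of_quadratic_eq {A B C' A' B' C'' : ℤ}
    (h : (C A * X ^ 2 + C B * X + C C' : ℤ[X]) = C A' * X ^ 2 + C B' * X + C C'') :
    A = A' ∧ B = B' := by
  have h2 := congrArg (fun f => coeff f 2) h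
  have h1 := congrArg (fun f => coeff f 1) h
  simp only [coeff_add, coeff_C_mul, coeff_X_pow, coeff_X, coeff_C] at h1 h2
  norm_num at h1 h2
  exact ⟨h2, h1⟩

variable (F) in
theorem r_ne_q : F.r ≠ F.q := by
  intro h
  have h1 := F.C_d_mul_r
  rw [h, F.C_d_mul_q] at h1
  obtain ⟨h2, h3⟩ := coeff_eq_of_quadratic_eq h1
  have ha := F.ha
  have hh : (F.h : ℤ) = 1 := mul_right_cancel₀ (pow_ne_zero 2 ha) (by rw [h2, one_mul])
  rw [hh, one_mul, add_eq_left] at h3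
  have := F.d_pos
  rcases mul_eq_zero.mp h3 with h3 | h3
  · omega
  · exact ha h3

theorem r_ne_Delta0 : F.r ≠ F.Delta0 := by
  intro h
  have h1 := F.C_d_mul_r
  rw [h, F.C_d_mul_Delta0] at h1
  obtain ⟨h2, h3⟩ := coeff_eq_of_quadratic_eq h1
  have ha := F.ha
  have hh : (4 * F.h - F.d : ℤ) = 1 := mul_right_cancel₀ (pow_ne_zero 2 ha) (by rw [h2, one_mul])
  have h4 : 4 * (F.epsilon * F.h - F.d) = F.epsilon := mul_right_cancel₀ ha (by
    rw [hh] at h3; linarith)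
  have := F.epsilon_pos
  have := F.epsilon_lt_four
  omega

theorem q_ne_Delta0 (hirr : Irreducible (F.Delta.map (Int.castRingHom ℚ))) : F.q ≠ F.Delta0 := by
  intro h
  have h1 := F.C_d_mul_q
  rw [h, F.C_d_mul_Delta0] at h1
  obtain ⟨h2, h3⟩ := coeff_eq_of_quadratic_eq h1
  have ha := F.ha
  have hh : (4 * F.h - F.d : ℤ) = F.h := mul_right_cancel₀ (pow_ne_zero 2 ha) h2
  have h4 : 4 * (F.epsilon * F.h - F.d) = F.epsilon * F.h - F.d := mul_right_cancel₀ ha (by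
    rw [hh] at h3; linarith)
  exact epsilon_mul_h_sub_d_ne_zero hirr (by omega)

/-- The local factor at a prime `p` of the progression `β mod m ^ 2`, relative to that of all
integers. -/
noncomputable def localRatio (F : MNTFamily) (m : ℕ) (β : ℤ) (p : ℕ) : ℝ :=
  (1 - (localCount ![F.r, F.q] F.Delta0 m β p : ℝ) / (p : ℝ) ^ 2) *
    (1 - (F.Cp p : ℝ) / (p : ℝ) ^ 2)⁻¹

theorem localCount_eq (m : ℕ) (β : ℤ) (p : ℕ) : localCount ![F.r, F.q] F.Delta0 m β p =
    countMod (p ^ 2) (fun j => BadAt (F.q * F.r) F.Delta0 m p (β + j * (m : ℤ) ^ 2)) := by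
  classical
  rw [localCount, ← countMod_eq]
  congr! 2
  simp only [BadAt, Fin.prod_univ_two, eval_mul, Matrix.cons_val_zero, Matrix.cons_val_one]
  rw [mul_comm (eval _ F.r)]

theorem localCount_of_not_dvd {m : ℕ} (hm : 0 < m) {β : ℤ} (hβ : (m : ℤ) ^ 2 ∣ F.Delta0.eval β)
    {p : ℕ} (hp : p.Prime) (hpm : ¬ p ∣ m) : localCount ![F.r, F.q] F.Delta0 m β p = F.Cp p := by
  rw [localCount_eq, countMod_badAt_of_not_dvd hm hβ hp hpm, Cp_eq]

theorem localCount_le (m : ℕ) (β : ℤ) (p : ℕ) :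
    localCount ![F.r, F.q] F.Delta0 m β p ≤ p ^ 2 := by
  rw [localCount_eq]
  exact countMod_le _ _

theorem hasEulerProduct_localCount (hfix : NoFixedPrimeDivisor (F.r * F.q * F.Delta0)) {S : ℝ}
    (hS : HasEulerProduct (fun p => (1 - (F.Cp p : ℝ) / (p : ℝ) ^ 2) *
      ((1 - 1 / (p : ℝ)) ^ 2)⁻¹) S) {m : ℕ} (hm : 0 < m) {β : ℤ}
    (hβ : (m : ℤ) ^ 2 ∣ F.Delta0.eval β) :
    HasEulerProduct (fun p => (1 - (localCount ![F.r, F.q] F.Delta0 m β p : ℝ) / (p : ℝ) ^ 2) *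
      ((1 - 1 / (p : ℝ)) ^ 2)⁻¹) (S * ∏ p ∈ m.primeFactors, F.localRatio m β p) := by
  refine Tendsto.congr' ?_ (hS.mul_const _)
  filter_upwards [eventually_ge_atTop m] with N hN
  have hsub : m.primeFactors = ((Finset.range (N + 1)).filter Nat.Prime).filter (· ∣ m) := by
    ext p
    simp only [Nat.mem_primeFactors, Finset.mem_filter, Finset.mem_range]
    constructor
    · rintro ⟨h1, h2, -⟩
      exact ⟨⟨by have := Nat.le_of_dvd hm h2; omega, h1⟩, h2⟩
    · rintro ⟨⟨-, h1⟩, h2⟩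
      exact ⟨h1, h2, hm.ne'⟩
  rw [hsub, Finset.prod_filter (· ∣ m), ← Finset.prod_mul_distrib]
  refine Finset.prod_congr rfl fun p hp => ?_
  have hpp := (Finset.mem_filter.mp hp).2
  have hne := (one_sub_Cp_pos hfix hpp).ne'
  split_ifs with h
  · rw [localRatio]
    field_simp
  · rw [mul_one, localCount_of_not_dvd hm hβ hpp h]

theorem sum_prod_localRatio {m : ℕ} (hm : 0 < m) :
    ∑ β ∈ (Finset.range (m ^ 2)).filter (fun β : ℕ => (m : ℤ) ^ 2 ∣ F.Delta0.eval (β : ℤ)),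
      ∏ p ∈ m.primeFactors, F.localRatio m β p = ArithmeticFunction.ofLocal F.gamma m := by
  simp only [localRatio, Finset.prod_mul_distrib, localCount_eq]
  rw [← Finset.sum_mul, sum_prod_local_density hm, ArithmeticFunction.ofLocal_apply hm.ne']
  have h1 : (m : ℝ) ^ 2 = ∏ p ∈ m.primeFactors, (p : ℝ) ^ (2 * m.factorization p) := by
    conv_lhs => rw [← Nat.prod_factorization_pow_eq_self hm.ne', Finsupp.prod]
    rw [Nat.support_factorization]
    push_cast
    rw [← Finset.prod_pow]
    exact Finset.prod_congr rfl fun p _ => by rw [← pow_mul, mul_comm]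
  rw [h1, ← Finset.prod_mul_distrib, ← Finset.prod_mul_distrib]
  refine Finset.prod_congr rfl fun p hp => ?_
  rw [gamma, if_neg]
  exact ((Nat.prime_of_mem_primeFactors hp).factorization_pos_of_dvd hm.ne'
    (Nat.dvd_of_mem_primeFactors hp)).ne'

/-- The conjecture, summed over the residue classes `β` modulo `m ^ 2` with `m ^ 2 ∣ Δ₀(β)`. -/
theorem exists_le_sum_primeSquarefreeCount (hBH : GeneralizedBatemanHorn)
    (hirr : Irreducible (F.Delta.map (Int.castRingHom ℚ)))
    (hfix : NoFixedPrimeDivisor (F.r * F.q * F.Delta0)) {S : ℝ}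
    (hS : HasEulerProduct (fun p => (1 - (F.Cp p : ℝ) / (p : ℝ) ^ 2) *
      ((1 - 1 / (p : ℝ)) ^ 2)⁻¹) S) {δ ε : ℝ} (hδ : 0 < δ) (hδ1 : δ < 1) (hε : 0 < ε) :
    ∃ X₀ : ℝ, ∀ X : ℝ, X₀ ≤ X → ∀ m : ℕ, 0 < m → (m : ℝ) ^ 2 ≤ X ^ (1 - δ) →
      (1 - ε) * (S * ArithmeticFunction.ofLocal F.gamma m * (X / (m : ℝ) ^ 2) /
        (4 * Real.log X ^ 2)) ≤
      ∑ β ∈ (Finset.range (m ^ 2)).filter (fun β : ℕ => (m : ℤ) ^ 2 ∣ F.Delta0.eval (β : ℤ)),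
        (primeSquarefreeCount ![F.r, F.q] F.Delta0 m β X : ℝ) := by
  have hr := F.r_natDegree
  have hq := F.q_natDegree
  have hD := Delta0_natDegree hirr
  obtain ⟨X₀, hX₀⟩ := hBH 2 ![F.r, F.q] F.Delta0
    (by
      rw [Fin.forall_fin_two]
      exact ⟨⟨F.r_irreducible, by simp [hr.1], hr.2⟩, ⟨F.q_irreducible, by simp [hq.1], hq.2⟩⟩)
    ⟨Delta0_irreducible hirr hfix, by simp [hD.1], hD.2⟩
    (by
      intro i j
      fin_cases i <;> fin_cases j <;> simp [F.r_ne_q, F.r_ne_q.symm])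
    (by
      rw [Fin.forall_fin_two]
      exact ⟨r_ne_Delta0, q_ne_Delta0 hirr⟩)
    (by simpa [Fin.prod_univ_two] using hfix) δ hδ hδ1 ε hε
  refine ⟨X₀, fun X hX m hm hmX => ?_⟩
  rw [← sum_prod_localRatio hm, Finset.mul_sum, Finset.sum_mul, Finset.sum_div, Finset.mul_sum]
  refine Finset.sum_le_sum fun β hβ => ?_
  have hβ := (Finset.mem_filter.mp hβ).2
  by_cases hloc : ∀ p : ℕ, p.Prime → localCount ![F.r, F.q] F.Delta0 m β p < p ^ 2
  · have h := hX₀ X hX m β hm hmX hβ hloc _ (hasEulerProduct_localCount hfix hS hm hβ)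
    simp only [Fin.prod_univ_two, Matrix.cons_val_zero, Matrix.cons_val_one, hr.1, hq.1] at h
    have h4 : ((2 : ℕ) : ℝ) * Real.log X * (((2 : ℕ) : ℝ) * Real.log X) =
        4 * Real.log X ^ 2 := by push_cast; ring
    rw [h4] at h
    linarith [(abs_le.mp h).1]
  · -- a progression with a local obstruction contributes a vanishing term
    push Not at hloc
    obtain ⟨p, hp, hle⟩ := hloc
    have heq := le_antisymm (localCount_le (F := F) m β p) hle
    have hpm : p ∣ m := by
      by_contra hpm
      rw [localCount_of_not_dvd hm hβ hp hpm] at hle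
      exact absurd (Cp_lt hfix hp) (not_lt.mpr hle)
    have h0 : F.localRatio m β p = 0 := by
      have hp0 : (p : ℝ) ^ 2 ≠ 0 := pow_ne_zero 2 (by exact_mod_cast hp.ne_zero)
      rw [localRatio, heq, Nat.cast_pow, div_self hp0, sub_self, zero_mul]
    rw [Finset.prod_eq_zero (Nat.mem_primeFactors.mpr ⟨hp, hpm, hm.ne'⟩) h0]
    simp

end MNTFamily

/-! ### Curves from prime values -/

theorem dvd_of_sq_dvd_squarefree_mul_sq {m k : ℕ} {D : ℤ} (hm : 0 < m) (hD : Squarefree D)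
    (h : (m : ℤ) ^ 2 ∣ D * (k : ℤ) ^ 2) : m ∣ k := by
  obtain ⟨g, a, b, hg, hab, rfl, rfl⟩ := Nat.exists_coprime' (m := m) (n := k)
    (Nat.gcd_pos_of_pos_left _ hm)
  have hg0 : (g : ℤ) ^ 2 ≠ 0 := by positivity
  have h1 : (a : ℤ) ^ 2 ∣ D * (b : ℤ) ^ 2 := by
    refine (mul_dvd_mul_iff_right hg0).mp ?_
    push_cast at h
    rwa [← mul_pow, mul_assoc, ← mul_pow]
  have hcop : IsCoprime ((a : ℤ) ^ 2) ((b : ℤ) ^ 2) := (Nat.isCoprime_iff_coprime.mpr hab).pow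
  have h2 := hcop.dvd_of_dvd_mul_right h1
  have h3 := hD a (by rwa [← sq])
  rw [Int.isUnit_iff_natAbs_eq, Int.natAbs_natCast] at h3
  rw [h3, one_mul]
  exact dvd_mul_left _ _

theorem eq_of_squarefree_mul_sq_eq {m k : ℕ} {D E : ℤ} (hm : 0 < m) (hk : 0 < k)
    (hD : Squarefree D) (hE : Squarefree E) (h : D * (m : ℤ) ^ 2 = E * (k : ℤ) ^ 2) : m = k :=
  Nat.dvd_antisymm (dvd_of_sq_dvd_squarefree_mul_sq hm hE (h ▸ dvd_mul_left _ _))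
    (dvd_of_sq_dvd_squarefree_mul_sq hk hD (h ▸ dvd_mul_left _ _))

namespace MNTFamily

variable {F : MNTFamily}

variable (F) in
theorem u_mul_Delta0_eval (n : ℤ) :
    F.u * F.Delta0.eval n = (F.w0 * n + F.w1) ^ 2 + F.w2 := by
  have h := congrArg (eval n) F.Delta_eq
  rw [Delta] at h
  simpa using h.symm

variable (F) in
theorem eventually_le_abs_t (T : ℤ) : ∀ᶠ n : ℕ in atTop, T ≤ |F.t.eval (n : ℤ)| := by
  filter_upwards [eventually_ge_atTop (T + |F.b|).toNat] with n hn
  have h1 : T + |F.b| ≤ n := Int.toNat_le.mp hn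
  have h2 : 1 ≤ |F.a| := Int.one_le_abs F.ha
  have h3 : |F.a * n| - |F.b| ≤ |F.a * n + F.b| := by
    have := abs_sub_abs_le_abs_sub (F.a * n) (-F.b)
    rwa [abs_neg, sub_neg_eq_add] at this
  rw [t_eval]
  have h4 : (n : ℤ) ≤ |F.a * n| := by
    rw [abs_mul, Nat.abs_cast]
    exact le_mul_of_one_le_left (Nat.cast_nonneg n) h2
  linarith

theorem eventually_Delta0_pos (hirr : Irreducible (F.Delta.map (Int.castRingHom ℚ))) :
    ∀ᶠ n : ℕ in atTop, 0 < F.Delta0.eval (n : ℤ) := by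
  have hd := d_lt_of_irreducible hirr
  have he := F.epsilon_pos
  have he4 := F.epsilon_lt_four
  filter_upwards [F.eventually_le_abs_t (8 * |F.epsilon * F.h - F.d| + 1)] with n hn
  have h1 : F.d * F.Delta0.eval (n : ℤ) = (4 * F.h - F.d) * F.t.eval (n : ℤ) ^ 2 -
      4 * (F.epsilon * F.h - F.d) * F.t.eval (n : ℤ) + 4 * (F.epsilon * F.h - F.d) := by
    rw [F.Delta0_eval, F.q_eval]
    linear_combination (4 * F.h : ℤ) * F.d_mul_r_eval n
  set s := F.epsilon * F.h - F.d
  set T := F.t.eval (n : ℤ)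
  have h2 : 0 < F.d * F.Delta0.eval (n : ℤ) := by
    rw [h1]
    have a1 : T ^ 2 ≤ (4 * F.h - F.d) * T ^ 2 := le_mul_of_one_le_left (sq_nonneg _) (by omega)
    have a2 : s * T ≤ |s| * |T| := by rw [← abs_mul]; exact le_abs_self _
    have a3 : -|s| ≤ s := neg_abs_le s
    have a4 : T ^ 2 = |T| * |T| := by rw [abs_mul_abs_self, sq]
    have a5 : 0 ≤ |s| := abs_nonneg s
    nlinarith
  exact pos_of_mul_pos_right h2 (Nat.cast_nonneg _)

theorem eventually_isCurve (hirr : Irreducible (F.Delta.map (Int.castRingHom ℚ))) :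
    ∀ᶠ n : ℕ in atTop, PrimeValue F.r n → PrimeValue F.q n → ∀ (D : ℤ) (m : ℕ), 0 < m →
      Squarefree D → F.Delta0.eval (n : ℤ) = D * (m : ℤ) ^ 2 → 0 < D ∧ F.IsCurve n D.toNat := by
  filter_upwards [eventually_Delta0_pos hirr, F.eventually_le_abs_t (6 * F.d + 10)]
    with n hpos hT hr hq D m hm hD hDm
  have hm2 : (0 : ℤ) < (m : ℤ) ^ 2 := by positivity
  have hD0 : 0 < D := by
    rw [hDm] at hpos
    exact pos_of_mul_pos_left hpos hm2.le
  have hDn : ((D.toNat : ℕ) : ℤ) = D := Int.toNat_of_nonneg hD0.le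
  refine ⟨hD0, hq, hr, ?_, ?_, ?_, m, hm, ?_⟩
  · -- `|t(n)| < q(n)` because `t(n) ^ 2 < 4 q(n)`
    intro hdvd
    rw [F.Delta0_eval] at hpos
    set T := F.t.eval (n : ℤ)
    have hd0 : (0 : ℤ) ≤ F.d := Nat.cast_nonneg _
    have hT0 : T ≠ 0 := by
      intro h
      rw [h, abs_zero] at hT
      omega
    have h1 := Int.le_of_dvd (abs_pos.mpr hT0) ((dvd_abs _ _).mpr hdvd)
    have h2 : T ^ 2 = |T| * |T| := by rw [abs_mul_abs_self, sq]
    nlinarith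
  · set P := (F.r.eval (n : ℤ)).toNat with hP
    have hPp : P.Prime := hr
    have hrP : (P : ℤ) = F.r.eval (n : ℤ) := by
      refine Int.toNat_of_nonneg ?_
      by_contra h
      rw [not_le] at h
      rw [hP, Int.toNat_of_nonpos h.le] at hPp
      exact Nat.not_prime_zero hPp
    have : Fact P.Prime := ⟨hPp⟩
    -- `r(n) > 6` ensures that `r(n)` does not divide `k`
    have hP6 : 6 < P := by
      have h1 := F.d_mul_r_eval n
      rw [← hrP] at h1
      have he := F.epsilon_pos
      have he4 := F.epsilon_lt_four
      set T := F.t.eval (n : ℤ)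
      have h2 : T ^ 2 = |T| * |T| := by rw [abs_mul_abs_self, sq]
      have h3 : F.epsilon * T ≤ 3 * |T| := by
        calc F.epsilon * T ≤ F.epsilon * |T| :=
              mul_le_mul_of_nonneg_left (le_abs_self T) he.le
          _ ≤ 3 * |T| := mul_le_mul_of_nonneg_right (by omega) (abs_nonneg T)
      have hd : (0 : ℤ) < F.d := by exact_mod_cast F.d_pos
      by_contra h
      have h4 : (P : ℤ) ≤ 6 := by exact_mod_cast not_lt.mp h
      have h5 : (F.d : ℤ) * P ≤ F.d * 6 := mul_le_mul_of_nonneg_left h4 hd.le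
      nlinarith
    have hk0 : ((F.k : ℕ) : ZMod P) ≠ 0 := by
      intro h
      have h1 := Nat.le_of_dvd (by have := F.hk; omega) ((ZMod.natCast_eq_zero_iff _ _).mp h)
      have := F.hk
      omega
    have : NeZero ((F.k : ℕ) : ZMod P) := ⟨hk0⟩
    have hr0 : ((F.r.eval (n : ℤ) : ℤ) : ZMod P) = 0 := by
      rw [← hrP, Int.cast_natCast, ZMod.natCast_self]
    have hqt : ((F.q.eval (n : ℤ) : ℤ) : ZMod P) = ((F.t.eval (n : ℤ) - 1 : ℤ) : ZMod P) := by
      rw [F.q_eval]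
      push_cast
      rw [hr0]
      ring
    have hroot : (cyclotomic F.k (ZMod P)).IsRoot ((F.q.eval (n : ℤ) : ℤ) : ZMod P) := by
      have h1 := congrArg (eval (n : ℤ)) F.cyclotomic_eq
      rw [eval_comp, eval_mul, eval_C] at h1
      have h2 : eval (n : ℤ) (C F.a * X + C F.b - 1) = F.t.eval (n : ℤ) - 1 := by
        rw [t, eval_sub, eval_one]
      rw [h2] at h1
      have h3 := congrArg (Int.castRingHom (ZMod P)) h1
      rw [← eval₂_hom, ← eval_map, map_cyclotomic, map_mul] at h3
      rw [IsRoot.def, hqt]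
      refine h3.trans ?_
      rw [eq_intCast (Int.castRingHom (ZMod P)) (F.r.eval (n : ℤ)), hr0, mul_zero]
    exact (isRoot_cyclotomic_iff.mp hroot).eq_orderOf.symm
  · rw [← Int.squarefree_natCast, hDn]
    exact hD
  · rw [← F.Delta0_eval, hDm, hDn]

theorem Delta0_eval_lt (hirr : Irreducible (F.Delta.map (Int.castRingHom ℚ))) {κ : ℝ} (hκ : 0 < κ)
    (hκu : |(F.w0 : ℝ)| * κ < Real.sqrt F.u) :
    ∀ᶠ z : ℝ in atTop, ∀ n m : ℕ, 0 < m → (n : ℝ) ≤ κ * m * Real.sqrt z →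
      ((F.Delta0.eval (n : ℤ) : ℤ) : ℝ) < z * (m : ℝ) ^ 2 := by
  have hu : (0 : ℝ) < F.u := by exact_mod_cast u_pos hirr
  have hlim : Tendsto (fun z : ℝ => (|(F.w0 : ℝ)| * κ + |(F.w1 : ℝ)| / Real.sqrt z) ^ 2 +
      |(F.w2 : ℝ)| / z) atTop (𝓝 ((|(F.w0 : ℝ)| * κ + 0) ^ 2 + 0)) :=
    (((tendsto_const_nhds.div_atTop Real.tendsto_sqrt_atTop).const_add _).pow 2).add
      (tendsto_const_nhds.div_atTop tendsto_id)
  have hlt : (|(F.w0 : ℝ)| * κ + 0) ^ 2 + 0 < F.u := by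
    rw [add_zero, add_zero]
    exact (Real.lt_sqrt (by positivity)).mp hκu
  filter_upwards [hlim.eventually_lt_const hlt, eventually_gt_atTop 0] with z hz hz0 n m hm hn
  have hs : 0 < Real.sqrt z := Real.sqrt_pos.mpr hz0
  have hss : Real.sqrt z ^ 2 = z := Real.sq_sqrt hz0.le
  have hm1 : (1 : ℝ) ≤ m := by exact_mod_cast hm
  have heq : (F.u : ℝ) * ((F.Delta0.eval (n : ℤ) : ℤ) : ℝ) =
      ((F.w0 : ℝ) * n + F.w1) ^ 2 + F.w2 := by
    exact_mod_cast F.u_mul_Delta0_eval n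
  refine lt_of_mul_lt_mul_left ?_ hu.le
  rw [heq]
  have h1 : |(F.w0 : ℝ) * n + F.w1| ≤ (|(F.w0 : ℝ)| * κ + |(F.w1 : ℝ)| / Real.sqrt z) *
      (m * Real.sqrt z) := by
    calc |(F.w0 : ℝ) * n + F.w1| ≤ |(F.w0 : ℝ)| * n + |(F.w1 : ℝ)| := by
          refine (abs_add_le _ _).trans_eq ?_
          rw [abs_mul, Nat.abs_cast]
      _ ≤ |(F.w0 : ℝ)| * (κ * m * Real.sqrt z) + |(F.w1 : ℝ)| * m := by
          gcongr
          exact le_mul_of_one_le_right (abs_nonneg _) hm1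
      _ = _ := by field_simp
  have h2 : ((F.w0 : ℝ) * n + F.w1) ^ 2 ≤
      (|(F.w0 : ℝ)| * κ + |(F.w1 : ℝ)| / Real.sqrt z) ^ 2 * ((m : ℝ) ^ 2 * z) := by
    rw [← sq_abs]
    calc _ ≤ _ := pow_le_pow_left₀ (abs_nonneg _) h1 2
      _ = _ := by rw [mul_pow, mul_pow, hss]
  have h3 : (F.w2 : ℝ) ≤ |(F.w2 : ℝ)| / z * ((m : ℝ) ^ 2 * z) := by
    calc (F.w2 : ℝ) ≤ |(F.w2 : ℝ)| := le_abs_self _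
      _ ≤ |(F.w2 : ℝ)| * (m : ℝ) ^ 2 :=
        le_mul_of_one_le_right (abs_nonneg _) (one_le_pow₀ hm1)
      _ = _ := by field_simp
  calc _ ≤ ((|(F.w0 : ℝ)| * κ + |(F.w1 : ℝ)| / Real.sqrt z) ^ 2 + |(F.w2 : ℝ)| / z) *
        ((m : ℝ) ^ 2 * z) := by linarith
    _ < F.u * ((m : ℝ) ^ 2 * z) := mul_lt_mul_of_pos_right hz (by positivity)
    _ = _ := by ring

/-- The parameters counted for distinct square parts `m` and residues `β` are distinct, and all
but finitely many of them belong to curves of the family. -/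
theorem exists_sum_primeSquarefreeCount_le_E
    (hirr : Irreducible (F.Delta.map (Int.castRingHom ℚ))) {κ : ℝ} (hκ : 0 < κ)
    (hκu : |(F.w0 : ℝ)| * κ < Real.sqrt F.u) :
    ∃ n₀ : ℕ, ∀ᶠ z : ℝ in atTop, ∀ M : ℕ,
      ((∑ m ∈ Finset.Ioc 0 M, ∑ β ∈ (Finset.range (m ^ 2)).filter
        (fun β : ℕ => (m : ℤ) ^ 2 ∣ F.Delta0.eval (β : ℤ)),
          primeSquarefreeCount ![F.r, F.q] F.Delta0 m β (κ * m * Real.sqrt z) : ℕ) : ℕ∞) ≤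
        F.E z + n₀ := by
  classical
  obtain ⟨n₀, hn₀⟩ := eventually_atTop.mp (eventually_isCurve hirr)
  refine ⟨n₀, ?_⟩
  filter_upwards [Delta0_eval_lt hirr hκ hκu] with z hz M
  set A : (Σ _ : ℕ, ℕ) → Set ℕ := fun i => {n : ℕ | 0 < n ∧ (n : ℝ) ≤ κ * i.1 * Real.sqrt z ∧
    (n : ℤ) ≡ i.2 [ZMOD (i.1 : ℤ) ^ 2] ∧ (∀ j, PrimeValue (![F.r, F.q] j) n) ∧
      ∃ D : ℤ, Squarefree D ∧ F.Delta0.eval (n : ℤ) = D * (i.1 : ℤ) ^ 2} with hA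
  have hfin : ∀ i, (A i).Finite := fun i =>
    (Set.finite_Iic ⌊κ * i.1 * Real.sqrt z⌋₊).subset fun n hn => Nat.le_floor hn.2.1
  set I := (Finset.Ioc 0 M).sigma fun m => (Finset.range (m ^ 2)).filter
    (fun β : ℕ => (m : ℤ) ^ 2 ∣ F.Delta0.eval (β : ℤ)) with hI
  have hdisj : (I : Set (Σ _ : ℕ, ℕ)).PairwiseDisjoint fun i => (hfin i).toFinset := by
    rintro ⟨m, β⟩ hi ⟨k, β'⟩ hi' hne
    rw [Function.onFun, Finset.disjoint_left]
    intro n hn hn'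
    refine hne ?_
    simp only [hI, Finset.coe_sigma, Set.mem_sigma_iff, Finset.mem_coe, Finset.mem_Ioc,
      Finset.mem_filter, Finset.mem_range] at hi hi'
    obtain ⟨-, -, hmod, -, D, hD, hDm⟩ := (Set.Finite.mem_toFinset _).mp hn
    obtain ⟨-, -, hmod', -, D', hD', hDm'⟩ := (Set.Finite.mem_toFinset _).mp hn'
    obtain rfl : m = k :=
      eq_of_squarefree_mul_sq_eq hi.1.1 hi'.1.1 hD hD' (hDm.symm.trans hDm')
    have h1 : (β : ℤ) ≡ β' [ZMOD ((m ^ 2 : ℕ) : ℤ)] := by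
      push_cast
      exact hmod.symm.trans hmod'
    have h2 := (Int.natCast_modEq_iff.mp h1).eq_of_lt_of_lt hi.2.1 hi'.2.1
    rw [h2]
  have hcount : (∑ m ∈ Finset.Ioc 0 M, ∑ β ∈ (Finset.range (m ^ 2)).filter
      (fun β : ℕ => (m : ℤ) ^ 2 ∣ F.Delta0.eval (β : ℤ)),
        primeSquarefreeCount ![F.r, F.q] F.Delta0 m β (κ * m * Real.sqrt z)) =
      (I.biUnion fun i => (hfin i).toFinset).card := by
    rw [Finset.card_biUnion hdisj, hI, Finset.sum_sigma]
    refine Finset.sum_congr rfl fun m _ => Finset.sum_congr rfl fun β _ => ?_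
    rw [← Set.ncard_eq_toFinset_card _ (hfin ⟨m, β⟩)]
    rfl
  rw [hcount, ← Set.encard_coe_eq_coe_finsetCard]
  have hsub : ((I.biUnion fun i => (hfin i).toFinset : Finset ℕ) : Set ℕ) ⊆
      {n : ℕ | 0 < n ∧ ∃ D : ℕ, (D : ℝ) < z ∧ F.IsCurve n D} ∪ (Finset.range n₀ : Set ℕ) := by
    intro n hn
    rw [Finset.mem_coe, Finset.mem_biUnion] at hn
    obtain ⟨⟨m, β⟩, hi, hn⟩ := hn
    simp only [hI, Finset.mem_sigma, Finset.mem_Ioc] at hi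
    obtain ⟨hn0, hnX, -, hprime, D, hD, hDm⟩ := (Set.Finite.mem_toFinset _).mp hn
    rcases Nat.lt_or_ge n n₀ with h | h
    · exact Or.inr (by simpa using h)
    · obtain ⟨hD0, hcurve⟩ := hn₀ n h (hprime 0) (hprime 1) D m hi.1.1 hD hDm
      refine Or.inl ⟨hn0, D.toNat, ?_, hcurve⟩
      have h1 := hz n m hi.1.1 hnX
      rw [hDm] at h1
      have h2 : ((D.toNat : ℕ) : ℝ) = D := by
        exact_mod_cast congrArg (Int.cast (R := ℝ)) (Int.toNat_of_nonneg hD0.le)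
      rw [h2]
      push_cast at h1
      exact lt_of_mul_lt_mul_right h1 (by positivity)
  calc _ ≤ _ := Set.encard_le_encard hsub
    _ ≤ _ := Set.encard_union_le _ _
    _ = _ := by rw [Set.encard_coe_eq_coe_finsetCard, Finset.card_range]; rfl

end MNTFamily

/-! ### Summation over the square parts -/

theorem tendsto_comp_floor_rpow_div_log {H : ℕ → ℝ} {c : ℝ}
    (hH : Tendsto (fun n : ℕ => H n / Real.log n) atTop (𝓝 c)) {a : ℝ} (ha : 0 < a) :
    Tendsto (fun z : ℝ => H ⌊z ^ a⌋₊ / Real.log z) atTop (𝓝 (c * a)) := by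
  have hpow : Tendsto (fun z : ℝ => z ^ a) atTop atTop := tendsto_rpow_atTop ha
  have hfloor : Tendsto (fun z : ℝ => ⌊z ^ a⌋₊) atTop atTop := tendsto_nat_floor_atTop.comp hpow
  have h1 : Tendsto (fun z : ℝ => Real.log ((⌊z ^ a⌋₊ : ℝ) / z ^ a) / Real.log z + a) atTop
      (𝓝 (0 + a)) := by
    refine Tendsto.add_const a (Tendsto.div_atTop (a := Real.log 1) ?_ Real.tendsto_log_atTop)
    exact ((Real.continuousAt_log one_ne_zero).tendsto.comp
      ((tendsto_nat_floor_div_atTop (R := ℝ)).comp hpow))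
  rw [zero_add] at h1
  refine ((hH.comp hfloor).mul h1).congr' ?_
  filter_upwards [eventually_gt_atTop 1, hfloor.eventually_ge_atTop 2] with z hz hf
  have hz0 : 0 < z ^ a := Real.rpow_pos_of_pos (by linarith) a
  have hf2 : (2 : ℝ) ≤ (⌊z ^ a⌋₊ : ℝ) := by exact_mod_cast hf
  have hl : Real.log z ≠ 0 := (Real.log_pos hz).ne'
  have hl2 : Real.log (⌊z ^ a⌋₊ : ℝ) ≠ 0 := (Real.log_pos (by linarith)).ne'
  rw [Function.comp_apply, Real.log_div (by linarith) hz0.ne', Real.log_rpow (by linarith)]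
  field_simp
  ring

theorem tendsto_comp_floor_rpow_div_log' {H : ℕ → ℝ} {c : ℝ}
    (hH : Tendsto (fun n : ℕ => H n / Real.log n) atTop (𝓝 c)) {a : ℝ} (ha : 0 ≤ a) :
    Tendsto (fun z : ℝ => H ⌊z ^ a⌋₊ / Real.log z) atTop (𝓝 (c * a)) := by
  rcases ha.eq_or_lt with rfl | ha
  · simpa using tendsto_const_nhds.div_atTop Real.tendsto_log_atTop
  · exact tendsto_comp_floor_rpow_div_log hH ha

/-- If `∑ g(m)` over `m ≤ x` is asymptotic to `c log x`, then the sum of `g(m) / log² (κ m √z)`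
over `m ≤ z ^ θ` is asymptotically at least `c (1 - η) / log z` as soon as `θ < 1 / 2` is close to
`1 / 2`. With `m = z ^ a` the sum is a Riemann sum for the integral of
`c / (a + 1 / 2) ^ 2` over `0 ≤ a ≤ θ`, which tends to `c` as `θ` tends to `1 / 2`. -/
theorem exists_le_sum_div_log_sq {g : ℕ → ℝ} (h0 : ∀ m, 0 ≤ g m) {c : ℝ} (hc : 0 ≤ c)
    (hg : Tendsto (fun n : ℕ => (∑ m ∈ Finset.Ioc 0 n, g m) / Real.log n) atTop (𝓝 c))
    {κ : ℝ} (hκ : 0 < κ) {η : ℝ} (hη : 0 < η) :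
    ∃ θ : ℝ, 0 ≤ θ ∧ θ < 1 / 2 ∧ ∀ᶠ z : ℝ in atTop, (c - η) / Real.log z ≤
      ∑ m ∈ Finset.Ioc 0 ⌊z ^ θ⌋₊, g m / Real.log (κ * m * Real.sqrt z) ^ 2 := by
  -- the number `J` of blocks `z ^ (i τ) < m ≤ z ^ ((i + 1) τ)`, with `τ = 1 / (2 (J + 2))`
  obtain ⟨J, hJ⟩ : ∃ J : ℕ, c - η <
      c * (2 * ((J : ℝ) + 2) / (J + 3) - 2 * ((J : ℝ) + 2) / (2 * J + 3)) := by
    have h1 : Tendsto (fun J : ℕ => c * (2 * (1 + 2 * (J : ℝ)⁻¹) / (1 + 3 * (J : ℝ)⁻¹) -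
        2 * (1 + 2 * (J : ℝ)⁻¹) / (2 + 3 * (J : ℝ)⁻¹))) atTop
        (𝓝 (c * (2 * (1 + 2 * 0) / (1 + 3 * 0) - 2 * (1 + 2 * 0) / (2 + 3 * 0)))) := by
      have hi : Tendsto (fun J : ℕ => (J : ℝ)⁻¹) atTop (𝓝 0) := tendsto_inv_atTop_nhds_zero_nat
      have hn := ((hi.const_mul 2).const_add 1).const_mul 2
      exact ((hn.div ((hi.const_mul 3).const_add 1) (by norm_num)).sub
        (hn.div ((hi.const_mul 3).const_add 2) (by norm_num))).const_mul c
    rw [show c * (2 * (1 + 2 * 0) / (1 + 3 * 0) - 2 * (1 + 2 * 0) / (2 + 3 * 0)) = c by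
      norm_num] at h1
    obtain ⟨J, hJ, hJ1⟩ := ((h1.eventually_const_lt (show c - η < c by linarith)).and
      (eventually_ge_atTop 1)).exists
    refine ⟨J, ?_⟩
    have hJ0 : (0 : ℝ) < J := by exact_mod_cast hJ1
    have e1 : 2 * ((J : ℝ) + 2) / (J + 3) = 2 * (1 + 2 * (J : ℝ)⁻¹) / (1 + 3 * (J : ℝ)⁻¹) := by
      field_simp
    have e2 : 2 * ((J : ℝ) + 2) / (2 * J + 3) = 2 * (1 + 2 * (J : ℝ)⁻¹) / (2 + 3 * (J : ℝ)⁻¹) := by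
      field_simp
    rw [e1, e2]
    exact hJ
  set τ : ℝ := 1 / (2 * ((J : ℝ) + 2)) with hτ
  have hτ0 : 0 < τ := by positivity
  set y : ℝ → ℕ → ℕ := fun z i => ⌊z ^ ((i : ℝ) * τ)⌋₊ with hy
  set w : ℝ → ℕ → ℝ := fun z i => ((Real.log κ + (1 / 2 + i * τ) * Real.log z) ^ 2)⁻¹ with hw
  set H : ℕ → ℝ := fun n => ∑ m ∈ Finset.Ioc 0 n, g m with hH
  refine ⟨J * τ, by positivity, ?_, ?_⟩
  · rw [hτ, mul_one_div, div_lt_div_iff₀ (by positivity) (by norm_num)]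
    linarith
  have hlim : Tendsto (fun z : ℝ => ∑ i ∈ Finset.range J,
      (H (y z (i + 1)) / Real.log z - H (y z i) / Real.log z) *
        ((Real.log κ / Real.log z + (1 / 2 + ((i + 1 : ℕ) : ℝ) * τ)) ^ 2)⁻¹) atTop
      (𝓝 (∑ i ∈ Finset.range J, (c * (((i + 1 : ℕ) : ℝ) * τ) - c * ((i : ℝ) * τ)) *
        ((0 + (1 / 2 + ((i + 1 : ℕ) : ℝ) * τ)) ^ 2)⁻¹)) := by
    refine tendsto_finsetSum _ fun i _ => ?_
    refine ((tendsto_comp_floor_rpow_div_log' hg (by positivity)).sub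
      (tendsto_comp_floor_rpow_div_log' hg (by positivity))).mul ?_
    refine Tendsto.inv₀ (((tendsto_const_nhds.div_atTop
      Real.tendsto_log_atTop).add_const _).pow 2) ?_
    positivity
  -- the Riemann sum is bounded below by a telescoping sum
  have htel : c * (2 * ((J : ℝ) + 2) / (J + 3) - 2 * ((J : ℝ) + 2) / (2 * J + 3)) ≤
      ∑ i ∈ Finset.range J, (c * (((i + 1 : ℕ) : ℝ) * τ) - c * ((i : ℝ) * τ)) *
        ((0 + (1 / 2 + ((i + 1 : ℕ) : ℝ) * τ)) ^ 2)⁻¹ := by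
    have h1 := Finset.sum_range_sub' (fun i : ℕ => c * (1 / 2 + ((i : ℝ) + 1) * τ)⁻¹) J
    have h2 : c * (1 / 2 + (((0 : ℕ) : ℝ) + 1) * τ)⁻¹ - c * (1 / 2 + ((J : ℝ) + 1) * τ)⁻¹ =
        c * (2 * ((J : ℝ) + 2) / (J + 3) - 2 * ((J : ℝ) + 2) / (2 * J + 3)) := by
      have a1 : 1 / 2 + (((0 : ℕ) : ℝ) + 1) * τ = (J + 3) / (2 * ((J : ℝ) + 2)) := by
        rw [hτ]
        push_cast
        field_simp
        ring
      have a2 : 1 / 2 + ((J : ℝ) + 1) * τ = (2 * J + 3) / (2 * ((J : ℝ) + 2)) := by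
        rw [hτ]
        field_simp
        ring
      rw [a1, a2, inv_div, inv_div, mul_sub]
    rw [← h2, ← h1]
    refine Finset.sum_le_sum fun i _ => ?_
    push_cast
    have hi : (0 : ℝ) ≤ i := Nat.cast_nonneg i
    have hpos : 0 < 1 / 2 + ((i : ℝ) + 1) * τ := by positivity
    have hpos' : 0 < 1 / 2 + ((i : ℝ) + 1 + 1) * τ := by positivity
    have e1 : c * (1 / 2 + ((i : ℝ) + 1) * τ)⁻¹ - c * (1 / 2 + ((i : ℝ) + 1 + 1) * τ)⁻¹ =
        c * τ * ((1 / 2 + ((i : ℝ) + 1) * τ)⁻¹ * (1 / 2 + ((i : ℝ) + 1 + 1) * τ)⁻¹) := by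
      field_simp
      ring
    have e2 : (c * (((i : ℝ) + 1) * τ) - c * ((i : ℝ) * τ)) *
        ((0 + (1 / 2 + ((i : ℝ) + 1) * τ)) ^ 2)⁻¹ =
        c * τ * ((1 / 2 + ((i : ℝ) + 1) * τ)⁻¹ * (1 / 2 + ((i : ℝ) + 1) * τ)⁻¹) := by
      rw [zero_add, sq, mul_inv]
      ring
    rw [e1, e2]
    have h3 : (1 / 2 + ((i : ℝ) + 1 + 1) * τ)⁻¹ ≤ (1 / 2 + ((i : ℝ) + 1) * τ)⁻¹ :=
      inv_anti₀ hpos (by nlinarith)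
    gcongr
  have hκz : Tendsto (fun z : ℝ => κ * Real.sqrt z) atTop atTop :=
    Real.tendsto_sqrt_atTop.const_mul_atTop hκ
  filter_upwards [hlim.eventually_const_lt (hJ.trans_le htel), eventually_gt_atTop 1,
    hκz.eventually_gt_atTop 1] with z hz hz1 hzκ
  have hz0 : 0 < z := by linarith
  have hlog : 0 < Real.log z := Real.log_pos hz1
  have hmono : ∀ i, y z i ≤ y z (i + 1) := fun i => Nat.floor_le_floor
    (Real.rpow_le_rpow_of_exponent_le hz1.le (by push_cast; nlinarith))
  have hblock : ∀ j : ℕ, ∑ i ∈ Finset.range j, (H (y z (i + 1)) - H (y z i)) * w z (i + 1) ≤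
      ∑ m ∈ Finset.Ioc 0 (y z j), g m / Real.log (κ * m * Real.sqrt z) ^ 2 := by
    intro j
    induction j with
    | zero => exact Finset.sum_nonneg fun m _ => div_nonneg (h0 m) (sq_nonneg _)
    | succ j ih =>
      rw [Finset.sum_range_succ, ← Finset.sum_Ioc_consecutive _ (Nat.zero_le (y z j)) (hmono j)]
      refine add_le_add ih ?_
      have h1 : H (y z (j + 1)) - H (y z j) = ∑ m ∈ Finset.Ioc (y z j) (y z (j + 1)), g m := by
        rw [hH]
        simp only
        rw [← Finset.sum_Ioc_consecutive _ (Nat.zero_le (y z j)) (hmono j), add_sub_cancel_left]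
      rw [h1, Finset.sum_mul]
      refine Finset.sum_le_sum fun m hm => ?_
      rw [Finset.mem_Ioc] at hm
      have hm1 : (1 : ℝ) ≤ m := by exact_mod_cast (by omega : 1 ≤ m)
      have hmz : (m : ℝ) ≤ z ^ (((j + 1 : ℕ) : ℝ) * τ) :=
        (Nat.le_floor_iff (Real.rpow_nonneg hz0.le _)).mp hm.2
      have hX : 1 < κ * m * Real.sqrt z := by
        calc 1 < κ * Real.sqrt z := hzκ
          _ ≤ κ * Real.sqrt z * m := le_mul_of_one_le_right (by linarith) hm1
          _ = _ := by ring
      have hlX : 0 < Real.log (κ * m * Real.sqrt z) := Real.log_pos hX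
      have hle : Real.log (κ * m * Real.sqrt z) ≤
          Real.log κ + (1 / 2 + ((j + 1 : ℕ) : ℝ) * τ) * Real.log z := by
        have hs : Real.sqrt z ≠ 0 := (Real.sqrt_pos.mpr hz0).ne'
        rw [Real.log_mul (by positivity) hs, Real.log_mul hκ.ne' (by positivity),
          Real.log_sqrt hz0.le]
        have := Real.log_le_log (by linarith) hmz
        rw [Real.log_rpow hz0] at this
        linarith
      rw [div_eq_mul_inv]
      refine mul_le_mul_of_nonneg_left ?_ (h0 m)
      exact inv_anti₀ (by positivity) (pow_le_pow_left₀ hlX.le hle 2)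
  have hscale : (∑ i ∈ Finset.range J,
      (H (y z (i + 1)) / Real.log z - H (y z i) / Real.log z) *
        ((Real.log κ / Real.log z + (1 / 2 + ((i + 1 : ℕ) : ℝ) * τ)) ^ 2)⁻¹) / Real.log z =
      ∑ i ∈ Finset.range J, (H (y z (i + 1)) - H (y z i)) * w z (i + 1) := by
    rw [Finset.sum_div]
    refine Finset.sum_congr rfl fun i _ => ?_
    have e1 : Real.log κ + (1 / 2 + ((i + 1 : ℕ) : ℝ) * τ) * Real.log z =
        (Real.log κ / Real.log z + (1 / 2 + ((i + 1 : ℕ) : ℝ) * τ)) * Real.log z := by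
      field_simp
    rw [hw]
    simp only
    rw [e1, mul_pow, mul_inv, sq (Real.log z), mul_inv]
    field_simp
  calc (c - η) / Real.log z ≤ _ := div_le_div_of_nonneg_right hz.le hlog.le
    _ = _ := hscale
    _ ≤ _ := hblock J

namespace MNTFamily

variable {F : MNTFamily}

/-! ### The lower bound -/

theorem ofLocal_gamma_nonneg (hfix : NoFixedPrimeDivisor (F.r * F.q * F.Delta0)) (m : ℕ) :
    0 ≤ ArithmeticFunction.ofLocal F.gamma m := by
  rcases Nat.eq_zero_or_pos m with rfl | hm
  · rw [ArithmeticFunction.map_zero]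
  · rw [ArithmeticFunction.ofLocal_apply hm.ne']
    exact Finset.prod_nonneg fun p hp => gamma_nonneg hfix (Nat.prime_of_mem_primeFactors hp) _

/-- For `θ < 1 / 2` the moduli `m ^ 2` with `m ≤ z ^ θ` lie in the range of uniformity of the
conjecture at `X = κ m √z`. -/
theorem eventually_sq_le_rpow {κ θ : ℝ} (hκ : 0 < κ) (hθ0 : 0 ≤ θ) (hθ : θ < 1 / 2) :
    ∃ δ : ℝ, 0 < δ ∧ δ < 1 ∧ ∀ᶠ z : ℝ in atTop, ∀ m : ℕ, 0 < m → m ≤ ⌊z ^ θ⌋₊ →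
      (m : ℝ) ^ 2 ≤ (κ * m * Real.sqrt z) ^ (1 - δ) := by
  -- the condition on `m ≤ z ^ θ` is `m ^ (1 + δ) ≤ (κ √z) ^ (1 - δ)`
  obtain ⟨δ, hδ⟩ : ∃ δ : ℝ, δ = (1 / 2 - θ) / 2 := ⟨_, rfl⟩
  have hδ0 : 0 < δ := by linarith
  have hexp : θ * (1 + δ) < 1 / 2 * (1 - δ) := by nlinarith
  refine ⟨δ, hδ0, by linarith, ?_⟩
  have hlim : Tendsto (fun z : ℝ => κ ^ (1 - δ) * z ^ (1 / 2 * (1 - δ) - θ * (1 + δ)))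
      atTop atTop :=
    (tendsto_rpow_atTop (by linarith)).const_mul_atTop (Real.rpow_pos_of_pos hκ _)
  filter_upwards [hlim.eventually_ge_atTop 1, eventually_gt_atTop 0] with z hz hz0 m hm hmz
  have hm0 : (0 : ℝ) < m := by exact_mod_cast hm
  have hmz' : (m : ℝ) ≤ z ^ θ := (Nat.le_floor_iff (Real.rpow_nonneg hz0.le _)).mp hmz
  have h1 : (m : ℝ) ^ (1 + δ) ≤ z ^ (θ * (1 + δ)) := by
    rw [Real.rpow_mul hz0.le]
    exact Real.rpow_le_rpow hm0.le hmz' (by linarith)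
  have h2 : z ^ (θ * (1 + δ)) ≤ κ ^ (1 - δ) * z ^ (1 / 2 * (1 - δ)) := by
    have h3 := mul_le_mul_of_nonneg_right hz (Real.rpow_nonneg hz0.le (θ * (1 + δ)))
    rwa [one_mul, mul_assoc, ← Real.rpow_add hz0, sub_add_cancel] at h3
  calc (m : ℝ) ^ 2 = (m : ℝ) ^ (1 + δ) * (m : ℝ) ^ (1 - δ) := by
        rw [← Real.rpow_add hm0, show 1 + δ + (1 - δ) = ((2 : ℕ) : ℝ) by norm_num,
          Real.rpow_natCast]
    _ ≤ κ ^ (1 - δ) * z ^ (1 / 2 * (1 - δ)) * (m : ℝ) ^ (1 - δ) :=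
        mul_le_mul_of_nonneg_right (h1.trans h2) (Real.rpow_nonneg hm0.le _)
    _ = _ := by
        rw [Real.mul_rpow (by positivity) (Real.sqrt_nonneg z), Real.mul_rpow hκ.le hm0.le,
          Real.sqrt_eq_rpow, ← Real.rpow_mul hz0.le]
        ring

/-- The lower bound for fixed `κ < √u / |w₀|` and `ε > 0`, up to the finitely many parameters that
are too small to belong to curves. -/
theorem exists_le_E_add (hBH : GeneralizedBatemanHorn)
    (hirr : Irreducible (F.Delta.map (Int.castRingHom ℚ)))
    (hfix : NoFixedPrimeDivisor (F.r * F.q * F.Delta0)) {S₁ S₂ : ℝ}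
    (hS₁ : HasEulerProduct (fun p => (1 - (F.Cp p : ℝ) / (p : ℝ) ^ 2) *
      ((1 - 1 / (p : ℝ)) ^ 2)⁻¹) S₁)
    (hS₂ : HasEulerProduct (fun p => (1 - 1 / (p : ℝ)) * (1 + F.fp p / (p : ℝ))) S₂)
    {κ ε : ℝ} (hκ : 0 < κ) (hκu : |(F.w0 : ℝ)| * κ < Real.sqrt F.u) (hε : 0 < ε) (hε1 : ε < 1) :
    ∃ n₀ : ℕ, ∀ᶠ z : ℝ in atTop, F.E z ≠ ⊤ →
      (1 - ε) * (κ / 4) * S₁ * (S₂ - ε) * (Real.sqrt z / Real.log z) ≤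
        (F.E z).toNat + n₀ := by
  obtain ⟨hS₂0, c, hSc, hmean⟩ := exists_tendsto_sum_gamma hirr hfix hS₂
  have hS₁0 : 0 ≤ S₁ := hS₁.nonneg fun p hp => mul_nonneg (one_sub_Cp_pos hfix hp).le
    (inv_nonneg.mpr (sq_nonneg _))
  obtain ⟨θ, hθ0, hθ, hsum⟩ := exists_le_sum_div_log_sq
    (g := fun m => (m : ℝ)⁻¹ * ArithmeticFunction.ofLocal F.gamma m)
    (fun m => mul_nonneg (by positivity) (ofLocal_gamma_nonneg hfix m)) (hS₂0.trans hSc) hmean hκ hε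
  obtain ⟨δ, hδ0, hδ1, hunif⟩ := eventually_sq_le_rpow hκ hθ0 hθ
  obtain ⟨X₀, hX₀⟩ := exists_le_sum_primeSquarefreeCount hBH hirr hfix hS₁ hδ0 hδ1 hε
  obtain ⟨n₀, hn₀⟩ := exists_sum_primeSquarefreeCount_le_E hirr hκ hκu
  refine ⟨n₀, ?_⟩
  have hκz : Tendsto (fun z : ℝ => κ * Real.sqrt z) atTop atTop :=
    Real.tendsto_sqrt_atTop.const_mul_atTop hκ
  filter_upwards [hsum, hunif, hn₀, hκz.eventually_ge_atTop X₀, eventually_gt_atTop 1]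
    with z hsum hunif hn₀ hzX hz1 hE
  have hlog : 0 < Real.log z := Real.log_pos hz1
  have hcount := hn₀ ⌊z ^ θ⌋₊
  obtain ⟨N, hN⟩ := ENat.ne_top_iff_exists.mp hE
  rw [← hN] at hcount ⊢
  have hcount' : ((∑ m ∈ Finset.Ioc 0 ⌊z ^ θ⌋₊, ∑ β ∈ (Finset.range (m ^ 2)).filter
      (fun β : ℕ => (m : ℤ) ^ 2 ∣ F.Delta0.eval (β : ℤ)),
        primeSquarefreeCount ![F.r, F.q] F.Delta0 m β (κ * m * Real.sqrt z) : ℕ) : ℝ) ≤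
      (N : ℝ) + n₀ := by exact_mod_cast hcount
  rw [ENat.toNat_natCast]
  refine le_trans ?_ hcount'
  push_cast
  have hterm : ∀ m ∈ Finset.Ioc 0 ⌊z ^ θ⌋₊, (1 - ε) * (κ / 4) * S₁ * Real.sqrt z *
      ((m : ℝ)⁻¹ * ArithmeticFunction.ofLocal F.gamma m /
        Real.log (κ * m * Real.sqrt z) ^ 2) ≤
      ∑ β ∈ (Finset.range (m ^ 2)).filter (fun β : ℕ => (m : ℤ) ^ 2 ∣ F.Delta0.eval (β : ℤ)),
        (primeSquarefreeCount ![F.r, F.q] F.Delta0 m β (κ * m * Real.sqrt z) : ℝ) := by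
    intro m hm
    rw [Finset.mem_Ioc] at hm
    have hm1 : (1 : ℝ) ≤ m := by exact_mod_cast hm.1
    have hX : X₀ ≤ κ * m * Real.sqrt z := by
      calc X₀ ≤ κ * Real.sqrt z := hzX
        _ ≤ κ * Real.sqrt z * m := le_mul_of_one_le_right (by positivity) hm1
        _ = _ := by ring
    refine le_trans (le_of_eq ?_) (hX₀ _ hX m hm.1 (hunif m hm.1 hm.2))
    have hm0 : (m : ℝ) ≠ 0 := by linarith
    field_simp
  refine le_trans ?_ (Finset.sum_le_sum hterm)
  rw [← Finset.mul_sum]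
  have hpos : 0 ≤ (1 - ε) * (κ / 4) * S₁ * Real.sqrt z := by
    have : 0 ≤ 1 - ε := by linarith
    positivity
  calc _ = (1 - ε) * (κ / 4) * S₁ * Real.sqrt z * ((S₂ - ε) / Real.log z) := by ring
    _ ≤ (1 - ε) * (κ / 4) * S₁ * Real.sqrt z * ((c - ε) / Real.log z) := by gcongr
    _ ≤ _ := mul_le_mul_of_nonneg_left hsum hpos

theorem eventually_le_E (hBH : GeneralizedBatemanHorn)
    (hirr : Irreducible (F.Delta.map (Int.castRingHom ℚ)))
    (hfix : NoFixedPrimeDivisor (F.r * F.q * F.Delta0)) {S₁ S₂ : ℝ}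
    (hS₁ : HasEulerProduct (fun p => (1 - (F.Cp p : ℝ) / (p : ℝ) ^ 2) *
      ((1 - 1 / (p : ℝ)) ^ 2)⁻¹) S₁)
    (hS₂ : HasEulerProduct (fun p => (1 - 1 / (p : ℝ)) * (1 + F.fp p / (p : ℝ))) S₂)
    {η : ℝ} (hη : 0 < η) :
    ∀ᶠ z : ℝ in atTop, F.E z ≠ ⊤ →
      (Real.sqrt F.u / (4 * |(F.w0 : ℝ)|) * S₁ * S₂ - η) * (Real.sqrt z / Real.log z) ≤
        (F.E z).toNat := by
  have hu : (0 : ℝ) < Real.sqrt F.u := Real.sqrt_pos.mpr (by exact_mod_cast u_pos hirr)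
  have hw : (0 : ℝ) < |(F.w0 : ℝ)| := abs_pos.mpr (by exact_mod_cast w0_ne_zero hirr)
  set S₀ := Real.sqrt F.u / (4 * |(F.w0 : ℝ)|) * S₁ * S₂ with hS₀
  obtain ⟨ε, hlt, hε, hε1⟩ : ∃ ε : ℝ, S₀ - η / 2 <
      (1 - ε) * ((1 - ε) * (Real.sqrt F.u / |(F.w0 : ℝ)|) / 4) * S₁ * (S₂ - ε) ∧ 0 < ε ∧ ε < 1 := by
    have hcont : Tendsto (fun ε : ℝ =>
        (1 - ε) * ((1 - ε) * (Real.sqrt F.u / |(F.w0 : ℝ)|) / 4) * S₁ * (S₂ - ε)) (𝓝[>] 0)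
        (𝓝 ((1 - 0) * ((1 - 0) * (Real.sqrt F.u / |(F.w0 : ℝ)|) / 4) * S₁ * (S₂ - 0))) :=
      Tendsto.mono_left (Continuous.tendsto (by fun_prop) 0) nhdsWithin_le_nhds
    have h0 : (1 - 0) * ((1 - 0) * (Real.sqrt F.u / |(F.w0 : ℝ)|) / 4) * S₁ * (S₂ - 0) = S₀ := by
      rw [hS₀]
      field_simp
      ring
    rw [h0] at hcont
    exact ((hcont.eventually_const_lt (by linarith : S₀ - η / 2 < S₀)).and
      (Ioo_mem_nhdsGT one_pos)).exists
  have hκ : 0 < (1 - ε) * (Real.sqrt F.u / |(F.w0 : ℝ)|) := mul_pos (by linarith) (by positivity)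
  obtain ⟨n₀, hn₀⟩ := exists_le_E_add hBH hirr hfix hS₁ hS₂ hκ
    (by
      rw [show |(F.w0 : ℝ)| * ((1 - ε) * (Real.sqrt F.u / |(F.w0 : ℝ)|)) =
        (1 - ε) * Real.sqrt F.u by field_simp]
      exact mul_lt_of_lt_one_left hu (by linarith)) hε hε1
  have hgrow : Tendsto (fun z : ℝ => η / 2 * (Real.sqrt z / Real.log z)) atTop atTop := by
    refine Tendsto.const_mul_atTop (by linarith) ?_
    have h := (isLittleO_log_rpow_atTop (r := 1 / 2) (by norm_num)).tendsto_div_nhds_zero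
    have h' : Tendsto (fun z : ℝ => Real.log z / z ^ (1 / 2 : ℝ)) atTop (𝓝[>] 0) := by
      refine tendsto_nhdsWithin_iff.mpr ⟨h, ?_⟩
      filter_upwards [eventually_gt_atTop 1] with z hz
      exact div_pos (Real.log_pos hz) (Real.rpow_pos_of_pos (by linarith) _)
    refine h'.inv_tendsto_nhdsGT_zero.congr fun z => ?_
    rw [Pi.inv_apply, inv_div, Real.sqrt_eq_rpow]
  filter_upwards [hn₀, hgrow.eventually_ge_atTop n₀, eventually_gt_atTop 1] with z h1 h2 hz hE
  have h3 := h1 hE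
  have hz0 : 0 ≤ Real.sqrt z / Real.log z := div_nonneg (Real.sqrt_nonneg _) (Real.log_pos hz).le
  have h4 := mul_le_mul_of_nonneg_right hlt.le hz0
  linarith

end MNTFamily

theorem mainTheorem4 (hBH : GeneralizedBatemanHorn) (F : MNTFamily)
    (hirr : Irreducible (F.Delta.map (Int.castRingHom ℚ)))
    (hfix : NoFixedPrimeDivisor (F.r * F.q * F.Delta0)) :
    ∃ S₁ S₂ : ℝ,
      HasEulerProduct (fun p => (1 - (F.Cp p : ℝ) / (p : ℝ) ^ 2) *
        ((1 - 1 / (p : ℝ)) ^ 2)⁻¹) S₁ ∧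
      HasEulerProduct (fun p => (1 - 1 / (p : ℝ)) * (1 + F.fp p / (p : ℝ))) S₂ ∧
      ∃ o : ℝ → ℝ, Tendsto o atTop (𝓝 0) ∧ ∀ᶠ z : ℝ in atTop,
        ENNReal.ofReal
          ((Real.sqrt (F.u : ℝ) / (4 * |(F.w0 : ℝ)|) * S₁ * S₂ + o z) *
            (Real.sqrt z / Real.log z)) ≤ (F.E z : ℝ≥0∞) := by
  obtain ⟨S₁, hS₁⟩ := MNTFamily.exists_hasEulerProduct_Cp hirr hfix
  obtain ⟨S₂, hS₂⟩ := MNTFamily.exists_hasEulerProduct_fp hirr hfix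
  refine ⟨S₁, S₂, hS₁, hS₂, ?_⟩
  set S₀ := Real.sqrt (F.u : ℝ) / (4 * |(F.w0 : ℝ)|) * S₁ * S₂
  classical
  -- the error term is the deficiency of `E(z)` with respect to `S₀ √z / log z`
  refine ⟨fun z => if F.E z = ⊤ then 0 else
    min 0 ((F.E z).toNat / (Real.sqrt z / Real.log z) - S₀), ?_, ?_⟩
  · refine tendsto_order.mpr ⟨fun a ha => ?_, fun a ha => ?_⟩
    · filter_upwards [MNTFamily.eventually_le_E hBH hirr hfix hS₁ hS₂
        (η := -a / 2) (by linarith), eventually_gt_atTop 1] with z hz hz1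
      have hpos : 0 < Real.sqrt z / Real.log z :=
        div_pos (Real.sqrt_pos.mpr (by linarith)) (Real.log_pos hz1)
      split_ifs with h
      · exact ha
      · have h1 := (le_div_iff₀ hpos).mpr (hz h)
        exact lt_min ha (by linarith)
    · filter_upwards with z
      split_ifs
      · exact ha
      · exact (min_le_left _ _).trans_lt ha
  · filter_upwards [eventually_gt_atTop 1] with z hz1
    have hpos : 0 < Real.sqrt z / Real.log z :=
      div_pos (Real.sqrt_pos.mpr (by linarith)) (Real.log_pos hz1)
    by_cases h : F.E z = ⊤
    · rw [h]
      simp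
    · obtain ⟨N, hN⟩ := ENat.ne_top_iff_exists.mp h
      rw [if_neg h, ← hN, ENat.toNat_natCast, ENat.toENNReal_coe]
      refine ENNReal.ofReal_le_of_le_toReal ?_
      rw [ENNReal.toReal_natCast]
      refine (le_div_iff₀ hpos).mp ?_
      linarith [min_le_right 0 ((N : ℝ) / (Real.sqrt z / Real.log z) - S₀)]
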